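/- **Theorem (Approximate attention with spectral norm bound).** For $Q,K,V\in\mathbb{R}^{n\times d}$ ($n,d\ge 1$) with rows $q_i,k_i,v_i$, let $A=\exp(QK^\top/\sqrt d)$ (entrywise), $D=\mathrm{diag}(A\mathbf 1_n)$ and $\mathrm{Att}(Q,K,V)=D^{-1}AV$. Let $\|\cdot\|_{op}$ be the spectral norm and $\mathrm{srank}(M)=\|M\|_F^2/\|M\|_{op}^2$ (with $\mathrm{srank}(0)=0$). For $X,Y\in\mathbb{R}^{n\times d}$ with rows $x_j,y_i$, a positive vector $w\in\mathbb{R}^n$ and $\varepsilon,\tau>0$ let $$\mathcal C_{X,Y,w,\varepsilon,\tau}=\inf_{\mu>0}\ \frac1{\varepsilon^2\mu^\tau}+\left|\left\{i\in[n]:\ \frac{\sum_{j} w_j e^{\langle x_j,y_i\rangle}}{\sum_{j} w_j e^{(\|x_j\|_2^2+\|y_i\|_2^2)/2}}<n\mu\right\}\right| .$$ A *sampling matrix* is a matrix $\Pi\in\mathbb{R}^{m\times n}$ whose $r$-th row is $e_{\ell_r}^\top/\sqrt{m\,p_{\ell_r}}$ for some indices $\ell_1,\dots,\ell_m\in[n]$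 and some probability vector $p$ on $[n]$ with all $p_{\ell_r}>0$. A *fast Gaussian KDE* with exponent $\tau$, constant $C_0$ and failure exponent $a$ consists of two procedures. For every $X\in\mathbb{R}^{n\times d}$ and $\varepsilon,\tilde\mu\in(0,1)$ the first builds a (possibly random) data structure; for every $q\in\mathbb{R}^d$ the second, given this data structure, returns an estimate. With $\mu_X(q)=\frac1n\sum_i e^{-\|q-x_i\|_2^2/2}$, for each fixed $X,\varepsilon,\tilde\mu,q$ the following hold together with probability at least $1-n^{-a}$: building takes time at most $C_0\varepsilon^{-2}dn/\tilde\mu^{\tau}$; the estimate approximates $\mu_X(q)\mathbf 1_{\{\tilde\mu\le\mu_X(q)\}}$ up to relative error $\varepsilon$; the query takes time at most $C_0\varepsilon^{-2}d/(\tilde\mu+\mu_X(q))^\tau$. (A primitive that never fails is a special case.) There is a single algorithm (a program for a randomized real RAM that may call such a primitive, each call being charged the primitive's running time) such that for all $\tau,C_0,c>0$ there are constants $C,a>0$ for which the following holds. Let a fast Gaussian KDE with parameters $\tau,C_0,a$ be given. For all $n,d\ge1$, all $Q,K,V\in\mathbb{R}^{n\times d}$, all $\varepsilon>0$ and every integer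 $$m\ \ge\ C\,\varepsilon^{-2}\log n\,\bigl(\mathrm{srank}(D^{-1}A)+\mathrm{srank}(V)\bigr)$$ (in particular for $m$ equal to this bound rounded up, so that, up to rounding, $m=O(\varepsilon^{-2}\log n\,(\mathrm{srank}(D^{-1}A)+\mathrm{srank}(V)))$ samples suffice), the algorithm on input $Q,K,V,\varepsilon,\tau,m$ outputs, with probability at least $1-n^{-c}$, a diagonal matrix $\widetilde D\in\mathbb{R}^{n\times n}$ with positive diagonal and a sampling matrix $\Pi\in\mathbb{R}^{m\times n}$ such that $$\bigl\|\mathrm{Att}(Q,K,V)-\widetilde D^{-1}A\,\Pi^\top\Pi V\bigr\|_{op}\ \le\ \varepsilon\,\|D^{-1}A\|_{op}\,\|V\|_{op},$$ and it does so in time at most $$C\Bigl(m+nd\bigl(\mathcal C_{\frac{K}{d^{1/4}},\frac{Q}{d^{1/4}},\mathbf 1_n,\varepsilon,\tau}+\mathcal C_{\frac{\sqrt2 Q}{d^{1/4}},\frac{\sqrt2K}{d^{1/4}},v,1,\tau}\bigr)\Bigr),\qquad v_j=\Bigl(\sum_{\ell\in[n]} e^{\langle q_j,k_\ell\rangle/\sqrt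 d}\Bigr)^{-2}.$$ -/

import Mathlib

noncomputable section

namespace KDEAttention

/-! ### Linear algebra: norms, stable rank, attention -/

open scoped Matrix.Norms.L2Operator in
/-- The spectral norm (operator norm between Euclidean spaces) of a real matrix. -/
def opNorm {m n : ℕ} (A : Matrix (Fin m) (Fin n) ℝ) : ℝ := ‖A‖

/-- The squared Frobenius norm. -/
def frobSq {m n : ℕ} (A : Matrix (Fin m) (Fin n) ℝ) : ℝ := ∑ i, ∑ j, A i j ^ 2

/-- The stable rank `‖A‖_F² / ‖A‖_op²` (equal to `0` for the zero matrix). -/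
def srank {m n : ℕ} (A : Matrix (Fin m) (Fin n) ℝ) : ℝ := frobSq A / opNorm A ^ 2

/-- The attention matrix `A = exp(Q Kᵀ / √d)`, entrywise exponential. -/
def attnMatrix {n d : ℕ} (Q K : Matrix (Fin n) (Fin d) ℝ) : Matrix (Fin n) (Fin n) ℝ :=
  Matrix.of fun i j => Real.exp ((Q * K.transpose) i j / Real.sqrt d)

/-- The scaling `D = diag(A 1)`. -/
def attnScale {n d : ℕ} (Q K : Matrix (Fin n) (Fin d) ℝ) : Matrix (Fin n) (Fin n) ℝ :=
  Matrix.diagonal ((attnMatrix Q K).mulVec 1)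

/-- The softmax matrix `D⁻¹ A`. -/
def softmaxMatrix {n d : ℕ} (Q K : Matrix (Fin n) (Fin d) ℝ) : Matrix (Fin n) (Fin n) ℝ :=
  (attnScale Q K)⁻¹ * attnMatrix Q K

/-- Dot-product attention `D⁻¹ A V`. -/
def attention {n d : ℕ} (Q K V : Matrix (Fin n) (Fin d) ℝ) : Matrix (Fin n) (Fin d) ℝ :=
  softmaxMatrix Q K * V

/-- `P` is a sampling matrix: for some probability vector `p` and some indices `ℓ₁, …, ℓ_m` of
positive probability, its `r`-th row is `e_{ℓ_r}ᵀ / √(m p_{ℓ_r})`. -/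
def IsSamplingMatrix {m n : ℕ} (P : Matrix (Fin m) (Fin n) ℝ) : Prop :=
  ∃ (p : Fin n → ℝ) (l : Fin m → Fin n),
    (∀ i, 0 ≤ p i) ∧ ∑ i, p i = 1 ∧ (∀ r, 0 < p (l r)) ∧
    ∀ r i, P r i = if i = l r then 1 / Real.sqrt (m * p (l r)) else 0

/-! ### Data-dependent cost -/

open Classical in
/-- `min_{μ > 0} ε⁻² μ^{-τ} + #{i : (∑ⱼ vⱼ e^{⟨xⱼ,yᵢ⟩}) / (∑ⱼ vⱼ e^{(‖xⱼ‖²+‖yᵢ‖²)/2}) < n μ}`,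
with the minimum read as an infimum. -/
def kdeCost {n d : ℕ} (X Y : Matrix (Fin n) (Fin d) ℝ) (v : Fin n → ℝ) (ε τ : ℝ) : ℝ :=
  ⨅ μ : Set.Ioi (0 : ℝ),
    (1 / (ε ^ 2 * (μ : ℝ) ^ τ) +
      ((Finset.univ.filter fun i : Fin n =>
        (∑ j, v j * Real.exp (X j ⬝ᵥ Y i)) /
          (∑ j, v j * Real.exp ((X j ⬝ᵥ X j + Y i ⬝ᵥ Y i) / 2)) < n * (μ : ℝ)).card : ℝ))

/-- The weights `v_j = (∑_ℓ exp(⟨q_j, k_ℓ⟩ / √d))⁻²`. -/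
def softmaxWeights {n d : ℕ} (Q K : Matrix (Fin n) (Fin d) ℝ) (j : Fin n) : ℝ :=
  ((∑ l, Real.exp (Q j ⬝ᵥ K l / Real.sqrt d)) ^ 2)⁻¹

/-- The rescaled dataset `X / d^{1/4}`. -/
def rescale {n d : ℕ} (X : Matrix (Fin n) (Fin d) ℝ) : Matrix (Fin n) (Fin d) ℝ :=
  ((d : ℝ) ^ (1 / 4 : ℝ))⁻¹ • X

/-! ### Gaussian kernel density estimation -/

/-- The Gaussian kernel density `μ_X(q) = (1/n) ∑ᵢ exp(-‖q - xᵢ‖² / 2)`. -/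
def gaussDensity {n d : ℕ} (X : Matrix (Fin n) (Fin d) ℝ) (q : Fin d → ℝ) : ℝ :=
  1 / n * ∑ i, Real.exp (-((q - X i) ⬝ᵥ (q - X i)) / 2)

/-- The interface of a (possibly randomized) Gaussian KDE primitive. `build X ε μ` returns a data
structure and the time spent; `query S q` returns an answer and the time spent. Random bits used
while answering queries are part of the data structure. -/
structure KDEPrimitive where
  DS : Type
  build : {n d : ℕ} → Matrix (Fin n) (Fin d) ℝ → ℝ → ℝ → PMF (DS × ℕ)
  query : {d : ℕ} → DS → (Fin d → ℝ) → ℝ × ℕ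

/-- A fast Gaussian KDE with exponent `τ` and hidden constant `C`: for every dataset `X` of `n`
points in dimension `d`, all `ε, μ ∈ (0,1)` and every query `q`, except with probability at most
`n^{-a}`, building the data structure takes time `≤ C ε⁻² d n / μ^τ`, the answer approximates
`μ_X(q) 1_{μ ≤ μ_X(q)}` to relative error `ε`, and the query takes time
`≤ C ε⁻² d / (μ + μ_X(q))^τ`. A primitive that never fails is a special case. -/
def KDEPrimitive.IsFast (𝒦 : KDEPrimitive) (τ C a : ℝ) : Prop :=
  ∀ (n d : ℕ), 0 < n → 0 < d → ∀ (X : Matrix (Fin n) (Fin d) ℝ) (ε μ : ℝ),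
    ε ∈ Set.Ioo (0 : ℝ) 1 → μ ∈ Set.Ioo (0 : ℝ) 1 → ∀ q : Fin d → ℝ,
    (𝒦.build X ε μ).toOuterMeasure
      {r | ¬ ((r.2 : ℝ) ≤ C * (d * n / (ε ^ 2 * μ ^ τ)) ∧
        (μ ≤ gaussDensity X q → |(𝒦.query r.1 q).1 - gaussDensity X q| ≤ ε * gaussDensity X q) ∧
        (gaussDensity X q < μ → (𝒦.query r.1 q).1 = 0) ∧
        ((𝒦.query r.1 q).2 : ℝ) ≤ C * (d / (ε ^ 2 * (μ + gaussDensity X q) ^ τ)))}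
      ≤ ENNReal.ofReal ((n : ℝ) ^ (-a))

/-! ### A randomized real RAM with a KDE primitive

Memory consists of two-dimensional arrays, numbered by naturals, of naturals (used for counters
and addresses) and of reals, and of registers holding KDE data structures. Every node of an
expression and every command costs one step; a call of the primitive costs in addition the time
that the primitive reports. -/

/-- Index expressions. -/
inductive NExpr
  | const (k : ℕ)
  | cell (a : ℕ) (i j : NExpr)
  | add (e f : NExpr)
  | sub (e f : NExpr)

/-- Real expressions. -/
inductive RExpr
  | const (q : ℚ)
  | ofNat (e : NExpr)
  | cell (a : ℕ) (i j : NExpr)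
  | add (e f : RExpr)
  | sub (e f : RExpr)
  | mul (e f : RExpr)
  | div (e f : RExpr)
  | exp (e : RExpr)
  | log (e : RExpr)
  | sqrt (e : RExpr)

/-- Tests. -/
inductive BExpr
  | natLe (e f : NExpr)
  | realLe (e f : RExpr)
  | not (b : BExpr)
  | and (b c : BExpr)

/-- Programs. `unif a i j k` stores a uniformly random element of `{0, …, k - 1}` in the natural
cell `a[i,j]`. `build s b rows cols ε μ` runs the preprocessing of the primitive on the first
`rows` rows and `cols` columns of the real array `b`, with result in register `s`.
`query a i j s b row cols` queries register `s` at the first `cols` entries of row `row` of the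
real array `b`, with the answer stored in the real cell `a[i,j]`. -/
inductive Cmd
  | skip
  | setN (a : ℕ) (i j e : NExpr)
  | setR (a : ℕ) (i j : NExpr) (e : RExpr)
  | unif (a : ℕ) (i j k : NExpr)
  | build (s b : ℕ) (rows cols : NExpr) (ε μ : RExpr)
  | query (a : ℕ) (i j : NExpr) (s b : ℕ) (row cols : NExpr)
  | seq (c₁ c₂ : Cmd)
  | ite (b : BExpr) (c₁ c₂ : Cmd)
  | loop (b : BExpr) (c : Cmd)

/-- Machine states, with a step counter `time`. -/
structure State (DS : Type) where
  nat : ℕ → ℕ → ℕ → ℕ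
  real : ℕ → ℕ → ℕ → ℝ
  ds : ℕ → Option DS
  time : ℕ

/-- Overwriting one cell of a family of arrays. -/
def setCell {α : Type} (f : ℕ → ℕ → ℕ → α) (a i j : ℕ) (x : α) : ℕ → ℕ → ℕ → α :=
  fun a' i' j' => if a' = a ∧ i' = i ∧ j' = j then x else f a' i' j'

def NExpr.eval {DS : Type} (s : State DS) : NExpr → ℕ
  | .const k => k
  | .cell a i j => s.nat a (i.eval s) (j.eval s)
  | .add e f => e.eval s + f.eval s
  | .sub e f => e.eval s - f.eval s

def NExpr.size : NExpr → ℕ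
  | .const _ => 1
  | .cell _ i j => i.size + j.size + 1
  | .add e f => e.size + f.size + 1
  | .sub e f => e.size + f.size + 1

def RExpr.eval {DS : Type} (s : State DS) : RExpr → ℝ
  | .const q => q
  | .ofNat e => (e.eval s : ℝ)
  | .cell a i j => s.real a (i.eval s) (j.eval s)
  | .add e f => e.eval s + f.eval s
  | .sub e f => e.eval s - f.eval s
  | .mul e f => e.eval s * f.eval s
  | .div e f => e.eval s / f.eval s
  | .exp e => Real.exp (e.eval s)
  | .log e => Real.log (e.eval s)
  | .sqrt e => Real.sqrt (e.eval s)

def RExpr.size : RExpr → ℕ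
  | .const _ => 1
  | .ofNat e => e.size + 1
  | .cell _ i j => i.size + j.size + 1
  | .add e f => e.size + f.size + 1
  | .sub e f => e.size + f.size + 1
  | .mul e f => e.size + f.size + 1
  | .div e f => e.size + f.size + 1
  | .exp e => e.size + 1
  | .log e => e.size + 1
  | .sqrt e => e.size + 1

def BExpr.Holds {DS : Type} (s : State DS) : BExpr → Prop
  | .natLe e f => e.eval s ≤ f.eval s
  | .realLe e f => e.eval s ≤ f.eval s
  | .not b => ¬ b.Holds s
  | .and b c => b.Holds s ∧ c.Holds s

def BExpr.size : BExpr → ℕ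
  | .natLe e f => e.size + f.size + 1
  | .realLe e f => e.size + f.size + 1
  | .not b => b.size + 1
  | .and b c => b.size + c.size + 1

/-- Advancing the step counter. -/
def State.tick {DS : Type} (s : State DS) (t : ℕ) : State DS := { s with time := s.time + t }

/-- The uniform distribution on `{0, …, k - 1}` (the point mass at `0` if `k = 0`). -/
def unifBelow (k : ℕ) : PMF ℕ :=
  if h : 0 < k then PMF.uniformOfFinset (Finset.range k) ⟨0, Finset.mem_range.2 h⟩ else PMF.pure 0

/-- Running `g` on the outcome of `f`, where `none` stands for a run that was cut off. -/
def andThen {α : Type} (f : PMF (Option α)) (g : α → PMF (Option α)) : PMF (Option α) :=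
  f.bind fun o => o.elim (PMF.pure none) g

open Classical in
/-- At most `k` evaluations of the test of a loop, `none` if this does not suffice. -/
def runLoop {DS : Type} (b : BExpr) (body : State DS → PMF (Option (State DS))) :
    ℕ → State DS → PMF (Option (State DS))
  | 0, _ => PMF.pure none
  | k + 1, s =>
    if b.Holds s then andThen (body (s.tick (b.size + 1))) (runLoop b body k)
    else PMF.pure (some (s.tick (b.size + 1)))

open Classical in
/-- The distribution of the final state when the program is run with each loop cut off after
`fuel` tests; `none` means that some loop was cut off. -/
def Cmd.run (𝒦 : KDEPrimitive) (fuel : ℕ) :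
    Cmd → State 𝒦.DS → PMF (Option (State 𝒦.DS))
  | .skip, s => PMF.pure (some (s.tick 1))
  | .setN a i j e, s =>
    PMF.pure (some (({ s with nat := setCell s.nat a (i.eval s) (j.eval s) (e.eval s) }
      : State 𝒦.DS).tick (i.size + j.size + e.size + 1)))
  | .setR a i j e, s =>
    PMF.pure (some (({ s with real := setCell s.real a (i.eval s) (j.eval s) (e.eval s) }
      : State 𝒦.DS).tick (i.size + j.size + e.size + 1)))
  | .unif a i j k, s =>
    (unifBelow (k.eval s)).map fun x =>
      some (({ s with nat := setCell s.nat a (i.eval s) (j.eval s) x }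
        : State 𝒦.DS).tick (i.size + j.size + k.size + 1))
  | .build r b rows cols ε μ, s =>
    (𝒦.build (Matrix.of fun (i : Fin (rows.eval s)) (j : Fin (cols.eval s)) => s.real b i j)
        (ε.eval s) (μ.eval s)).map fun x =>
      some (({ s with ds := Function.update s.ds r (some x.1) }
        : State 𝒦.DS).tick (rows.size + cols.size + ε.size + μ.size + 1 + x.2))
  | .query a i j r b row cols, s =>
    match s.ds r with
    | none => PMF.pure none
    | some S =>
      let x := 𝒦.query S fun l : Fin (cols.eval s) => s.real b (row.eval s) l
      PMF.pure (some (({ s with real := setCell s.real a (i.eval s) (j.eval s) x.1 }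
        : State 𝒦.DS).tick (i.size + j.size + row.size + cols.size + 1 + x.2)))
  | .seq c₁ c₂, s => andThen (c₁.run 𝒦 fuel s) (c₂.run 𝒦 fuel)
  | .ite b c₁ c₂, s =>
    if b.Holds s then c₁.run 𝒦 fuel (s.tick (b.size + 1)) else c₂.run 𝒦 fuel (s.tick (b.size + 1))
  | .loop b c, s => runLoop b (c.run 𝒦 fuel) fuel s

/-! ### Input and output of the attention algorithm -/

/-- The entry `(i, j)` of a matrix, and `0` outside its range. -/
def entry {n d : ℕ} (M : Matrix (Fin n) (Fin d) ℝ) (i j : ℕ) : ℝ :=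
  if h : i < n ∧ j < d then M ⟨i, h.1⟩ ⟨j, h.2⟩ else 0

/-- The initial state: real arrays `0, 1, 2` hold `Q, K, V`; real array `3` holds `ε` and `τ` in
its cells `(0,0)` and `(0,1)`; natural array `0` holds `n`, `d` and `m` in its cells `(0,0)`,
`(0,1)` and `(0,2)`. All other cells are `0`. -/
def inputState (DS : Type) {n d : ℕ} (Q K V : Matrix (Fin n) (Fin d) ℝ) (ε τ : ℝ) (m : ℕ) :
    State DS where
  nat a i j :=
    if a = 0 ∧ i = 0 then (if j = 0 then n else if j = 1 then d else if j = 2 then m else 0) else 0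
  real a i j :=
    if a = 0 then entry Q i j else if a = 1 then entry K i j else if a = 2 then entry V i j
    else if a = 3 ∧ i = 0 then (if j = 0 then ε else if j = 1 then τ else 0) else 0
  ds _ := none
  time := 0

/-- The diagonal of the output `D̃`: column `0` of real array `4`. -/
def outputDiag {DS : Type} (s : State DS) (n : ℕ) : Fin n → ℝ := fun i => s.real 4 i 0

/-- The output `Π`, stored sparsely: its `r`-th row has the entry `s.real 5 r 0` at position
`s.nat 1 r 0` and zeros elsewhere. -/
def outputSampling {DS : Type} (s : State DS) (m n : ℕ) : Matrix (Fin m) (Fin n) ℝ :=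
  Matrix.of fun r i => if s.nat 1 r 0 = (i : ℕ) then s.real 5 r 0 else 0

/-- The spectral guarantee
`‖Att(Q,K,V) - D̃⁻¹ A Πᵀ Π V‖_op ≤ ε ‖D⁻¹A‖_op ‖V‖_op`. -/
def SpectralGuarantee {n d m : ℕ} (Q K V : Matrix (Fin n) (Fin d) ℝ) (ε : ℝ)
    (D' : Matrix (Fin n) (Fin n) ℝ) (P : Matrix (Fin m) (Fin n) ℝ) : Prop :=
  opNorm (attention Q K V - D'⁻¹ * attnMatrix Q K * P.transpose * (P * V))
    ≤ ε * opNorm (softmaxMatrix Q K) * opNorm V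

end KDEAttention

end

noncomputable section

namespace KDEAttention

/-! ### Matrix concentration by exchangeable pairs -/

section Concentration

/-! Write `P` for the softmax matrix `D⁻¹A`. Two approximations suffice when `ε < 2`: a diagonal
`D̃` within relative error `ε/8` of `D`, and a sampling matrix `Π` with `‖PV - PΠᵀΠV‖ ≤
(ε/2)‖P‖‖V‖`. Since `D̃⁻¹A` is `P` with its rows rescaled by factors `1 + O(ε)`, the two errors add
up to less than `ε‖P‖‖V‖` (`spectralGuarantee_of_approx`). For `ε ≥ 2` any approximant of norm at
most `‖V‖` works, because `‖P‖ ≥ 1` (`one_le_opNorm_softmaxMatrix`), and sampling one fixed index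
with a suitable `D̃` provides one (`spectralGuarantee_of_two_le`).

Sampling. To index `i` attach the vector made of column `i` of `P` divided by `‖P‖` and row `i` of
`V` divided by `‖V‖`. A product `PΠᵀΠV` is an off-diagonal block of a sampled sum of rank one
operators, so by polarization its error is controlled by the deviation of that sum from its mean. If
the probabilities are at least `1/R` times the squared norms of these vectors, with `R` of order
`srank P + srank V`, matrix concentration (`card_sampleOp_large_le`, `card_sample_deviation_le`,
`card_sampling_bad_le`) gives failure probability `2n exp(-mη²/(16R))` for error `η`. The
concentration bound is proved by exchangeable pairs: resampling one coordinate bounds the derivative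
of the trace moment generating function by the function itself, through the mean value trace
inequality `traceExp_mean_value`, and the differential inequality is integrated in
`traceMgf_pos_le`.

Suitable probabilities come from the squared row norms of `V`, which are computed exactly, and the
squared column norms of `P`, which need only be known up to constants. The row sums of `A` and these
column norms are both sums `∑ⱼ exp(⟨xⱼ,yᵢ⟩ + wⱼ)`, the latter with points scaled by `√2` and weights
`wⱼ = -2 log D̃ⱼ`. One additional coordinate turns such a sum into a multiple of a Gaussian kernel
density (`gaussDensity_lift`), whose value is exactly the ratio in the data-dependent cost divided
by `n`.

To match the infimum in the cost without knowing the best `μ`, the estimation works in rounds with a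
cost parameter `P = μ^{-τ}` that doubles each time, and stops as soon as the points with density
below `μ` number at most `P/ε²`. A round is entered only if the previous parameter was too small,
and then every `μ` has cost at least that parameter over `ε²` (`IsKDECost.le_of_card`). Hence the
geometric sum of the round costs and the direct computation of the missing sums are both `O(nd)`
times the infimum (`kdeRounds_spec`, `kdeProc_spec`). Replacing exact weights and precision by
approximate ones changes the cost by a constant factor (`kdeCost_le_mul`).

All of this is carried out for an explicit program by a program logic that records a postcondition,
a step count and a failure probability (`Good`). The random draws are uniform positions in a table
in which index `i` occurs `⌈n uᵢ⌉` times (`tableLoop_spec`, `drawLoop_spec`), so the probability of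
a bad sample is a ratio of cardinalities, as supplied by the concentration bound. -/

theorem two_mul_exp_sub_one_le {s : ℝ} (hs : 0 ≤ s) :
    2 * (Real.exp s - 1) ≤ s * (Real.exp s + 1) := by
  have hmono : MonotoneOn (fun s : ℝ => s * (Real.exp s + 1) - 2 * (Real.exp s - 1))
      (Set.Ici 0) := by
    have hd : ∀ x : ℝ, HasDerivAt (fun s : ℝ => s * (Real.exp s + 1) - 2 * (Real.exp s - 1))
        (1 * (Real.exp x + 1) + x * Real.exp x - 2 * Real.exp x) x := by
      intro x
      exact ((hasDerivAt_id x).mul ((Real.hasDerivAt_exp x).add_const 1)).sub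
        (((Real.hasDerivAt_exp x).sub_const 1).const_mul 2)
    apply monotoneOn_of_deriv_nonneg (convex_Ici 0)
    · exact fun x _ => (hd x).continuousAt.continuousWithinAt
    · exact fun x _ => (hd x).differentiableAt.differentiableWithinAt
    · intro x _
      rw [(hd x).deriv]
      -- The derivative equals `1 - (1 - x) * exp x`, so its sign follows from `1 - x ≤ exp (-x)`.
      have h1 : 1 - x ≤ Real.exp (-x) := by linarith [Real.add_one_le_exp (-x)]
      have h2 : (1 - x) * Real.exp x ≤ 1 := by
        calc _ ≤ Real.exp (-x) * Real.exp x :=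
              mul_le_mul_of_nonneg_right h1 (Real.exp_pos x).le
          _ = 1 := by rw [← Real.exp_add]; simp
      linarith
  have := hmono (Set.mem_Ici.2 le_rfl) (Set.mem_Ici.2 hs) hs
  simp at this
  linarith

/-- The logarithmic mean is at most the arithmetic mean. -/
theorem sub_mul_exp_sub_exp_le {θ : ℝ} (hθ : 0 ≤ θ) (x y : ℝ) :
    (x - y) * (Real.exp (θ * x) - Real.exp (θ * y)) ≤
      θ / 2 * ((x - y) ^ 2 * (Real.exp (θ * x) + Real.exp (θ * y))) := by
  wlog h : y ≤ x generalizing x y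
  · have := this y x (le_of_not_ge h)
    nlinarith [this]
  -- Factoring out `exp (θ * y)` leaves a one-variable inequality in `θ * (x - y)`.
  have key := two_mul_exp_sub_one_le (mul_nonneg hθ (sub_nonneg.2 h))
  have e : Real.exp (θ * x) = Real.exp (θ * (x - y)) * Real.exp (θ * y) := by
    rw [← Real.exp_add]; congr 1; ring
  have h3 := mul_le_mul_of_nonneg_left key
    (mul_nonneg (sub_nonneg.2 h) (Real.exp_pos (θ * y)).le)
  rw [e]
  nlinarith [h3]

variable {E : Type*} [NormedAddCommGroup E] [InnerProductSpace ℝ E]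
variable {κ : Type*} [Fintype κ] {m : ℕ}

open scoped InnerProductSpace

/-- The rank one operator `x ↦ ⟨z, x⟩ z`. -/
def rankOneOp (z : E) : E →ₗ[ℝ] E := (innerₛₗ ℝ z).smulRight z

@[simp] theorem rankOneOp_apply (z x : E) : rankOneOp z x = ⟪z, x⟫_ℝ • z := rfl

theorem rankOneOp_isSymmetric (z : E) : (rankOneOp z).IsSymmetric := by
  intro x y
  simp [inner_smul_left, inner_smul_right, real_inner_comm, mul_comm]

/-- The average of the rank one operators of a finite family of vectors. -/
def avgOp (z : κ → E) : E →ₗ[ℝ] E := (Fintype.card κ : ℝ)⁻¹ • ∑ t, rankOneOp (z t)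

/-- The centred sum of the rank one operators of a sample, with a sign. -/
def sampleOp (z : κ → E) (σ : ℝ) (ω : Fin m → κ) : E →ₗ[ℝ] E :=
  σ • ∑ r, (rankOneOp (z (ω r)) - avgOp z)

theorem isSymmetric_real_smul {A : E →ₗ[ℝ] E} (hA : A.IsSymmetric) (c : ℝ) :
    (c • A).IsSymmetric := by
  intro x y
  simp [inner_smul_left, inner_smul_right, hA x y]

theorem isSymmetric_finset_sum {ι : Type*} (s : Finset ι) {A : ι → E →ₗ[ℝ] E}
    (hA : ∀ i, (A i).IsSymmetric) : (∑ i ∈ s, A i).IsSymmetric := by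
  intro x y
  simp only [LinearMap.sum_apply, sum_inner, inner_sum]
  exact Finset.sum_congr rfl fun i _ => hA i x y

theorem avgOp_isSymmetric (z : κ → E) : (avgOp z).IsSymmetric :=
  isSymmetric_real_smul (isSymmetric_finset_sum _ fun t => rankOneOp_isSymmetric (z t)) _

theorem sampleOp_isSymmetric (z : κ → E) (σ : ℝ) (ω : Fin m → κ) :
    (sampleOp z σ ω).IsSymmetric :=
  isSymmetric_real_smul (isSymmetric_finset_sum _ fun r =>
    (rankOneOp_isSymmetric (z (ω r))).sub (avgOp_isSymmetric z)) _

/-- Exchanging coordinate `r` of the sample with the fresh element is an involution. This is the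
exchangeability of the pair. -/
theorem sum_swap_coordinate [DecidableEq κ] (r : Fin m) (F : (Fin m → κ) × κ → ℝ) :
    ∑ x : (Fin m → κ) × κ, F (Function.update x.1 r x.2, x.1 r) = ∑ x, F x := by
  refine Finset.sum_nbij' (fun x => (Function.update x.1 r x.2, x.1 r))
    (fun x => (Function.update x.1 r x.2, x.1 r)) ?_ ?_ ?_ ?_ ?_ <;> simp

theorem sampleOp_sub_update (z : κ → E) (σ : ℝ) (ω : Fin m → κ) (r : Fin m) (t : κ) :
    sampleOp z σ ω - sampleOp z σ (Function.update ω r t) =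
      σ • (rankOneOp (z (ω r)) - rankOneOp (z t)) := by
  unfold sampleOp
  rw [← smul_sub, ← Finset.sum_sub_distrib]
  congr 1
  rw [Finset.sum_eq_single r]
  · simp
  · intro b _ hb; simp [Function.update_of_ne hb]
  · simp

/-- In operator form, `(zzᵀ - wwᵀ)² ≤ 2R(zzᵀ + wwᵀ)`: the parallelogram law with the sum term
dropped, and `(zzᵀ)² = ‖z‖² zzᵀ`. The square of a jump is thereby bounded linearly by rank one
operators. -/
theorem norm_rankOneOp_sub_sq_le {R : ℝ} {z w : E} (hz : ‖z‖ ^ 2 ≤ R) (hw : ‖w‖ ^ 2 ≤ R) (u : E) :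
    ‖rankOneOp z u - rankOneOp w u‖ ^ 2 ≤ 2 * R * (⟪z, u⟫_ℝ ^ 2 + ⟪w, u⟫_ℝ ^ 2) := by
  have h := parallelogram_law_with_norm ℝ (rankOneOp z u) (rankOneOp w u)
  have h1 : ‖rankOneOp z u‖ ^ 2 ≤ R * ⟪z, u⟫_ℝ ^ 2 := by
    rw [rankOneOp_apply, norm_smul, mul_pow, Real.norm_eq_abs, sq_abs]
    nlinarith [sq_nonneg ⟪z, u⟫_ℝ]
  have h2 : ‖rankOneOp w u‖ ^ 2 ≤ R * ⟪w, u⟫_ℝ ^ 2 := by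
    rw [rankOneOp_apply, norm_smul, mul_pow, Real.norm_eq_abs, sq_abs]
    nlinarith [sq_nonneg ⟪w, u⟫_ℝ]
  nlinarith [mul_self_nonneg ‖rankOneOp z u + rankOneOp w u‖]

theorem avgOp_apply_inner (z : κ → E) (u : E) :
    ⟪u, avgOp z u⟫_ℝ = (Fintype.card κ : ℝ)⁻¹ * ∑ t, ⟪z t, u⟫_ℝ ^ 2 := by
  simp only [avgOp, LinearMap.smul_apply, LinearMap.sum_apply, rankOneOp_apply, inner_smul_right,
    inner_sum]
  congr 1
  refine Finset.sum_congr rfl fun t _ => ?_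
  rw [real_inner_comm u]; ring

/-- The centred sum is the average, over the fresh element, of all jumps caused by resampling one
coordinate. This brings the derivative of the moment generating function into a form to which
exchangeability applies. -/
theorem sampleOp_eq_avg (z : κ → E) [Nonempty κ] (σ : ℝ) (ω : Fin m → κ) :
    sampleOp z σ ω = (σ * (Fintype.card κ : ℝ)⁻¹) •
      ∑ r, ∑ t, (rankOneOp (z (ω r)) - rankOneOp (z t)) := by
  have hk : (Fintype.card κ : ℝ) ≠ 0 := by exact_mod_cast Fintype.card_ne_zero
  have h : ∀ r, rankOneOp (z (ω r)) - avgOp z = (Fintype.card κ : ℝ)⁻¹ •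
      ∑ t, (rankOneOp (z (ω r)) - rankOneOp (z t)) := by
    intro r
    rw [Finset.sum_sub_distrib, smul_sub, Finset.sum_const, Finset.card_univ,
      ← Nat.cast_smul_eq_nsmul ℝ, smul_smul, inv_mul_cancel₀ hk, one_smul, avgOp]
  unfold sampleOp
  rw [Finset.sum_congr rfl fun r _ => h r, ← Finset.smul_sum, smul_smul]

/-- The variance proxy of the jumps is expressed through the centred sum itself plus a multiple of
the mean, which closes the differential inequality. -/
theorem sum_add_eq_sampleOp (z : κ → E) [Nonempty κ] {σ : ℝ} (hσ : σ ^ 2 = 1) (ω : Fin m → κ) :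
    (Fintype.card κ : ℝ)⁻¹ • ∑ r, ∑ t, (rankOneOp (z (ω r)) + rankOneOp (z t)) =
      σ • sampleOp z σ ω + (2 * m : ℝ) • avgOp z := by
  have hk : (Fintype.card κ : ℝ) ≠ 0 := by exact_mod_cast Fintype.card_ne_zero
  unfold sampleOp
  rw [smul_smul, ← sq, hσ, one_smul, Finset.sum_sub_distrib]
  simp only [Finset.sum_add_distrib, Finset.sum_const, Finset.card_univ, Fintype.card_fin]
  rw [← Finset.smul_sum, smul_add, ← Nat.cast_smul_eq_nsmul ℝ (Fintype.card κ), smul_smul,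
    inv_mul_cancel₀ hk, one_smul, ← Nat.cast_smul_eq_nsmul ℝ m, smul_comm]
  change _ + (m : ℝ) • avgOp z = _
  rw [← Nat.cast_smul_eq_nsmul ℝ m]
  module

variable [FiniteDimensional ℝ E]

/-- `tr (M exp (θ A))` for a symmetric operator `A`, in terms of an eigenbasis of `A`. -/
def traceExp {A : E →ₗ[ℝ] E} (hA : A.IsSymmetric) (θ : ℝ) (M : E →ₗ[ℝ] E) : ℝ :=
  ∑ i, Real.exp (θ * hA.eigenvalues rfl i) *
    ⟪hA.eigenvectorBasis rfl i, M (hA.eigenvectorBasis rfl i)⟫_ℝ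

/-- `tr (Mᵀ M exp (θ A))` for a symmetric operator `A`. -/
def traceExpSq {A : E →ₗ[ℝ] E} (hA : A.IsSymmetric) (θ : ℝ) (M : E →ₗ[ℝ] E) : ℝ :=
  ∑ i, Real.exp (θ * hA.eigenvalues rfl i) * ‖M (hA.eigenvectorBasis rfl i)‖ ^ 2

theorem traceExp_add {A : E →ₗ[ℝ] E} (hA : A.IsSymmetric) (θ : ℝ) (M N : E →ₗ[ℝ] E) :
    traceExp hA θ (M + N) = traceExp hA θ M + traceExp hA θ N := by
  simp [traceExp, inner_add_right, mul_add, Finset.sum_add_distrib]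

theorem traceExp_smul {A : E →ₗ[ℝ] E} (hA : A.IsSymmetric) (θ c : ℝ) (M : E →ₗ[ℝ] E) :
    traceExp hA θ (c • M) = c * traceExp hA θ M := by
  simp [traceExp, inner_smul_right, Finset.mul_sum, mul_left_comm]

theorem traceExp_sub {A : E →ₗ[ℝ] E} (hA : A.IsSymmetric) (θ : ℝ) (M N : E →ₗ[ℝ] E) :
    traceExp hA θ (M - N) = traceExp hA θ M - traceExp hA θ N := by
  simp [traceExp, inner_sub_right, mul_sub, Finset.sum_sub_distrib]

theorem traceExp_sum {A : E →ₗ[ℝ] E} (hA : A.IsSymmetric) (θ : ℝ) {ι : Type*} (s : Finset ι)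
    (M : ι → E →ₗ[ℝ] E) : traceExp hA θ (∑ i ∈ s, M i) = ∑ i ∈ s, traceExp hA θ (M i) := by
  classical
  induction s using Finset.induction_on with
  | empty => simp [traceExp]
  | insert a s ha ih => rw [Finset.sum_insert ha, Finset.sum_insert ha, traceExp_add, ih]

theorem inner_eigenvectorBasis_apply {A : E →ₗ[ℝ] E} (hA : A.IsSymmetric) (x : E)
    (j : Fin (Module.finrank ℝ E)) :
    ⟪A x, hA.eigenvectorBasis rfl j⟫_ℝ =
      hA.eigenvalues rfl j * ⟪x, hA.eigenvectorBasis rfl j⟫_ℝ := by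
  rw [hA x, hA.apply_eigenvectorBasis, inner_smul_right]; rfl

/-- The mean value trace inequality. -/
theorem traceExp_mean_value {A B : E →ₗ[ℝ] E} (hA : A.IsSymmetric) (hB : B.IsSymmetric) {θ : ℝ}
    (hθ : 0 ≤ θ) :
    traceExp hA θ (A - B) - traceExp hB θ (A - B) ≤
      θ / 2 * (traceExpSq hA θ (A - B) + traceExpSq hB θ (A - B)) := by
  set u := hA.eigenvectorBasis rfl with hu
  set v := hB.eigenvectorBasis rfl with hv
  set a := hA.eigenvalues rfl with ha
  set b := hB.eigenvalues rfl with hb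
  -- Between the two eigenbases `A - B` has entries `(aᵢ - bⱼ)⟨uᵢ, vⱼ⟩`. All four traces become
  -- double sums with the weights `⟨uᵢ, vⱼ⟩²`, and the claim reduces to the scalar inequality for
  -- each pair of eigenvalues, although `A` and `B` need not commute.
  have dotAB : ∀ i j, ⟪(A - B) (u i), v j⟫_ℝ = (a i - b j) * ⟪u i, v j⟫_ℝ := by
    intro i j
    rw [LinearMap.sub_apply, inner_sub_left, inner_eigenvectorBasis_apply hB,
      hA.apply_eigenvectorBasis, inner_smul_left]
    simp [← ha, ← hb, ← hu]; ring
  have dotBA : ∀ i j, ⟪(A - B) (v j), u i⟫_ℝ = (a i - b j) * ⟪u i, v j⟫_ℝ := by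
    intro i j
    rw [LinearMap.sub_apply, inner_sub_left, inner_eigenvectorBasis_apply hA,
      hB.apply_eigenvectorBasis, inner_smul_left, real_inner_comm]
    simp [← ha, ← hb]; ring
  have h1 : traceExp hA θ (A - B) =
      ∑ i, ∑ j, Real.exp (θ * a i) * ((a i - b j) * ⟪u i, v j⟫_ℝ ^ 2) := by
    unfold traceExp
    refine Finset.sum_congr rfl fun i _ => ?_
    rw [← Finset.mul_sum]
    congr 1
    rw [← v.sum_inner_mul_inner]
    refine Finset.sum_congr rfl fun j _ => ?_
    rw [real_inner_comm ((A - B) _) (v j), dotAB]; ring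
  have h2 : traceExp hB θ (A - B) =
      ∑ i, ∑ j, Real.exp (θ * b j) * ((a i - b j) * ⟪u i, v j⟫_ℝ ^ 2) := by
    unfold traceExp
    rw [Finset.sum_comm]
    refine Finset.sum_congr rfl fun j _ => ?_
    rw [← Finset.mul_sum]
    congr 1
    rw [← u.sum_inner_mul_inner]
    refine Finset.sum_congr rfl fun i _ => ?_
    rw [real_inner_comm ((A - B) _) (u i), dotBA, real_inner_comm]; ring
  have h3 : traceExpSq hA θ (A - B) =
      ∑ i, ∑ j, Real.exp (θ * a i) * ((a i - b j) ^ 2 * ⟪u i, v j⟫_ℝ ^ 2) := by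
    unfold traceExpSq
    refine Finset.sum_congr rfl fun i _ => ?_
    rw [← Finset.mul_sum]
    congr 1
    rw [← real_inner_self_eq_norm_sq, ← v.sum_inner_mul_inner]
    refine Finset.sum_congr rfl fun j _ => ?_
    rw [real_inner_comm ((A - B) _) (v j), dotAB]; ring
  have h4 : traceExpSq hB θ (A - B) =
      ∑ i, ∑ j, Real.exp (θ * b j) * ((a i - b j) ^ 2 * ⟪u i, v j⟫_ℝ ^ 2) := by
    unfold traceExpSq
    rw [Finset.sum_comm]
    refine Finset.sum_congr rfl fun j _ => ?_
    rw [← Finset.mul_sum]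
    congr 1
    rw [← real_inner_self_eq_norm_sq, ← u.sum_inner_mul_inner]
    refine Finset.sum_congr rfl fun i _ => ?_
    rw [real_inner_comm ((A - B) _) (u i), dotBA]; ring
  rw [h1, h2, h3, h4, ← Finset.sum_sub_distrib, ← Finset.sum_add_distrib, Finset.mul_sum]
  refine Finset.sum_le_sum fun i _ => ?_
  rw [← Finset.sum_sub_distrib, ← Finset.sum_add_distrib, Finset.mul_sum]
  refine Finset.sum_le_sum fun j _ => ?_
  have := mul_le_mul_of_nonneg_right (sub_mul_exp_sub_exp_le hθ (a i) (b j))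
    (sq_nonneg ⟪u i, v j⟫_ℝ)
  nlinarith [this]

theorem traceExpSq_rankOneOp_sub_le {A : E →ₗ[ℝ] E} (hA : A.IsSymmetric) (θ : ℝ) {R σ : ℝ}
    {z w : E} (hz : ‖z‖ ^ 2 ≤ R) (hw : ‖w‖ ^ 2 ≤ R) (hσ : σ ^ 2 = 1) :
    traceExpSq hA θ (σ • (rankOneOp z - rankOneOp w)) ≤
      2 * R * traceExp hA θ (rankOneOp z + rankOneOp w) := by
  unfold traceExpSq traceExp
  rw [Finset.mul_sum]
  refine Finset.sum_le_sum fun i _ => ?_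
  have h := norm_rankOneOp_sub_sq_le hz hw (hA.eigenvectorBasis rfl i)
  rw [LinearMap.smul_apply, norm_smul, mul_pow, Real.norm_eq_abs, sq_abs, hσ, one_mul,
    LinearMap.sub_apply]
  have e : ⟪hA.eigenvectorBasis rfl i,
      (rankOneOp z + rankOneOp w) (hA.eigenvectorBasis rfl i)⟫_ℝ =
      ⟪z, hA.eigenvectorBasis rfl i⟫_ℝ ^ 2 + ⟪w, hA.eigenvectorBasis rfl i⟫_ℝ ^ 2 := by
    simp only [LinearMap.add_apply, rankOneOp_apply, inner_add_right, inner_smul_right]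
    rw [real_inner_comm z, real_inner_comm w]; ring
  rw [e]
  nlinarith [mul_le_mul_of_nonneg_left h (Real.exp_pos (θ * hA.eigenvalues rfl i)).le]

/-- The exchangeable pairs bound for one coordinate of the sample. -/
theorem sum_traceExp_coordinate_le [DecidableEq κ] (z : κ → E) {σ R θ : ℝ} (hσ : σ ^ 2 = 1)
    (hR : ∀ t, ‖z t‖ ^ 2 ≤ R) (hθ : 0 ≤ θ) (r : Fin m) :
    σ * ∑ x : (Fin m → κ) × κ, traceExp (sampleOp_isSymmetric z σ x.1) θ
        (rankOneOp (z (x.1 r)) - rankOneOp (z x.2)) ≤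
      R * θ * ∑ x : (Fin m → κ) × κ, traceExp (sampleOp_isSymmetric z σ x.1) θ
        (rankOneOp (z (x.1 r)) + rankOneOp (z x.2)) := by
  set F : (Fin m → κ) × κ → ℝ := fun x => traceExp (sampleOp_isSymmetric z σ x.1) θ
        (rankOneOp (z (x.1 r)) - rankOneOp (z x.2)) with hF
  set S : (Fin m → κ) × κ → ℝ := fun x => traceExpSq (sampleOp_isSymmetric z σ x.1) θ
        (σ • (rankOneOp (z (x.1 r)) - rankOneOp (z x.2))) with hS
  -- Pairing each jump with its reverse flips the sign of the difference, so the mean value trace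
  -- inequality applies to the sum. Summing over all pairs and undoing the swap doubles both sides.
  have key : ∀ x, σ * (F x + F (Function.update x.1 r x.2, x.1 r)) ≤
      θ / 2 * (S x + S (Function.update x.1 r x.2, x.1 r)) := by
    rintro ⟨ω, t⟩
    have h := traceExp_mean_value (sampleOp_isSymmetric z σ ω)
      (sampleOp_isSymmetric z σ (Function.update ω r t)) hθ
    rw [sampleOp_sub_update, traceExp_smul, traceExp_smul] at h
    have e1 : F (Function.update ω r t, ω r) = - traceExp
        (sampleOp_isSymmetric z σ (Function.update ω r t)) θ
          (rankOneOp (z (ω r)) - rankOneOp (z t)) := by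
      simp only [hF, Function.update_self, traceExp_sub]; ring
    have e2 : S (Function.update ω r t, ω r) = traceExpSq
        (sampleOp_isSymmetric z σ (Function.update ω r t)) θ
          (σ • (rankOneOp (z (ω r)) - rankOneOp (z t))) := by
      simp only [hS, Function.update_self, traceExpSq]
      refine Finset.sum_congr rfl fun i _ => ?_
      congr 2
      rw [← norm_neg]
      congr 1
      simp only [LinearMap.smul_apply, LinearMap.sub_apply, ← smul_neg, neg_sub]
    rw [e1, e2]
    simp only [hF, hS]
    linarith
  have hsum := Finset.sum_le_sum fun x (_ : x ∈ Finset.univ) => key x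
  rw [← Finset.mul_sum, ← Finset.mul_sum, Finset.sum_add_distrib, Finset.sum_add_distrib,
    sum_swap_coordinate r F, sum_swap_coordinate r S] at hsum
  have hS2 : ∑ x, S x ≤ 2 * R * ∑ x : (Fin m → κ) × κ,
      traceExp (sampleOp_isSymmetric z σ x.1) θ (rankOneOp (z (x.1 r)) + rankOneOp (z x.2)) := by
    rw [Finset.mul_sum]
    exact Finset.sum_le_sum fun x _ => traceExpSq_rankOneOp_sub_le _ θ (hR _) (hR _) hσ
  nlinarith [mul_le_mul_of_nonneg_left hS2 hθ]

/-- The trace moment generating function, summed over all samples. -/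
def traceMgf (m : ℕ) [DecidableEq κ] (z : κ → E) (σ θ : ℝ) : ℝ :=
  ∑ ω : Fin m → κ, ∑ i, Real.exp (θ * (sampleOp_isSymmetric z σ ω).eigenvalues rfl i)

theorem traceExp_self {A : E →ₗ[ℝ] E} (hA : A.IsSymmetric) (θ : ℝ) :
    traceExp hA θ A = ∑ i, Real.exp (θ * hA.eigenvalues rfl i) * hA.eigenvalues rfl i := by
  unfold traceExp
  refine Finset.sum_congr rfl fun i _ => ?_
  congr 1
  rw [hA.apply_eigenvectorBasis, inner_smul_right, real_inner_self_eq_norm_sq,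
    (hA.eigenvectorBasis rfl).norm_eq_one]
  simp

theorem hasDerivAt_traceMgf (m : ℕ) [DecidableEq κ] (z : κ → E) (σ θ : ℝ) :
    HasDerivAt (traceMgf m z σ)
      (∑ ω : Fin m → κ, traceExp (sampleOp_isSymmetric z σ ω) θ (sampleOp z σ ω)) θ := by
  unfold traceMgf
  apply HasDerivAt.fun_sum
  intro ω _
  rw [traceExp_self]
  apply HasDerivAt.fun_sum
  intro i _
  have := (((hasDerivAt_id θ).mul_const
    ((sampleOp_isSymmetric z σ ω).eigenvalues rfl i))).exp
  simpa using this

/-- The coordinate bounds are summed over `r` and averaged over the fresh element. On the right this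
produces the centred sum, which is the derivative again, and twice `m` times the mean operator,
whose quadratic form is at most `2‖u‖²`; hence the factor `4`. -/
theorem deriv_traceMgf_le [DecidableEq κ] [Nonempty κ] (z : κ → E) {σ R θ : ℝ} (hσ : σ ^ 2 = 1)
    (hR : ∀ t, ‖z t‖ ^ 2 ≤ R) (hθ : 0 ≤ θ) (hR0 : 0 ≤ R)
    (havg : ∀ u : E, ⟪u, avgOp z u⟫_ℝ ≤ 2 * ‖u‖ ^ 2) :
    (∑ ω : Fin m → κ, traceExp (sampleOp_isSymmetric z σ ω) θ (sampleOp z σ ω)) ≤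
      R * θ * (σ * (∑ ω : Fin m → κ, traceExp (sampleOp_isSymmetric z σ ω) θ (sampleOp z σ ω)) +
        4 * m * traceMgf m z σ θ) := by
  have hk : 0 ≤ (Fintype.card κ : ℝ)⁻¹ := by positivity
  have h1 : (∑ ω : Fin m → κ, traceExp (sampleOp_isSymmetric z σ ω) θ (sampleOp z σ ω)) =
      (Fintype.card κ : ℝ)⁻¹ * ∑ r, σ * ∑ x : (Fin m → κ) × κ,
        traceExp (sampleOp_isSymmetric z σ x.1) θ
        (rankOneOp (z (x.1 r)) - rankOneOp (z x.2)) := by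
    simp_rw [Fintype.sum_prod_type]
    rw [← Finset.mul_sum, ← mul_assoc, Finset.sum_comm, Finset.mul_sum]
    refine Finset.sum_congr rfl fun ω _ => ?_
    rw [show traceExp (sampleOp_isSymmetric z σ ω) θ (sampleOp z σ ω) = _ from
      congrArg (traceExp (sampleOp_isSymmetric z σ ω) θ) (sampleOp_eq_avg z σ ω), traceExp_smul, traceExp_sum, mul_comm σ]
    simp_rw [traceExp_sum]
  have h2 : (Fintype.card κ : ℝ)⁻¹ * ∑ r, R * θ * ∑ x : (Fin m → κ) × κ,
        traceExp (sampleOp_isSymmetric z σ x.1) θ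
        (rankOneOp (z (x.1 r)) + rankOneOp (z x.2)) = R * θ * ∑ ω : Fin m → κ,
        traceExp (sampleOp_isSymmetric z σ ω) θ (σ • sampleOp z σ ω + (2 * m : ℝ) • avgOp z) := by
    simp_rw [Fintype.sum_prod_type]
    rw [← Finset.mul_sum, mul_left_comm, Finset.sum_comm]
    congr 1
    rw [Finset.mul_sum]
    refine Finset.sum_congr rfl fun ω _ => ?_
    rw [← sum_add_eq_sampleOp z hσ, traceExp_smul, traceExp_sum]
    simp_rw [traceExp_sum]
  have h3 : (∑ ω : Fin m → κ, traceExp (sampleOp_isSymmetric z σ ω) θ (sampleOp z σ ω)) ≤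
      R * θ * ∑ ω : Fin m → κ,
        traceExp (sampleOp_isSymmetric z σ ω) θ (σ • sampleOp z σ ω + (2 * m : ℝ) • avgOp z) := by
    rw [← h2]
    conv_lhs => rw [h1]
    exact mul_le_mul_of_nonneg_left
      (Finset.sum_le_sum fun r _ => sum_traceExp_coordinate_le z hσ hR hθ r) hk
  refine h3.trans (mul_le_mul_of_nonneg_left ?_ (mul_nonneg hR0 hθ))
  unfold traceMgf
  rw [Finset.mul_sum, Finset.mul_sum, ← Finset.sum_add_distrib]
  refine Finset.sum_le_sum fun ω _ => ?_
  rw [traceExp_add, traceExp_smul, traceExp_smul]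
  have h4 : traceExp (sampleOp_isSymmetric z σ ω) θ (avgOp z) ≤
      2 * ∑ i, Real.exp (θ * (sampleOp_isSymmetric z σ ω).eigenvalues rfl i) := by
    unfold traceExp
    rw [Finset.mul_sum]
    refine Finset.sum_le_sum fun i _ => ?_
    have := havg ((sampleOp_isSymmetric z σ ω).eigenvectorBasis rfl i)
    rw [((sampleOp_isSymmetric z σ ω).eigenvectorBasis rfl).norm_eq_one] at this
    nlinarith [Real.exp_pos (θ * (sampleOp_isSymmetric z σ ω).eigenvalues rfl i)]
  have hm : (0 : ℝ) ≤ m := Nat.cast_nonneg m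
  nlinarith [mul_le_mul_of_nonneg_left h4 hm]

/-- For `θ ≤ 1/(2R)` the derivative on the right of the differential inequality can be absorbed,
leaving `f' ≤ 8mRθ f`. Then `f(θ) exp(-4mRθ²)` is nonincreasing, and `f(0)` is the number of samples
times the dimension. -/
theorem traceMgf_pos_le [DecidableEq κ] [Nonempty κ] (z : κ → E) {σ R θ : ℝ}
    (hσ : σ = 1 ∨ σ = -1) (hR0 : 0 < R)
    (hR : ∀ t, ‖z t‖ ^ 2 ≤ R) (hθ : 0 ≤ θ) (hθR : θ ≤ 1 / (2 * R))
    (havg : ∀ u : E, ⟪u, avgOp z u⟫_ℝ ≤ 2 * ‖u‖ ^ 2) :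
    traceMgf m z σ θ ≤ (Fintype.card κ : ℝ) ^ m * Module.finrank ℝ E *
      Real.exp (4 * m * R * θ ^ 2) := by
  have hσ2 : σ ^ 2 = 1 := by rcases hσ with h | h <;> simp [h]
  have hanti : AntitoneOn (fun x => traceMgf m z σ x * Real.exp (-(4 * m * R * x ^ 2)))
      (Set.Icc 0 (1 / (2 * R))) := by
    have hd : ∀ x : ℝ, HasDerivAt (fun x => traceMgf m z σ x * Real.exp (-(4 * m * R * x ^ 2)))
        ((∑ ω : Fin m → κ, traceExp (sampleOp_isSymmetric z σ ω) x (sampleOp z σ ω)) *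
          Real.exp (-(4 * m * R * x ^ 2)) + traceMgf m z σ x *
          (Real.exp (-(4 * m * R * x ^ 2)) * -(4 * m * R * (2 * x)))) x := by
      intro x
      refine (hasDerivAt_traceMgf m z σ x).mul ?_
      have := ((((hasDerivAt_pow 2 x).const_mul (4 * m * R)).neg)).exp
      simpa using this
    apply antitoneOn_of_deriv_nonpos (convex_Icc _ _)
    · exact fun x _ => (hd x).continuousAt.continuousWithinAt
    · exact fun x _ => (hd x).differentiableAt.differentiableWithinAt
    · intro x hx
      rw [interior_Icc] at hx
      rw [(hd x).deriv]
      have h := deriv_traceMgf_le (m := m) z hσ2 hR hx.1.le hR0.le havg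
      set D := ∑ ω : Fin m → κ, traceExp (sampleOp_isSymmetric z σ ω) x (sampleOp z σ ω)
      have hf : 0 ≤ traceMgf m z σ x :=
        Finset.sum_nonneg fun _ _ => Finset.sum_nonneg fun _ _ => (Real.exp_pos _).le
      have hRx : R * x ≤ 1 / 2 := by
        have := (lt_div_iff₀ (by positivity : 0 < 2 * R)).1 hx.2
        nlinarith
      have hRx0 : 0 ≤ R * x := mul_nonneg hR0.le hx.1.le
      have hg : 0 ≤ R * x * (4 * m * traceMgf m z σ x) := by positivity
      have hD : D ≤ 2 * (R * x * (4 * m * traceMgf m z σ x)) := by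
        -- A nonpositive derivative needs no argument; for a positive one `σ * D ≤ D` holds for
        -- either sign, and `R * x ≤ 1/2` absorbs half of it.
        rcases le_or_gt D 0 with hD | hD
        · linarith
        · have h1 : σ * D ≤ D := by rcases hσ with h1 | h1 <;> rw [h1] <;> linarith
          have h2 : R * x * (σ * D) ≤ 1 / 2 * D :=
            (mul_le_mul_of_nonneg_left h1 hRx0).trans (mul_le_mul_of_nonneg_right hRx hD.le)
          rw [mul_add] at h
          linarith
      have hE := Real.exp_pos (-(4 * m * R * x ^ 2))
      nlinarith [mul_le_mul_of_nonneg_right hD hE.le]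
  have h := hanti (Set.mem_Icc.2 ⟨le_rfl, by positivity⟩) (Set.mem_Icc.2 ⟨hθ, hθR⟩) hθ
  have h0 : traceMgf m z σ 0 = (Fintype.card κ : ℝ) ^ m * Module.finrank ℝ E := by
    simp [traceMgf]
  simp only [h0] at h
  rw [Real.exp_neg, ← div_eq_mul_inv, div_le_iff₀ (Real.exp_pos _)] at h
  simpa using h

/-- If every eigenvalue were below `a`, the eigenbasis expansion would bound the quadratic form by
`a‖u‖²`. This feeds Markov's inequality for the trace moment generating function. -/
theorem exp_le_sum_exp_eigenvalues {A : E →ₗ[ℝ] E} (hA : A.IsSymmetric) {θ a : ℝ} (hθ : 0 ≤ θ)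
    {u : E} (hu : a * ‖u‖ ^ 2 < ⟪u, A u⟫_ℝ) :
    Real.exp (θ * a) ≤ ∑ i, Real.exp (θ * hA.eigenvalues rfl i) := by
  obtain ⟨i, hi⟩ : ∃ i, a ≤ hA.eigenvalues rfl i := by
    by_contra! hcon
    apply absurd hu (not_lt.2 _)
    rw [← (hA.eigenvectorBasis rfl).sum_inner_mul_inner, ← real_inner_self_eq_norm_sq,
      ← (hA.eigenvectorBasis rfl).sum_inner_mul_inner u u, Finset.mul_sum]
    refine Finset.sum_le_sum fun i _ => ?_
    rw [real_inner_comm (A u), inner_eigenvectorBasis_apply hA, real_inner_comm u]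
    nlinarith [hcon i, mul_self_nonneg ⟪hA.eigenvectorBasis rfl i, u⟫_ℝ]
  exact (Real.exp_le_exp.2 (mul_le_mul_of_nonneg_left hi hθ)).trans
    (Finset.single_le_sum (f := fun i => Real.exp (θ * hA.eigenvalues rfl i))
      (fun _ _ => (Real.exp_pos _).le) (Finset.mem_univ i))

open Classical in
/-- One-sided spectral concentration for sums of independent rank one operators. -/
theorem card_sampleOp_large_le [Nonempty κ] (z : κ → E) {σ R η : ℝ}
    (hσ : σ = 1 ∨ σ = -1) (hR0 : 0 < R) (hR : ∀ t, ‖z t‖ ^ 2 ≤ R) (hη : 0 ≤ η) (hη4 : η ≤ 4)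
    (havg : ∀ u : E, ⟪u, avgOp z u⟫_ℝ ≤ 2 * ‖u‖ ^ 2) :
    ((Finset.univ.filter fun ω : Fin m → κ =>
        ∃ u : E, m * η * ‖u‖ ^ 2 < ⟪u, sampleOp z σ ω u⟫_ℝ).card : ℝ) ≤
      (Fintype.card κ : ℝ) ^ m * (Module.finrank ℝ E * Real.exp (-(m * η ^ 2 / (16 * R)))) := by
  -- The minimizer of `4mRθ² - θmη`, with value `-mη²/(16R)`; the assumption `η ≤ 4` says that it
  -- lies in the range `θ ≤ 1/(2R)`.
  set θ := η / (8 * R) with hθ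
  have hθ0 : 0 ≤ θ := by positivity
  have hmgf := traceMgf_pos_le (m := m) z hσ hR0 hR hθ0
    (by rw [hθ, div_le_div_iff₀ (by positivity) (by positivity)]; nlinarith) havg
  set B := Finset.univ.filter fun ω : Fin m → κ =>
        ∃ u : E, m * η * ‖u‖ ^ 2 < ⟪u, sampleOp z σ ω u⟫_ℝ
  have h1 : (B.card : ℝ) * Real.exp (θ * (m * η)) ≤ traceMgf m z σ θ := by
    rw [← nsmul_eq_mul, ← Finset.sum_const]
    unfold traceMgf
    refine (Finset.sum_le_sum fun ω hω => ?_).trans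
      (Finset.sum_le_sum_of_subset_of_nonneg (Finset.subset_univ B)
        fun ω _ _ => Finset.sum_nonneg fun _ _ => (Real.exp_pos _).le)
    obtain ⟨u, hu⟩ := (Finset.mem_filter.1 hω).2
    exact exp_le_sum_exp_eigenvalues _ hθ0 hu
  rw [← le_div_iff₀ (Real.exp_pos _)] at h1
  refine h1.trans ((div_le_div_of_nonneg_right hmgf (Real.exp_pos _).le).trans (le_of_eq ?_))
  rw [mul_div_assoc, ← Real.exp_sub, mul_assoc]
  congr 3
  rw [hθ]
  field_simp
  ring

end Concentration

end KDEAttention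
end

noncomputable section

namespace KDEAttention

/-! ### Approximate matrix multiplication by sampling -/

section Ambient

open scoped InnerProductSpace

variable {F : Type*} [NormedAddCommGroup F] [InnerProductSpace ℝ F]
variable {κ : Type*} [Fintype κ] {m n : ℕ}

theorem inner_sampleOp_apply {E : Type*} [NormedAddCommGroup E] [InnerProductSpace ℝ E]
    (z : κ → E) (σ : ℝ) (ω : Fin m → κ) (u : E) :
    ⟪u, sampleOp z σ ω u⟫_ℝ = σ * ∑ r, (⟪z (ω r), u⟫_ℝ ^ 2 -
      (Fintype.card κ : ℝ)⁻¹ * ∑ t, ⟪z t, u⟫_ℝ ^ 2) := by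
  simp only [sampleOp, LinearMap.smul_apply, LinearMap.sum_apply, LinearMap.sub_apply,
    inner_smul_right, inner_sum, inner_sub_right, avgOp_apply_inner, rankOneOp_apply]
  congr 1
  refine Finset.sum_congr rfl fun r _ => ?_
  rw [real_inner_comm u]; ring

open Classical in
/-- Two-sided concentration for samples of a family of vectors that spans a space of dimension at
most `n`. -/
theorem card_sample_deviation_le [Nonempty κ] (y : Fin n → F) (l : κ → Fin n) (c : κ → ℝ)
    {R η : ℝ} (hR0 : 0 < R) (hR : ∀ t, ‖c t • y (l t)‖ ^ 2 ≤ R) (hη : 0 ≤ η) (hη4 : η ≤ 4)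
    (havg : ∀ u : F, (Fintype.card κ : ℝ)⁻¹ * ∑ t, ⟪c t • y (l t), u⟫_ℝ ^ 2 ≤ 2 * ‖u‖ ^ 2) :
    ((Finset.univ.filter fun ω : Fin m → κ => ∃ u : F, m * η * ‖u‖ ^ 2 <
        |∑ r, (⟪c (ω r) • y (l (ω r)), u⟫_ℝ ^ 2 -
          (Fintype.card κ : ℝ)⁻¹ * ∑ t, ⟪c t • y (l t), u⟫_ℝ ^ 2)|).card : ℝ) ≤
      (Fintype.card κ : ℝ) ^ m * (2 * n * Real.exp (-(m * η ^ 2 / (16 * R)))) := by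
  -- Working in the span makes the dimension factor at most `n`, independent of the ambient
  -- dimension. A violating vector projects to a violating vector in the span, since projection
  -- keeps the inner products with the `y i` and does not increase the norm.
  set S := Submodule.span ℝ (Set.range y)
  have : FiniteDimensional ℝ S := FiniteDimensional.span_of_finite ℝ (Set.finite_range y)
  have hdim : Module.finrank ℝ S ≤ n := by
    have h := finrank_range_le_card (R := ℝ) y
    rwa [Fintype.card_fin] at h
  set z : κ → S := fun t =>
    ⟨c t • y (l t), S.smul_mem _ (Submodule.subset_span (Set.mem_range_self _))⟩ with hz
  have hproj : ∀ (u : F) (t : κ), ⟪z t, S.orthogonalProjectionOnto u⟫_ℝ = ⟪c t • y (l t), u⟫_ℝ := by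
    intro u t
    rw [← Submodule.inner_orthogonalProjectionOnto_eq_of_mem_left (z t) u]
  have hzR : ∀ t, ‖z t‖ ^ 2 ≤ R := fun t => hR t
  have hzavg : ∀ u : S, ⟪u, avgOp z u⟫_ℝ ≤ 2 * ‖u‖ ^ 2 := by
    intro u
    rw [avgOp_apply_inner]
    exact havg u
  have hpos := card_sampleOp_large_le (m := m) z (Or.inl rfl) hR0 hzR hη hη4 hzavg
  have hneg := card_sampleOp_large_le (m := m) z (Or.inr rfl) hR0 hzR hη hη4 hzavg
  have hsub : (Finset.univ.filter fun ω : Fin m → κ => ∃ u : F, m * η * ‖u‖ ^ 2 <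
        |∑ r, (⟪c (ω r) • y (l (ω r)), u⟫_ℝ ^ 2 -
          (Fintype.card κ : ℝ)⁻¹ * ∑ t, ⟪c t • y (l t), u⟫_ℝ ^ 2)|) ⊆
      (Finset.univ.filter fun ω : Fin m → κ =>
        ∃ u : S, m * η * ‖u‖ ^ 2 < ⟪u, sampleOp z 1 ω u⟫_ℝ) ∪
      (Finset.univ.filter fun ω : Fin m → κ =>
        ∃ u : S, m * η * ‖u‖ ^ 2 < ⟪u, sampleOp z (-1) ω u⟫_ℝ) := by
    intro ω hω
    obtain ⟨u, hu⟩ := (Finset.mem_filter.1 hω).2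
    have hn : ‖S.orthogonalProjectionOnto u‖ ^ 2 ≤ ‖u‖ ^ 2 :=
      pow_le_pow_left₀ (norm_nonneg _) (S.norm_orthogonalProjectionOnto_apply_le u) 2
    have hn' : m * η * ‖S.orthogonalProjectionOnto u‖ ^ 2 ≤ m * η * ‖u‖ ^ 2 :=
      mul_le_mul_of_nonneg_left hn (by positivity)
    simp only [← hproj u] at hu
    rw [Finset.mem_union, Finset.mem_filter, Finset.mem_filter]
    rcases lt_abs.1 hu with h | h
    · refine Or.inl ⟨Finset.mem_univ _, S.orthogonalProjectionOnto u, ?_⟩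
      rw [inner_sampleOp_apply]; linarith
    · refine Or.inr ⟨Finset.mem_univ _, S.orthogonalProjectionOnto u, ?_⟩
      rw [inner_sampleOp_apply]; linarith
  have hcard := (Finset.card_le_card hsub).trans (Finset.card_union_le _ _)
  have hcard' : ((Finset.univ.filter fun ω : Fin m → κ => ∃ u : F, m * η * ‖u‖ ^ 2 <
        |∑ r, (⟪c (ω r) • y (l (ω r)), u⟫_ℝ ^ 2 -
          (Fintype.card κ : ℝ)⁻¹ * ∑ t, ⟪c t • y (l t), u⟫_ℝ ^ 2)|).card : ℝ) ≤ _ :=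
    Nat.cast_le.2 hcard
  rw [Nat.cast_add] at hcard'
  refine hcard'.trans ((add_le_add hpos hneg).trans ?_)
  rw [← two_mul, ← mul_assoc, mul_comm (2 : ℝ), mul_assoc]
  refine mul_le_mul_of_nonneg_left ?_ (by positivity)
  rw [← mul_assoc]
  refine mul_le_mul_of_nonneg_right ?_ (Real.exp_pos _).le
  exact mul_le_mul_of_nonneg_left (by exact_mod_cast hdim) (by norm_num)

end Ambient

/-! ### Elementary facts about the spectral norm. -/

section OpNorm

open scoped Matrix.Norms.L2Operator

variable {m n k : ℕ}

theorem opNorm_nonneg (A : Matrix (Fin m) (Fin n) ℝ) : 0 ≤ opNorm A := norm_nonneg A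

theorem opNorm_mul_le (A : Matrix (Fin m) (Fin n) ℝ) (B : Matrix (Fin n) (Fin k) ℝ) :
    opNorm (A * B) ≤ opNorm A * opNorm B := Matrix.l2_opNorm_mul A B

theorem opNorm_add_le (A B : Matrix (Fin m) (Fin n) ℝ) :
    opNorm (A + B) ≤ opNorm A + opNorm B := norm_add_le A B

theorem opNorm_sub_le (A B : Matrix (Fin m) (Fin n) ℝ) :
    opNorm (A - B) ≤ opNorm A + opNorm B := norm_sub_le A B

theorem opNorm_eq_zero {A : Matrix (Fin m) (Fin n) ℝ} : opNorm A = 0 ↔ A = 0 := norm_eq_zero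

theorem opNorm_transpose (A : Matrix (Fin m) (Fin n) ℝ) : opNorm A.transpose = opNorm A := by
  have := Matrix.l2_opNorm_conjTranspose A
  rwa [Matrix.conjTranspose_eq_transpose_of_trivial] at this

theorem opNorm_diagonal_le {v : Fin n → ℝ} {c : ℝ} (hc : 0 ≤ c) (hv : ∀ i, |v i| ≤ c) :
    opNorm (Matrix.diagonal v) ≤ c := by
  unfold opNorm
  rw [Matrix.l2_opNorm_diagonal]
  exact (pi_norm_le_iff_of_nonneg hc).2 hv

theorem euclideanSpace_norm_sq_eq_dotProduct (x : Fin n → ℝ) :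
    ‖(WithLp.toLp 2 x : EuclideanSpace ℝ (Fin n))‖ ^ 2 = x ⬝ᵥ x := by
  rw [EuclideanSpace.norm_sq_eq]
  simp [dotProduct, sq]

open Matrix in
theorem mulVec_dotProduct_self_le (A : Matrix (Fin m) (Fin n) ℝ) (x : Fin n → ℝ) :
    (A *ᵥ x) ⬝ᵥ (A *ᵥ x) ≤ opNorm A ^ 2 * (x ⬝ᵥ x) := by
  have h := Matrix.l2_opNorm_mulVec A (WithLp.toLp 2 x)
  have h2 := pow_le_pow_left₀ (norm_nonneg _) h 2
  rw [mul_pow, euclideanSpace_norm_sq_eq_dotProduct x, EuclideanSpace.norm_sq_eq] at h2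
  simp only [Real.norm_eq_abs, sq_abs, dotProduct, ← sq] at h2 ⊢
  exact h2

open Matrix in
theorem vecMul_dotProduct_self_le (A : Matrix (Fin m) (Fin n) ℝ) (x : Fin m → ℝ) :
    (x ᵥ* A) ⬝ᵥ (x ᵥ* A) ≤ opNorm A ^ 2 * (x ⬝ᵥ x) := by
  have := mulVec_dotProduct_self_le A.transpose x
  rwa [Matrix.mulVec_transpose, opNorm_transpose] at this

open Matrix in
theorem opNorm_le_of_forall_mulVec {A : Matrix (Fin m) (Fin n) ℝ} {c : ℝ} (hc : 0 ≤ c)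
    (h : ∀ y, (A *ᵥ y) ⬝ᵥ (A *ᵥ y) ≤ c ^ 2 * (y ⬝ᵥ y)) : opNorm A ≤ c := by
  unfold opNorm
  rw [Matrix.l2_opNorm_def]
  refine ContinuousLinearMap.opNorm_le_bound _ hc fun y => ?_
  refine le_of_sq_le_sq ?_ (by positivity)
  rw [mul_pow]
  have h1 := h y.ofLp
  rw [← euclideanSpace_norm_sq_eq_dotProduct, ← euclideanSpace_norm_sq_eq_dotProduct] at h1
  exact h1

open Matrix in
/-- A bound for the spectral norm from a bound for the bilinear form. -/
theorem opNorm_le_of_forall_bilin {A : Matrix (Fin m) (Fin n) ℝ} {c : ℝ} (hc : 0 ≤ c)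
    (h : ∀ x y, x ⬝ᵥ (A *ᵥ y) ≤ c / 2 * (x ⬝ᵥ x + y ⬝ᵥ y)) : opNorm A ≤ c := by
  refine opNorm_le_of_forall_mulVec hc fun y => ?_
  set w := A *ᵥ y with hw
  have hww : 0 ≤ w ⬝ᵥ w := by
    rw [← euclideanSpace_norm_sq_eq_dotProduct]; positivity
  have hyy : 0 ≤ y ⬝ᵥ y := by
    rw [← euclideanSpace_norm_sq_eq_dotProduct]; positivity
  rcases hc.eq_or_lt with hc0 | hc0
  · have := h w y
    rw [← hw, ← hc0] at this
    rw [← hc0]; linarith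
  -- The scaling `c⁻¹` balances the two terms: the hypothesis becomes `‖w‖²/c ≤ (c/2)(‖w‖²/c² +
  -- ‖y‖²)`, which is the claim.
  · have := h (c⁻¹ • w) y
    rw [← hw] at this
    simp only [smul_dotProduct, dotProduct_smul, smul_eq_mul] at this
    have h2 := mul_le_mul_of_nonneg_left this hc0.le
    field_simp at h2
    nlinarith [h2]

end OpNorm

/-- The sampling matrix of the sample `ω` of positions in a table `l`, for the probabilities `p`. -/
def tableSampling {m n T : ℕ} (l : Fin T → Fin n) (p : Fin n → ℝ) (ω : Fin m → Fin T) :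
    Matrix (Fin m) (Fin n) ℝ :=
  Matrix.of fun r i => if i = l (ω r) then 1 / Real.sqrt (m * p (l (ω r))) else 0

/-! ### Importance sampling of a matrix product. -/

section Sampling

open Matrix

variable {m n d T : ℕ}

theorem tableSampling_bilin (P : Matrix (Fin n) (Fin n) ℝ) (V : Matrix (Fin n) (Fin d) ℝ)
    (l : Fin T → Fin n) (p : Fin n → ℝ) (hp : ∀ i, 0 < p i) (ω : Fin m → Fin T)
    (x : Fin n → ℝ) (y : Fin d → ℝ) :
    x ⬝ᵥ ((P * (tableSampling l p ω)ᵀ * (tableSampling l p ω * V)) *ᵥ y) =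
      ∑ r, (x ᵥ* P) (l (ω r)) * (V *ᵥ y) (l (ω r)) / (m * p (l (ω r))) := by
  have h1 : x ⬝ᵥ ((P * (tableSampling l p ω)ᵀ * (tableSampling l p ω * V)) *ᵥ y) =
      (x ᵥ* P ᵥ* (tableSampling l p ω)ᵀ) ⬝ᵥ (tableSampling l p ω *ᵥ (V *ᵥ y)) := by
    rw [← Matrix.mulVec_mulVec, ← Matrix.mulVec_mulVec, ← Matrix.mulVec_mulVec,
      Matrix.dotProduct_mulVec, Matrix.dotProduct_mulVec]
  rw [h1, dotProduct]
  refine Finset.sum_congr rfl fun r _ => ?_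
  have h2 : ∀ f : Fin n → ℝ, (tableSampling l p ω *ᵥ f) r =
      f (l (ω r)) / Real.sqrt (m * p (l (ω r))) := by
    intro f
    simp [Matrix.mulVec, dotProduct, tableSampling, ite_mul]
    ring
  rw [Matrix.vecMul_transpose, h2, h2, div_mul_div_comm, Real.mul_self_sqrt]
  exact mul_nonneg (Nat.cast_nonneg _) (hp _).le

/-- Importance weighting is unbiased: index `i` fills `T * p i` positions of the table, each
weighted by `1 / p i`. -/
theorem sum_table (l : Fin T → Fin n) (p : Fin n → ℝ)
    (hp : ∀ i, p i = ((Finset.univ.filter fun t => l t = i).card : ℝ) / T) (hp0 : ∀ i, 0 < p i)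
    (f : Fin n → ℝ) :
    (T : ℝ)⁻¹ * ∑ t, f (l t) / p (l t) = ∑ i, f i := by
  rw [← Finset.sum_fiberwise (s := Finset.univ) (g := l) (f := fun t => f (l t) / p (l t)),
    Finset.mul_sum]
  refine Finset.sum_congr rfl fun i _ => ?_
  rw [Finset.sum_congr rfl (g := fun _ => f i / p i)
    (fun t ht => by rw [(Finset.mem_filter.1 ht).2]), Finset.sum_const, nsmul_eq_mul]
  have h1 := hp i
  have h2 := (hp0 i).ne'
  have : (T : ℝ)⁻¹ * ((Finset.univ.filter fun t => l t = i).card : ℝ) = p i := by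
    rw [h1]; ring
  rw [← mul_assoc, this]
  field_simp

open Classical in
/-- Sampling the product `P V` from a table with probabilities at least proportional to the
squared norms of the columns of `P` and the rows of `V`. -/
theorem card_sampling_bad_le (P : Matrix (Fin n) (Fin n) ℝ) (V : Matrix (Fin n) (Fin d) ℝ)
    (hT : 0 < T) (hm : 0 < m) (l : Fin T → Fin n) (p : Fin n → ℝ)
    (hp : ∀ i, p i = ((Finset.univ.filter fun t => l t = i).card : ℝ) / T) (hp0 : ∀ i, 0 < p i)
    (hP : 0 < opNorm P) (hV : 0 < opNorm V) {R η : ℝ} (hR0 : 0 < R) (hη : 0 ≤ η) (hη4 : η ≤ 4)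
    (hR : ∀ i, (∑ j, P j i ^ 2) / opNorm P ^ 2 + (∑ j, V i j ^ 2) / opNorm V ^ 2 ≤ R * p i) :
    ((Finset.univ.filter fun ω : Fin m → Fin T =>
      ¬ opNorm (P * V - P * (tableSampling l p ω)ᵀ * (tableSampling l p ω * V)) ≤
        η * opNorm P * opNorm V).card : ℝ) ≤
      (T : ℝ) ^ m * (2 * n * Real.exp (-(m * η ^ 2 / (16 * R)))) := by
  have : Nonempty (Fin T) := ⟨⟨0, hT⟩⟩
  set α := opNorm P
  set β := opNorm V
  -- Column `i` of `P` and row `i` of `V`, both normalized, are put side by side. The product `PV`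
  -- then appears as a cross term of `∑ yᵢyᵢᵀ`, and a single concentration bound serves.
  set y : Fin n → EuclideanSpace ℝ (Fin n ⊕ Fin d) := fun i =>
    WithLp.toLp 2 (Sum.elim (fun j => P j i / α) (fun j => V i j / β)) with hy
  set c : Fin T → ℝ := fun t => (Real.sqrt (p (l t)))⁻¹ with hc
  have hc2 : ∀ t, c t ^ 2 = (p (l t))⁻¹ := fun t => by
    simp only [hc]; rw [inv_pow, Real.sq_sqrt (hp0 _).le]
  have hinner : ∀ i (u : EuclideanSpace ℝ (Fin n ⊕ Fin d)), inner ℝ (y i) u =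
      ((fun j => u (Sum.inl j)) ᵥ* P) i / α + (V *ᵥ (fun j => u (Sum.inr j))) i / β := by
    intro i u
    simp only [hy, PiLp.inner_apply, Fintype.sum_sum_type, Sum.elim_inl, Sum.elim_inr,
      Matrix.vecMul, Matrix.mulVec, dotProduct, Finset.sum_div]
    congr 1 <;> refine Finset.sum_congr rfl fun j _ => ?_ <;> simp <;> ring
  have hnorm : ∀ i, ‖y i‖ ^ 2 = (∑ j, P j i ^ 2) / α ^ 2 + (∑ j, V i j ^ 2) / β ^ 2 := by
    intro i
    simp only [hy, EuclideanSpace.norm_sq_eq, Fintype.sum_sum_type, Sum.elim_inl, Sum.elim_inr,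
      Finset.sum_div, Real.norm_eq_abs, sq_abs, div_pow]
  have hunorm : ∀ u : EuclideanSpace ℝ (Fin n ⊕ Fin d), ‖u‖ ^ 2 =
      (fun j => u (Sum.inl j)) ⬝ᵥ (fun j => u (Sum.inl j)) +
      (fun j => u (Sum.inr j)) ⬝ᵥ (fun j => u (Sum.inr j)) := by
    intro u
    rw [EuclideanSpace.norm_sq_eq, Fintype.sum_sum_type]
    simp only [dotProduct, Real.norm_eq_abs, sq_abs]
    simp only [sq]
  have hsq : ∀ t (u : EuclideanSpace ℝ (Fin n ⊕ Fin d)),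
      (inner ℝ (c t • y (l t)) u : ℝ) ^ 2 = (inner ℝ (y (l t)) u : ℝ) ^ 2 / p (l t) := by
    intro t u
    rw [inner_smul_left, mul_pow]
    simp only [conj_trivial, hc2]
    ring
  have havgeq : ∀ u : EuclideanSpace ℝ (Fin n ⊕ Fin d),
      (T : ℝ)⁻¹ * ∑ t, (inner ℝ (c t • y (l t)) u : ℝ) ^ 2 =
        ∑ i, (inner ℝ (y i) u : ℝ) ^ 2 := by
    intro u
    simp only [hsq]
    exact sum_table l p hp hp0 fun i => (inner ℝ (y i) u : ℝ) ^ 2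
  have hdev := card_sample_deviation_le (m := m) y l c hR0 (η := η) (fun t => by
      rw [norm_smul, mul_pow, Real.norm_eq_abs, sq_abs, hc2, hnorm, inv_mul_le_iff₀ (hp0 _),
        mul_comm (p _)]
      exact hR _) hη hη4 (fun u => by
      rw [Fintype.card_fin, havgeq, hunorm]
      set x := fun j => u (Sum.inl j)
      set w := fun j => u (Sum.inr j)
      have h1 := vecMul_dotProduct_self_le P x
      have h2 := mulVec_dotProduct_self_le V w
      -- The inequality `(a + b)² ≤ 2(a² + b²)` is the origin of the constant `2` in the bound on
      -- the mean operator.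
      have h3 : ∑ i, (inner ℝ (y i) u : ℝ) ^ 2 ≤
          2 * (((x ᵥ* P) ⬝ᵥ (x ᵥ* P)) / α ^ 2 + ((V *ᵥ w) ⬝ᵥ (V *ᵥ w)) / β ^ 2) := by
        simp only [dotProduct, Finset.sum_div]
        rw [← Finset.sum_add_distrib, Finset.mul_sum]
        refine Finset.sum_le_sum fun i _ => ?_
        rw [hinner]
        have e1 : (x ᵥ* P) i * (x ᵥ* P) i / α ^ 2 = ((x ᵥ* P) i / α) ^ 2 := by ring
        have e2 : (V *ᵥ w) i * (V *ᵥ w) i / β ^ 2 = ((V *ᵥ w) i / β) ^ 2 := by ring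
        change _ ≤ 2 * ((x ᵥ* P) i * (x ᵥ* P) i / α ^ 2 + (V *ᵥ w) i * (V *ᵥ w) i / β ^ 2)
        rw [e1, e2]
        nlinarith [sq_nonneg ((x ᵥ* P) i / α - (V *ᵥ w) i / β)]
      refine h3.trans (mul_le_mul_of_nonneg_left (add_le_add ?_ ?_) (by norm_num))
      · rw [div_le_iff₀ (by positivity)]; linarith
      · rw [div_le_iff₀ (by positivity)]; linarith)
  rw [Fintype.card_fin] at hdev
  refine le_trans ?_ hdev
  refine Nat.cast_le.2 (Finset.card_le_card fun ω hω => ?_)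
  rw [Finset.mem_filter] at hω ⊢
  refine ⟨Finset.mem_univ _, ?_⟩
  by_contra! hcon
  refine hω.2 (opNorm_le_of_forall_bilin (by positivity) fun x w => ?_)
  have hmR : (0 : ℝ) < m := Nat.cast_pos.2 hm
  set a := x ᵥ* P with ha
  set b := V *ᵥ w with hb
  -- The deviation bound is tested on `(x, w)` and `(x, -w)`. These vectors have equal norm, and the
  -- difference of the two quadratic forms isolates the bilinear cross term.
  have dev : ∀ s : ℝ, s ^ 2 = 1 → |∑ r, ((a (l (ω r)) / α + s * (b (l (ω r)) / β)) ^ 2 /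
      p (l (ω r))) - m * ∑ i, (a i / α + s * (b i / β)) ^ 2| ≤
        m * η * (x ⬝ᵥ x + w ⬝ᵥ w) := by
    intro s hs
    have h := hcon (WithLp.toLp 2 (Sum.elim x (s • w)))
    rw [hunorm] at h
    simp only [havgeq] at h
    simp only [hsq, hinner, Sum.elim_inl, Sum.elim_inr] at h
    have e1 : (fun j => s * w j) ⬝ᵥ (fun j => s * w j) = w ⬝ᵥ w := by
      change (s • w) ⬝ᵥ (s • w) = _
      rw [smul_dotProduct, dotProduct_smul, smul_smul, ← sq, hs, one_smul]
    have e2 : (V *ᵥ fun j => s * w j) = s • b := Matrix.mulVec_smul V s w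
    rw [Finset.sum_sub_distrib, Finset.sum_const, Finset.card_univ, Fintype.card_fin,
      nsmul_eq_mul] at h
    simp only [Pi.smul_apply, smul_eq_mul, e1] at h
    rw [e2] at h
    simp only [Pi.smul_apply, smul_eq_mul, mul_div_assoc] at h
    exact h
  have hplus := neg_le_of_abs_le (dev 1 (by norm_num))
  have hminus := le_of_abs_le (dev (-1) (by norm_num))
  have key : ∑ r, (-4) * (a (l (ω r)) * b (l (ω r)) / (m * p (l (ω r)))) * (m / (α * β)) -
      m * ∑ i, (-4) * (a i * b i) / (α * β) ≤ 2 * (m * η * (x ⬝ᵥ x + w ⬝ᵥ w)) := by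
    have e1 : ∑ r, (-4) * (a (l (ω r)) * b (l (ω r)) / (m * p (l (ω r)))) * (m / (α * β)) =
        ∑ r, ((a (l (ω r)) / α + -1 * (b (l (ω r)) / β)) ^ 2 / p (l (ω r))) -
        ∑ r, ((a (l (ω r)) / α + 1 * (b (l (ω r)) / β)) ^ 2 / p (l (ω r))) := by
      rw [← Finset.sum_sub_distrib]
      refine Finset.sum_congr rfl fun r _ => ?_
      have := (hp0 (l (ω r))).ne'
      field_simp
      ring
    have e2 : ∑ i, (-4) * (a i * b i) / (α * β) =
        ∑ i, (a i / α + -1 * (b i / β)) ^ 2 - ∑ i, (a i / α + 1 * (b i / β)) ^ 2 := by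
      rw [← Finset.sum_sub_distrib]
      refine Finset.sum_congr rfl fun r _ => ?_
      field_simp
      ring
    rw [e1, e2]
    linarith
  rw [Matrix.sub_mulVec, dotProduct_sub, tableSampling_bilin P V l p hp0,
    ← Matrix.mulVec_mulVec, Matrix.dotProduct_mulVec, ← ha, ← hb, dotProduct]
  rw [← Finset.sum_mul, ← Finset.mul_sum, ← Finset.sum_div, ← Finset.mul_sum] at key
  set S1 := ∑ i, a i * b i
  set S2 := ∑ r, a (l (ω r)) * b (l (ω r)) / (m * p (l (ω r)))
  have e3 : -4 * S2 * (m / (α * β)) - m * (-4 * S1 / (α * β)) =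
      4 * m * (S1 - S2) / (α * β) := by ring
  rw [e3, div_le_iff₀ (by positivity)] at key
  have : 4 * m * (S1 - S2) ≤ 4 * m * (η * α * β / 2 * (x ⬝ᵥ x + w ⬝ᵥ w)) := by linarith
  exact le_of_mul_le_mul_left this (by positivity)

end Sampling

end KDEAttention
end

noncomputable section

namespace KDEAttention

/-! ### The softmax matrix and the spectral guarantee -/

section Softmax

open Matrix

variable {m n d : ℕ}

/-- The row sums of the attention matrix. -/
def attnRowSum (Q K : Matrix (Fin n) (Fin d) ℝ) (i : Fin n) : ℝ :=
  ∑ l, Real.exp (Q i ⬝ᵥ K l / Real.sqrt d)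

theorem attnMatrix_apply (Q K : Matrix (Fin n) (Fin d) ℝ) (i j : Fin n) :
    attnMatrix Q K i j = Real.exp (Q i ⬝ᵥ K j / Real.sqrt d) := rfl

theorem attnRowSum_pos (hn : 0 < n) (Q K : Matrix (Fin n) (Fin d) ℝ) (i : Fin n) :
    0 < attnRowSum Q K i := by
  have : Nonempty (Fin n) := ⟨⟨0, hn⟩⟩
  exact Finset.sum_pos (fun _ _ => Real.exp_pos _) Finset.univ_nonempty

theorem diagonal_inv_of_pos {v : Fin n → ℝ} (hv : ∀ i, 0 < v i) :
    (Matrix.diagonal v)⁻¹ = Matrix.diagonal fun i => (v i)⁻¹ := by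
  refine Matrix.inv_eq_left_inv ?_
  rw [Matrix.diagonal_mul_diagonal, ← Matrix.diagonal_one]
  congr 1
  funext i
  exact inv_mul_cancel₀ (hv i).ne'

theorem attnScale_eq (Q K : Matrix (Fin n) (Fin d) ℝ) :
    attnScale Q K = Matrix.diagonal (attnRowSum Q K) := by
  unfold attnScale
  congr 1
  funext i
  simp [Matrix.mulVec, dotProduct, attnMatrix_apply, attnRowSum]

theorem softmaxMatrix_apply (hn : 0 < n) (Q K : Matrix (Fin n) (Fin d) ℝ) (i j : Fin n) :
    softmaxMatrix Q K i j = Real.exp (Q i ⬝ᵥ K j / Real.sqrt d) / attnRowSum Q K i := by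
  unfold softmaxMatrix
  rw [attnScale_eq, diagonal_inv_of_pos (attnRowSum_pos hn Q K), Matrix.diagonal_mul,
    attnMatrix_apply]
  ring

/-- The rows of the softmax matrix sum to one, so it fixes the all-ones vector. -/
theorem one_le_opNorm_softmaxMatrix (hn : 0 < n) (Q K : Matrix (Fin n) (Fin d) ℝ) :
    1 ≤ opNorm (softmaxMatrix Q K) := by
  have h := mulVec_dotProduct_self_le (softmaxMatrix Q K) 1
  have h1 : softmaxMatrix Q K *ᵥ 1 = 1 := by
    funext i
    simp only [Matrix.mulVec, dotProduct, Pi.one_apply, mul_one, softmaxMatrix_apply hn]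
    rw [← Finset.sum_div]
    exact div_self (attnRowSum_pos hn Q K i).ne'
  rw [h1] at h
  have h2 : (0 : ℝ) < (1 : Fin n → ℝ) ⬝ᵥ 1 := by
    simp [dotProduct]; exact hn
  have h3 : 1 ≤ opNorm (softmaxMatrix Q K) ^ 2 := by
    by_contra! hc
    nlinarith
  nlinarith [opNorm_nonneg (softmaxMatrix Q K)]

theorem srank_softmaxMatrix_pos (hn : 0 < n) (Q K : Matrix (Fin n) (Fin d) ℝ) :
    0 < srank (softmaxMatrix Q K) := by
  have h1 := one_le_opNorm_softmaxMatrix hn Q K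
  refine div_pos ?_ (by positivity)
  have : Nonempty (Fin n) := ⟨⟨0, hn⟩⟩
  refine Finset.sum_pos (fun i _ => Finset.sum_pos (fun j _ => ?_) Finset.univ_nonempty)
    Finset.univ_nonempty
  rw [softmaxMatrix_apply hn]
  have := attnRowSum_pos hn Q K i
  positivity

theorem srank_nonneg (V : Matrix (Fin n) (Fin d) ℝ) : 0 ≤ srank V :=
  div_nonneg (Finset.sum_nonneg fun _ _ => Finset.sum_nonneg fun _ _ => sq_nonneg _)
    (sq_nonneg _)

/-- The spectral guarantee from an approximate scaling and an approximate product. -/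
theorem spectralGuarantee_of_approx (hn : 0 < n) (Q K V : Matrix (Fin n) (Fin d) ℝ) {ε : ℝ}
    (hε : 0 < ε) (hε2 : ε < 2) {v : Fin n → ℝ}
    (hv : ∀ i, |v i - attnRowSum Q K i| ≤ ε / 8 * attnRowSum Q K i)
    (S : Matrix (Fin m) (Fin n) ℝ)
    (hS : opNorm (softmaxMatrix Q K * V - softmaxMatrix Q K * Sᵀ * (S * V)) ≤
      ε / 2 * opNorm (softmaxMatrix Q K) * opNorm V) :
    (∀ i, 0 < v i) ∧ SpectralGuarantee Q K V ε (Matrix.diagonal v) S := by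
  have hD := attnRowSum_pos hn Q K
  have hlow : ∀ i, (1 - ε / 8) * attnRowSum Q K i ≤ v i := fun i => by
    have := neg_le_of_abs_le (hv i); linarith
  have hv0 : ∀ i, 0 < v i := fun i =>
    lt_of_lt_of_le (mul_pos (by linarith) (hD i)) (hlow i)
  refine ⟨hv0, ?_⟩
  set P := softmaxMatrix Q K with hP
  set ρ : Fin n → ℝ := fun i => attnRowSum Q K i / v i with hρ
  -- Since `ε < 2`, the approximation is at least `3/4` of the true row sum, and `(ε/8)/(3/4) =
  -- ε/6`.
  have hρ1 : ∀ i, |1 - ρ i| ≤ ε / 6 := by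
    intro i
    have e : 1 - ρ i = (v i - attnRowSum Q K i) / v i := by
      simp only [hρ]; have := (hv0 i).ne'; field_simp
    rw [e, abs_div, abs_of_pos (hv0 i), div_le_iff₀ (hv0 i)]
    refine (hv i).trans ?_
    have h3 : 3 / 4 * attnRowSum Q K i ≤ v i :=
      le_trans (mul_le_mul_of_nonneg_right (by linarith) (hD i).le) (hlow i)
    nlinarith
  have hρ2 : ∀ i, |ρ i| ≤ 4 / 3 := by
    intro i
    have := hρ1 i
    have h1 : |ρ i| ≤ |1 - ρ i| + 1 := by
      calc |ρ i| = |1 - (1 - ρ i)| := by ring_nf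
        _ ≤ |(1 : ℝ)| + |1 - ρ i| := abs_sub _ _
        _ = _ := by simp [add_comm]
    linarith
  have hA : (Matrix.diagonal v)⁻¹ * attnMatrix Q K = Matrix.diagonal ρ * P := by
    ext i j
    rw [diagonal_inv_of_pos hv0, Matrix.diagonal_mul, Matrix.diagonal_mul, hP,
      softmaxMatrix_apply hn, attnMatrix_apply]
    have h1 := (hv0 i).ne'
    have h2 := (hD i).ne'
    simp only [hρ]
    field_simp
  unfold SpectralGuarantee
  have hsplit : attention Q K V - (Matrix.diagonal v)⁻¹ * attnMatrix Q K * Sᵀ * (S * V) =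
      Matrix.diagonal (fun i => 1 - ρ i) * (P * V) +
        Matrix.diagonal ρ * (P * V - P * Sᵀ * (S * V)) := by
    rw [hA, Matrix.mul_sub, ← Matrix.mul_assoc (Matrix.diagonal ρ) (P * Sᵀ),
      ← Matrix.mul_assoc (Matrix.diagonal ρ) P Sᵀ]
    have : attention Q K V = Matrix.diagonal (fun i => 1 - ρ i) * (P * V) +
        Matrix.diagonal ρ * (P * V) := by
      rw [← Matrix.add_mul, Matrix.diagonal_add]
      simp [attention, hP]
    rw [this]
    abel
  rw [hsplit]
  have hPV := opNorm_mul_le P V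
  have n1 : opNorm (Matrix.diagonal (fun i => 1 - ρ i) * (P * V)) ≤
      ε / 6 * (opNorm P * opNorm V) :=
    (opNorm_mul_le _ _).trans (mul_le_mul (opNorm_diagonal_le (by linarith) hρ1) hPV
      (opNorm_nonneg _) (by linarith))
  have n2 : opNorm (Matrix.diagonal ρ * (P * V - P * Sᵀ * (S * V))) ≤
      4 / 3 * (ε / 2 * opNorm P * opNorm V) :=
    (opNorm_mul_le _ _).trans (mul_le_mul (opNorm_diagonal_le (by norm_num) hρ2) hS
      (opNorm_nonneg _) (by norm_num))
  have hnn : 0 ≤ opNorm P * opNorm V := mul_nonneg (opNorm_nonneg _) (opNorm_nonneg _)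
  have := opNorm_add_le (Matrix.diagonal (fun i => 1 - ρ i) * (P * V))
    (Matrix.diagonal ρ * (P * V - P * Sᵀ * (S * V)))
  -- The total is `ε/6 + (4/3)(ε/2) = 5ε/6`.
  nlinarith

/-- For `ε ≥ 2` it suffices to keep the approximation small. -/
theorem spectralGuarantee_of_two_le (hn : 0 < n) (hm : 0 < m) (Q K V : Matrix (Fin n) (Fin d) ℝ)
    {ε : ℝ} (hε : 2 ≤ ε) {v : Fin n → ℝ} (k : Fin n)
    (hv : ∀ i, v i = n * Real.exp (Q i ⬝ᵥ K k / Real.sqrt d))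
    (S : Matrix (Fin m) (Fin n) ℝ) (hS : ∀ r i, S r i = if i = k then 1 / Real.sqrt m else 0) :
    SpectralGuarantee Q K V ε (Matrix.diagonal v) S := by
  have hnR : (0 : ℝ) < n := Nat.cast_pos.2 hn
  have hmR : (0 : ℝ) < m := Nat.cast_pos.2 hm
  have hv0 : ∀ i, 0 < v i := fun i => by rw [hv]; positivity
  set M := (Matrix.diagonal v)⁻¹ * attnMatrix Q K * Sᵀ * (S * V) with hM
  -- The scaling `v` is chosen so that column `k` of the rescaled attention matrix is constantly
  -- `1/n`. The approximant then sends `y` to the constant vector `(Vy)ₖ / n`, whose norm is at most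
  -- `‖Vy‖`.
  have h1 : ∀ i r, ((Matrix.diagonal v)⁻¹ * attnMatrix Q K * Sᵀ) i r =
      1 / n * (1 / Real.sqrt m) := by
    intro i r
    rw [Matrix.mul_apply, diagonal_inv_of_pos hv0]
    simp only [Matrix.transpose_apply, hS, Matrix.diagonal_mul, attnMatrix_apply, mul_ite, mul_zero,
      Finset.sum_ite_eq', Finset.mem_univ, if_true]
    rw [hv i]
    have := (Real.exp_pos (Q i ⬝ᵥ K k / Real.sqrt d)).ne'
    field_simp
  have h2 : ∀ y i, (M *ᵥ y) i = 1 / n * (V *ᵥ y) k := by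
    intro y i
    rw [hM, ← Matrix.mulVec_mulVec, ← Matrix.mulVec_mulVec y S V]
    have h3 : ∀ r, (S *ᵥ (V *ᵥ y)) r = 1 / Real.sqrt m * (V *ᵥ y) k := by
      intro r
      simp [Matrix.mulVec, dotProduct, hS]
    change ∑ r, ((Matrix.diagonal v)⁻¹ * attnMatrix Q K * Sᵀ) i r * (S *ᵥ (V *ᵥ y)) r = _
    simp only [h1, h3, Finset.sum_const, Finset.card_univ, Fintype.card_fin, nsmul_eq_mul]
    have : Real.sqrt m * Real.sqrt m = m := Real.mul_self_sqrt hmR.le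
    have h5 : Real.sqrt m ≠ 0 := (Real.sqrt_pos.2 hmR).ne'
    field_simp
    rw [sq, this]
  have hMV : opNorm M ≤ opNorm V := by
    refine opNorm_le_of_forall_mulVec (opNorm_nonneg _) fun y => ?_
    refine le_trans ?_ (mulVec_dotProduct_self_le V y)
    rw [dotProduct]
    simp only [h2, Finset.sum_const, Finset.card_univ, Fintype.card_fin, nsmul_eq_mul]
    have h6 : (V *ᵥ y) k * (V *ᵥ y) k ≤ (V *ᵥ y) ⬝ᵥ (V *ᵥ y) :=
      Finset.single_le_sum (f := fun i => (V *ᵥ y) i * (V *ᵥ y) i)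
        (fun i _ => mul_self_nonneg _) (Finset.mem_univ k)
    have h7 : (n : ℝ) * (1 / n * (V *ᵥ y) k * (1 / n * (V *ᵥ y) k)) =
        1 / n * ((V *ᵥ y) k * (V *ᵥ y) k) := by field_simp
    have h8 : (1 : ℝ) / n ≤ 1 := by
      rw [div_le_one hnR]; exact_mod_cast hn
    rw [h7]
    nlinarith [mul_self_nonneg ((V *ᵥ y) k)]
  have hP := one_le_opNorm_softmaxMatrix hn Q K
  have hV := opNorm_nonneg V
  unfold SpectralGuarantee
  refine (opNorm_sub_le _ _).trans ?_
  have h9 : opNorm (attention Q K V) ≤ opNorm (softmaxMatrix Q K) * opNorm V := opNorm_mul_le _ _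
  have h10 : opNorm V ≤ opNorm (softmaxMatrix Q K) * opNorm V := by nlinarith
  have h11 : 0 ≤ opNorm (softmaxMatrix Q K) * opNorm V := by positivity
  rw [mul_assoc]
  nlinarith

end Softmax

/-! ### The data-dependent cost -/

section Cost

variable {n d : ℕ}

open Classical in
theorem le_kdeCost {X Y : Matrix (Fin n) (Fin d) ℝ} {v : Fin n → ℝ} {ε τ B : ℝ}
    (h : ∀ μ : ℝ, 0 < μ → B ≤ 1 / (ε ^ 2 * μ ^ τ) +
      ((Finset.univ.filter fun i : Fin n =>
        (∑ j, v j * Real.exp (X j ⬝ᵥ Y i)) /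
          (∑ j, v j * Real.exp ((X j ⬝ᵥ X j + Y i ⬝ᵥ Y i) / 2)) < n * μ).card : ℝ)) :
    B ≤ kdeCost X Y v ε τ := by
  have : Nonempty (Set.Ioi (0 : ℝ)) := ⟨⟨1, Set.mem_Ioi.2 one_pos⟩⟩
  exact le_ciInf fun μ => h μ μ.2

theorem kdeCost_nonneg (X Y : Matrix (Fin n) (Fin d) ℝ) (v : Fin n → ℝ) (ε τ : ℝ) :
    0 ≤ kdeCost X Y v ε τ := by
  refine le_kdeCost fun μ hμ => ?_
  have : 0 < μ ^ τ := Real.rpow_pos_of_pos hμ τ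
  positivity

open Classical in
theorem kdeCost_le {X Y : Matrix (Fin n) (Fin d) ℝ} {v : Fin n → ℝ} {ε τ μ : ℝ} (hμ : 0 < μ) :
    kdeCost X Y v ε τ ≤ 1 / (ε ^ 2 * μ ^ τ) +
      ((Finset.univ.filter fun i : Fin n =>
        (∑ j, v j * Real.exp (X j ⬝ᵥ Y i)) /
          (∑ j, v j * Real.exp ((X j ⬝ᵥ X j + Y i ⬝ᵥ Y i) / 2)) < n * μ).card : ℝ) := by
  refine ciInf_le (f := fun μ : Set.Ioi (0 : ℝ) => (1 / (ε ^ 2 * (μ : ℝ) ^ τ) +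
      ((Finset.univ.filter fun i : Fin n =>
        (∑ j, v j * Real.exp (X j ⬝ᵥ Y i)) /
          (∑ j, v j * Real.exp ((X j ⬝ᵥ X j + Y i ⬝ᵥ Y i) / 2)) < n * (μ : ℝ)).card : ℝ)))
    ⟨0, ?_⟩ ⟨μ, hμ⟩
  rintro _ ⟨ν, rfl⟩
  have : 0 < (ν : ℝ) ^ τ := Real.rpow_pos_of_pos ν.2 τ
  simp only
  positivity

/-- The cost changes by at most a constant factor if the weights and the precision do. -/
theorem kdeCost_le_mul {X Y : Matrix (Fin n) (Fin d) ℝ} {v w : Fin n → ℝ} {ε ε' τ a b s : ℝ}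
    (hn : 0 < n) (hε : 0 < ε) (hε' : 0 < ε') (hτ : 0 < τ) (hs : 1 ≤ s) (hss : ε ≤ s * ε')
    (ha : 0 < a) (hb : 0 < b) (hab : 1 ≤ a * b) (hv : ∀ j, 0 < v j)
    (h1 : ∀ j, w j ≤ a * v j) (h2 : ∀ j, v j ≤ b * w j) :
    kdeCost X Y w ε' τ ≤ s ^ 2 * (a * b) ^ τ * kdeCost X Y v ε τ := by
  classical
  have : Nonempty (Fin n) := ⟨⟨0, hn⟩⟩
  have habτ : 1 ≤ (a * b) ^ τ := Real.one_le_rpow hab hτ.le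
  have hL : 1 ≤ s ^ 2 * (a * b) ^ τ := by nlinarith
  rw [mul_comm, ← div_le_iff₀ (by linarith)]
  refine le_kdeCost fun μ hμ => ?_
  rw [div_le_iff₀ (by linarith)]
  -- The ratio for `v` is at most `a * b` times the ratio for `w`, so the light points for `w` at `μ
  -- / (a * b)` are light for `v` at `μ`. The shifted threshold costs `(a * b) ^ τ` in the power
  -- term, the precision `s ^ 2`.
  refine (kdeCost_le (μ := μ / (a * b)) (by positivity)).trans ?_
  have hw : ∀ j, 0 < w j := fun j => by
    by_contra! hc
    have := h2 j; have := hv j; nlinarith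
  rw [add_mul]
  have hμτ : 0 < μ ^ τ := Real.rpow_pos_of_pos hμ τ
  refine add_le_add ?_ ?_
  · rw [Real.div_rpow hμ.le (by positivity), one_div_mul_eq_div,
      div_le_div_iff₀ (by positivity) (by positivity)]
    have : ε ^ 2 ≤ s ^ 2 * ε' ^ 2 := by rw [← mul_pow]; exact pow_le_pow_left₀ hε.le hss 2
    have e : s ^ 2 * (a * b) ^ τ * (ε' ^ 2 * (μ ^ τ / (a * b) ^ τ)) = s ^ 2 * ε' ^ 2 * μ ^ τ := by
      have : (a * b) ^ τ ≠ 0 := by positivity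
      field_simp
    rw [e, one_mul]
    exact mul_le_mul_of_nonneg_right this hμτ.le
  · refine le_trans ?_ (le_mul_of_one_le_right (Nat.cast_nonneg _) hL)
    refine Nat.cast_le.2 (Finset.card_le_card fun i hi => ?_)
    rw [Finset.mem_filter] at hi ⊢
    refine ⟨hi.1, ?_⟩
    have p1 : 0 < ∑ j, v j * Real.exp ((X j ⬝ᵥ X j + Y i ⬝ᵥ Y i) / 2) :=
      Finset.sum_pos (fun j _ => mul_pos (hv j) (Real.exp_pos _)) Finset.univ_nonempty
    have p2 : 0 < ∑ j, w j * Real.exp ((X j ⬝ᵥ X j + Y i ⬝ᵥ Y i) / 2) :=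
      Finset.sum_pos (fun j _ => mul_pos (hw j) (Real.exp_pos _)) Finset.univ_nonempty
    have q1 : ∑ j, v j * Real.exp (X j ⬝ᵥ Y i) ≤ b * ∑ j, w j * Real.exp (X j ⬝ᵥ Y i) := by
      rw [Finset.mul_sum]
      refine Finset.sum_le_sum fun j _ => ?_
      rw [← mul_assoc]
      exact mul_le_mul_of_nonneg_right (h2 j) (Real.exp_pos _).le
    have q2 : ∑ j, w j * Real.exp ((X j ⬝ᵥ X j + Y i ⬝ᵥ Y i) / 2) ≤
        a * ∑ j, v j * Real.exp ((X j ⬝ᵥ X j + Y i ⬝ᵥ Y i) / 2) := by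
      rw [Finset.mul_sum]
      refine Finset.sum_le_sum fun j _ => ?_
      rw [← mul_assoc]
      exact mul_le_mul_of_nonneg_right (h1 j) (Real.exp_pos _).le
    have hi2 := hi.2
    rw [div_lt_iff₀ p2] at hi2
    rw [div_lt_iff₀ p1]
    have hnμ : 0 < n * (μ / (a * b)) := by
      have : (0 : ℝ) < n := Nat.cast_pos.2 hn
      positivity
    calc _ ≤ b * ∑ j, w j * Real.exp (X j ⬝ᵥ Y i) := q1
      _ < b * (n * (μ / (a * b)) * ∑ j, w j * Real.exp ((X j ⬝ᵥ X j + Y i ⬝ᵥ Y i) / 2)) :=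
        mul_lt_mul_of_pos_left hi2 hb
      _ ≤ b * (n * (μ / (a * b)) *
          (a * ∑ j, v j * Real.exp ((X j ⬝ᵥ X j + Y i ⬝ᵥ Y i) / 2))) := by
        gcongr
      _ = _ := by field_simp

end Cost

end KDEAttention
end

noncomputable section

namespace KDEAttention

open scoped ENNReal

/-! ### A program logic with failure probabilities -/

/-- A random run ends properly in a state satisfying `Q`, except with probability at most `δ`. -/
def GoodRun {α : Type} (p : PMF (Option α)) (Q : α → Prop) (δ : ℝ≥0∞) : Prop :=
  p.toOuterMeasure {o | ¬ ∃ s, o = some s ∧ Q s} ≤ δ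

theorem GoodRun.pure {α : Type} {s : α} {Q : α → Prop} {δ : ℝ≥0∞} (h : Q s) :
    GoodRun (PMF.pure (some s)) Q δ := by
  unfold GoodRun
  rw [PMF.toOuterMeasure_pure_apply, if_neg]
  · exact zero_le
  · simpa using h

theorem GoodRun.of_one_le {α : Type} {p : PMF (Option α)} {Q : α → Prop} {δ : ℝ≥0∞}
    (h : 1 ≤ δ) : GoodRun p Q δ := by
  refine le_trans ?_ h
  rw [PMF.toOuterMeasure_apply]
  refine le_trans (ENNReal.tsum_le_tsum fun x => ?_) p.tsum_coe.le
  exact Set.indicator_le_self _ _ x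

theorem GoodRun.mono {α : Type} {p : PMF (Option α)} {Q Q' : α → Prop} {δ δ' : ℝ≥0∞}
    (h : GoodRun p Q δ) (hQ : ∀ s, Q s → Q' s) (hδ : δ ≤ δ') : GoodRun p Q' δ' := by
  refine le_trans (le_trans (MeasureTheory.measure_mono ?_) h) hδ
  rintro o ho ⟨s, rfl, hs⟩
  exact ho ⟨s, rfl, hQ s hs⟩

/-- A union bound: on a bad first outcome the failure of the continuation is bounded by `1`, on a
good one by `δ'`. The bound for `g` is needed only at states satisfying `Q`, so later parts of a
program may depend on earlier random results. -/
theorem GoodRun.andThen {α : Type} {p : PMF (Option α)} {g : α → PMF (Option α)}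
    {Q Q' : α → Prop} {δ δ' : ℝ≥0∞} (h : GoodRun p Q δ)
    (hg : ∀ s, Q s → GoodRun (g s) Q' δ') : GoodRun (andThen p g) Q' (δ + δ') := by
  unfold GoodRun KDEAttention.andThen
  rw [PMF.toOuterMeasure_bind_apply]
  have hle : ∀ o : Option α, p o * (o.elim (PMF.pure none) g).toOuterMeasure
      {o | ¬ ∃ s, o = some s ∧ Q' s} ≤
        Set.indicator {o | ¬ ∃ s, o = some s ∧ Q s} p o + p o * δ' := by
    intro o
    by_cases ho : ∃ s, o = some s ∧ Q s
    · obtain ⟨s, rfl, hs⟩ := ho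
      exact le_add_left (mul_le_mul_right (hg s hs) _)
    · have hm : o ∈ {o | ¬ ∃ s, o = some s ∧ Q s} := ho
      rw [Set.indicator_of_mem hm]
      refine le_add_right ?_
      have : GoodRun (o.elim (PMF.pure none) g) Q' 1 := GoodRun.of_one_le le_rfl
      calc _ ≤ p o * 1 := mul_le_mul_right this _
        _ = p o := mul_one _
  refine (ENNReal.tsum_le_tsum hle).trans ?_
  rw [ENNReal.tsum_add, ENNReal.tsum_mul_right, p.tsum_coe, one_mul, ← PMF.toOuterMeasure_apply]
  exact add_le_add h le_rfl

theorem GoodRun.map {α β : Type} {p : PMF β} {f : β → α} {Q : α → Prop} {δ : ℝ≥0∞}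
    (h : p.toOuterMeasure {x | ¬ Q (f x)} ≤ δ) : GoodRun (p.map fun x => some (f x)) Q δ := by
  unfold GoodRun
  rw [PMF.toOuterMeasure_map_apply]
  refine le_trans (le_of_eq ?_) h
  congr 1
  ext x
  simp

section Rules

variable {𝒦 : KDEPrimitive} {F : ℕ}

/-- The failure-probability triple of a program. -/
def Good (𝒦 : KDEPrimitive) (F : ℕ) (c : Cmd) (s : State 𝒦.DS) (Q : State 𝒦.DS → Prop)
    (δ : ℝ≥0∞) : Prop := GoodRun (c.run 𝒦 F s) Q δ

theorem Good.mono {c : Cmd} {s : State 𝒦.DS} {Q Q' : State 𝒦.DS → Prop} {δ δ' : ℝ≥0∞}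
    (h : Good 𝒦 F c s Q δ) (hQ : ∀ s, Q s → Q' s) (hδ : δ ≤ δ' := by exact le_rfl) :
    Good 𝒦 F c s Q' δ' :=
  GoodRun.mono h hQ hδ

theorem Good.skip {s : State 𝒦.DS} {Q : State 𝒦.DS → Prop} {δ : ℝ≥0∞} (h : Q (s.tick 1)) :
    Good 𝒦 F .skip s Q δ := GoodRun.pure h

theorem Good.setN {a : ℕ} {i j e : NExpr} {s : State 𝒦.DS} {Q : State 𝒦.DS → Prop} {δ : ℝ≥0∞}
    (h : Q (({ s with nat := setCell s.nat a (i.eval s) (j.eval s) (e.eval s) }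
      : State 𝒦.DS).tick (i.size + j.size + e.size + 1))) :
    Good 𝒦 F (.setN a i j e) s Q δ := GoodRun.pure h

theorem Good.setR {a : ℕ} {i j : NExpr} {e : RExpr} {s : State 𝒦.DS} {Q : State 𝒦.DS → Prop}
    {δ : ℝ≥0∞}
    (h : Q (({ s with real := setCell s.real a (i.eval s) (j.eval s) (e.eval s) }
      : State 𝒦.DS).tick (i.size + j.size + e.size + 1))) :
    Good 𝒦 F (.setR a i j e) s Q δ := GoodRun.pure h

theorem Good.query {a : ℕ} {i j : NExpr} {r b : ℕ} {row cols : NExpr} {s : State 𝒦.DS}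
    {Q : State 𝒦.DS → Prop} {δ : ℝ≥0∞} {S : 𝒦.DS} (hS : s.ds r = some S)
    (h : Q (({ s with
        real := setCell s.real a (i.eval s) (j.eval s)
          (𝒦.query S fun l : Fin (cols.eval s) => s.real b (row.eval s) l).1 }
      : State 𝒦.DS).tick (i.size + j.size + row.size + cols.size + 1 +
        (𝒦.query S fun l : Fin (cols.eval s) => s.real b (row.eval s) l).2))) :
    Good 𝒦 F (.query a i j r b row cols) s Q δ := by
  unfold Good Cmd.run
  rw [hS]
  exact GoodRun.pure h

theorem Good.build {r b : ℕ} {rows cols : NExpr} {ε μ : RExpr} {s : State 𝒦.DS}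
    {Q : State 𝒦.DS → Prop} {δ : ℝ≥0∞}
    (h : (𝒦.build (Matrix.of fun (i : Fin (rows.eval s)) (j : Fin (cols.eval s)) => s.real b i j)
        (ε.eval s) (μ.eval s)).toOuterMeasure {x | ¬ Q (({ s with
          ds := Function.update s.ds r (some x.1) } : State 𝒦.DS).tick
            (rows.size + cols.size + ε.size + μ.size + 1 + x.2))} ≤ δ) :
    Good 𝒦 F (.build r b rows cols ε μ) s Q δ := GoodRun.map h

theorem Good.seq {c₁ c₂ : Cmd} {s : State 𝒦.DS} {Q Q' : State 𝒦.DS → Prop} {δ δ' : ℝ≥0∞}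
    (h₁ : Good 𝒦 F c₁ s Q δ) (h₂ : ∀ s', Q s' → Good 𝒦 F c₂ s' Q' δ') :
    Good 𝒦 F (.seq c₁ c₂) s Q' (δ + δ') := GoodRun.andThen h₁ h₂

theorem Good.seq_left {c₁ c₂ : Cmd} {s : State 𝒦.DS} {Q Q' : State 𝒦.DS → Prop} {δ : ℝ≥0∞}
    (h₁ : Good 𝒦 F c₁ s Q 0) (h₂ : ∀ s', Q s' → Good 𝒦 F c₂ s' Q' δ) :
    Good 𝒦 F (.seq c₁ c₂) s Q' δ := by
  have := h₁.seq h₂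
  rwa [zero_add] at this

theorem Good.seq_right {c₁ c₂ : Cmd} {s : State 𝒦.DS} {Q Q' : State 𝒦.DS → Prop} {δ : ℝ≥0∞}
    (h₁ : Good 𝒦 F c₁ s Q δ) (h₂ : ∀ s', Q s' → Good 𝒦 F c₂ s' Q' 0) :
    Good 𝒦 F (.seq c₁ c₂) s Q' δ := by
  have := h₁.seq h₂
  rwa [add_zero] at this

theorem Good.ite {b : BExpr} {c₁ c₂ : Cmd} {s : State 𝒦.DS} {Q : State 𝒦.DS → Prop} {δ : ℝ≥0∞}
    (h₁ : b.Holds s → Good 𝒦 F c₁ (s.tick (b.size + 1)) Q δ)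
    (h₂ : ¬ b.Holds s → Good 𝒦 F c₂ (s.tick (b.size + 1)) Q δ) :
    Good 𝒦 F (.ite b c₁ c₂) s Q δ := by
  unfold Good Cmd.run
  split_ifs with h
  · exact h₁ h
  · exact h₂ h

/-- Induction on the number `j` of iterations still allowed, each of which may fail with probability
`δ`. The loop may stop early, so the index `t'` at which it stops is part of the postcondition; one
more test than iterations is needed to leave it. -/
theorem GoodRun.runLoop {DS : Type} {b : BExpr} {body : State DS → PMF (Option (State DS))}
    {I : ℕ → State DS → Prop} {N : ℕ} {δ : ℝ≥0∞} (hexit : ∀ s, I N s → ¬ b.Holds s)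
    (hbody : ∀ t < N, ∀ s, I t s → b.Holds s → GoodRun (body (s.tick (b.size + 1))) (I (t + 1)) δ)
    (j : ℕ) : ∀ t k s, t + j = N → j + 1 ≤ k → I t s → GoodRun (runLoop b body k s)
      (fun s' => ∃ t' ≤ N, ∃ s₀, I t' s₀ ∧ ¬ b.Holds s₀ ∧ s' = s₀.tick (b.size + 1)) (j * δ) := by
  induction j with
  | zero =>
    intro t k s ht hk hI
    obtain ⟨k, rfl⟩ : ∃ k', k = k' + 1 := ⟨k - 1, by omega⟩
    obtain rfl : t = N := by omega
    rw [KDEAttention.runLoop, if_neg (hexit s hI)]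
    exact GoodRun.pure ⟨t, le_rfl, s, hI, hexit s hI, rfl⟩
  | succ j ih =>
    intro t k s ht hk hI
    obtain ⟨k, rfl⟩ : ∃ k', k = k' + 1 := ⟨k - 1, by omega⟩
    rw [KDEAttention.runLoop]
    split_ifs with hb
    · rw [Nat.cast_succ, add_mul, one_mul, add_comm ((j : ℝ≥0∞) * δ)]
      exact (hbody t (by omega) s hI hb).andThen fun s' hs' =>
        ih (t + 1) k s' (by omega) (by omega) hs'
    · exact GoodRun.pure ⟨t, by omega, s, hI, hb, rfl⟩

theorem Good.loop {b : BExpr} {c : Cmd} (I : ℕ → State 𝒦.DS → Prop) (N : ℕ) {δ : ℝ≥0∞}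
    {s : State 𝒦.DS} (hF : N + 1 ≤ F) (hI : I 0 s) (hexit : ∀ s, I N s → ¬ b.Holds s)
    (hbody : ∀ t < N, ∀ s, I t s → b.Holds s → Good 𝒦 F c (s.tick (b.size + 1)) (I (t + 1)) δ) :
    Good 𝒦 F (.loop b c) s
      (fun s' => ∃ t' ≤ N, ∃ s₀, I t' s₀ ∧ ¬ b.Holds s₀ ∧ s' = s₀.tick (b.size + 1)) (N * δ) :=
  GoodRun.runLoop hexit hbody N 0 F s (by omega) hF hI

/-- The arrays outside the given lists, and the data structures, are unchanged. -/
structure Frame {DS : Type} (ln lr : List ℕ) (s s' : State DS) : Prop where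
  nat : ∀ a, a ∉ ln → s'.nat a = s.nat a
  real : ∀ a, a ∉ lr → s'.real a = s.real a
  ds : s'.ds = s.ds

theorem Frame.refl {DS : Type} {ln lr : List ℕ} (s : State DS) : Frame ln lr s s :=
  ⟨fun _ _ => rfl, fun _ _ => rfl, rfl⟩

theorem Frame.trans {DS : Type} {ln lr : List ℕ} {s s' s'' : State DS} (h : Frame ln lr s s')
    (h' : Frame ln lr s' s'') : Frame ln lr s s'' :=
  ⟨fun a ha => (h'.nat a ha).trans (h.nat a ha), fun a ha => (h'.real a ha).trans (h.real a ha),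
    h'.ds.trans h.ds⟩

theorem Frame.mono {DS : Type} {ln lr ln' lr' : List ℕ} {s s' : State DS} (h : Frame ln lr s s')
    (hn : ln ⊆ ln' := by simp) (hr : lr ⊆ lr' := by simp) : Frame ln' lr' s s' :=
  ⟨fun a ha => h.nat a fun h' => ha (hn h'), fun a ha => h.real a fun h' => ha (hr h'), h.ds⟩

theorem setCell_of_ne {α : Type} (f : ℕ → ℕ → ℕ → α) {a a' : ℕ} (i j : ℕ) (x : α) (h : a' ≠ a) :
    setCell f a i j x a' = f a' := by
  funext i' j'
  simp [setCell, h]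

theorem setCell_self {α : Type} (f : ℕ → ℕ → ℕ → α) (a i j : ℕ) (x : α) :
    setCell f a i j x a i j = x := by
  simp [setCell]

theorem setCell_apply {α : Type} (f : ℕ → ℕ → ℕ → α) (a i j i' j' : ℕ) (x : α) :
    setCell f a i j x a i' j' = if i' = i ∧ j' = j then x else f a i' j' := by
  simp [setCell]

theorem Good.setR_frame {a : ℕ} {i j : NExpr} {e : RExpr} {s : State 𝒦.DS} {δ : ℝ≥0∞} :
    Good 𝒦 F (.setR a i j e) s (fun s' => Frame [] [a] s s' ∧
      (∀ i' j', s'.real a i' j' =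
        if i' = i.eval s ∧ j' = j.eval s then e.eval s else s.real a i' j') ∧
      s'.time = s.time + (i.size + j.size + e.size + 1)) δ :=
  Good.setR ⟨⟨fun _ _ => rfl, fun _ ha => setCell_of_ne _ _ _ _ (by simpa using ha), rfl⟩,
    fun _ _ => setCell_apply _ _ _ _ _ _ _, rfl⟩

theorem Good.setN_frame {a : ℕ} {i j e : NExpr} {s : State 𝒦.DS} {δ : ℝ≥0∞} :
    Good 𝒦 F (.setN a i j e) s (fun s' => Frame [a] [] s s' ∧
      (∀ i' j', s'.nat a i' j' =
        if i' = i.eval s ∧ j' = j.eval s then e.eval s else s.nat a i' j') ∧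
      s'.time = s.time + (i.size + j.size + e.size + 1)) δ :=
  Good.setN ⟨⟨fun _ ha => setCell_of_ne _ _ _ _ (by simpa using ha), fun _ _ => rfl, rfl⟩,
    fun _ _ => setCell_apply _ _ _ _ _ _ _, rfl⟩

/-- The loop `for a = 0, …, bound - 1`. -/
def forLoop (a : ℕ) (bound : NExpr) (body : Cmd) : Cmd :=
  .seq (.setN a (.const 0) (.const 0) (.const 0))
    (.loop (.natLe (.add (.cell a (.const 0) (.const 0)) (.const 1)) bound)
      (.seq body (.setN a (.const 0) (.const 0) (.add (.cell a (.const 0) (.const 0)) (.const 1)))))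

/-- The rule for counting loops, for an invariant that ignores the counter and the time. -/
theorem Good.forLoop {a : ℕ} {bound : NExpr} {body : Cmd} {s₀ : State 𝒦.DS} {ln lr : List ℕ}
    (J : ℕ → State 𝒦.DS → Prop) (N : ℕ) (B : ℕ → ℝ) {δ : ℝ≥0∞}
    (hJ : ∀ k (s s' : State 𝒦.DS), (∀ a' ≠ a, s'.nat a' = s.nat a') → s'.real = s.real →
      J k s → J k s')
    (hN : ∀ s, Frame (a :: ln) lr s₀ s → bound.eval s = N) (ha : a ∉ ln)
    (hF : N + 1 ≤ F) (h0 : J 0 s₀)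
    (hbody : ∀ k < N, ∀ s, Frame (a :: ln) lr s₀ s → s.nat a 0 0 = k → J k s →
      Good 𝒦 F body s (fun s' => Frame ln lr s s' ∧ J (k + 1) s' ∧
        (s'.time : ℝ) ≤ s.time + B k) δ) :
    Good 𝒦 F (KDEAttention.forLoop a bound body) s₀ (fun s' => Frame (a :: ln) lr s₀ s' ∧ J N s' ∧
      (s'.time : ℝ) ≤ s₀.time + ∑ k ∈ Finset.range N, B k + (N + 1) * (bound.size + 20))
      (N * δ) := by
  set K : ℝ := bound.size + 20 with hK
  -- The counter and the clock are tracked here so that `J` need not mention them. The `4` pays for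
  -- initializing the counter, and `K` covers one test and one increment.
  set I : ℕ → State 𝒦.DS → Prop := fun k s => Frame (a :: ln) lr s₀ s ∧ s.nat a 0 0 = k ∧ J k s ∧
    (s.time : ℝ) ≤ s₀.time + ∑ i ∈ Finset.range k, B i + (k * K + 4) with hI
  have hholds : ∀ k s, I k s → ((BExpr.natLe (.add (.cell a (.const 0) (.const 0)) (.const 1))
      bound).Holds s ↔ k < N) := by
    intro k s h
    simp only [BExpr.Holds, NExpr.eval, h.2.1, hN s h.1]
    omega
  refine Good.seq_left (Q := I 0) (Good.setN ?_) fun s₁ hs₁ => ?_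
  · refine ⟨⟨fun a' ha' => ?_, fun _ _ => rfl, rfl⟩, ?_, ?_, ?_⟩
    · simp only [State.tick]
      exact setCell_of_ne _ _ _ _ (by simp at ha'; exact ha'.1)
    · simp [State.tick, NExpr.eval, setCell]
    · refine hJ 0 s₀ _ (fun a' ha' => ?_) rfl h0
      simp only [State.tick]
      exact setCell_of_ne _ _ _ _ ha'
    · simp [State.tick, NExpr.size]
  · refine (Good.loop I N hF hs₁ (fun s h => ?_) fun t ht s hIt hb => ?_).mono
      (fun s' h => ?_) le_rfl
    · rw [hholds N s h]; exact lt_irrefl N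
    · refine Good.seq_right (hbody t ht _ ⟨hIt.1.nat, hIt.1.real, hIt.1.ds⟩ hIt.2.1
        (hJ t s _ (fun _ _ => rfl) rfl hIt.2.2.1)) fun s' hs' => Good.setN ?_
      obtain ⟨hfr, hJ', htime⟩ := hs'
      have hctr : s'.nat a 0 0 = t := by
        rw [hfr.nat a ha]; exact hIt.2.1
      refine ⟨⟨fun a' ha' => ?_, fun a' ha' => ?_, ?_⟩, ?_, ?_, ?_⟩
      · simp only [State.tick]
        have ha2 : a' ≠ a ∧ a' ∉ ln := by simpa using ha'
        rw [setCell_of_ne _ _ _ _ ha2.1, hfr.nat a' ha2.2]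
        exact hIt.1.nat a' ha'
      · exact (hfr.real a' ha').trans (hIt.1.real a' ha')
      · exact hfr.ds.trans hIt.1.ds
      · simp [State.tick, NExpr.eval, setCell, hctr]
      · refine hJ (t + 1) s' _ (fun a' ha' => ?_) rfl hJ'
        simp only [State.tick]
        exact setCell_of_ne _ _ _ _ ha'
      · have h4 := hIt.2.2.2
        rw [Finset.sum_range_succ]
        simp only [State.tick, NExpr.size, BExpr.size] at htime ⊢
        push_cast at htime ⊢
        rw [hK] at h4 ⊢
        nlinarith
    · obtain ⟨t, htN, s, hIt, hb, rfl⟩ := h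
      rw [hholds t s hIt] at hb
      obtain rfl : t = N := by omega
      refine ⟨⟨hIt.1.nat, hIt.1.real, hIt.1.ds⟩, hJ t s _ (fun _ _ => rfl) rfl hIt.2.2.1, ?_⟩
      have h4 := hIt.2.2.2
      simp only [State.tick, NExpr.size, BExpr.size]
      push_cast
      rw [hK] at h4 ⊢
      nlinarith

/-- The rule for deterministic counting loops with an invariant about the real arrays. -/
theorem Good.forLoop_real {a : ℕ} {bound : NExpr} {body : Cmd} {s₀ : State 𝒦.DS} {ln lr : List ℕ}
    (J : ℕ → (ℕ → ℕ → ℕ → ℝ) → Prop) (N : ℕ) (B : ℕ → ℝ)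
    (hN : ∀ s, Frame (a :: ln) lr s₀ s → bound.eval s = N) (ha : a ∉ ln)
    (hF : N + 1 ≤ F) (h0 : J 0 s₀.real)
    (hbody : ∀ k < N, ∀ s, Frame (a :: ln) lr s₀ s → s.nat a 0 0 = k → J k s.real →
      Good 𝒦 F body s (fun s' => Frame ln lr s s' ∧ J (k + 1) s'.real ∧
        (s'.time : ℝ) ≤ s.time + B k) 0) :
    Good 𝒦 F (KDEAttention.forLoop a bound body) s₀ (fun s' => Frame (a :: ln) lr s₀ s' ∧
      J N s'.real ∧
      (s'.time : ℝ) ≤ s₀.time + ∑ k ∈ Finset.range N, B k + (N + 1) * (bound.size + 20)) 0 := by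
  have h := Good.forLoop (𝒦 := 𝒦) (F := F) (fun k s => J k s.real) N B (δ := 0)
    (fun k s s' _ hr hj => by rw [hr]; exact hj) hN ha hF h0 hbody
  rwa [mul_zero] at h

/-- The program `acc := ∑_{ctr < bound} e`. -/
def sumLoop (ctr acc : ℕ) (bound : NExpr) (e : RExpr) : Cmd :=
  .seq (.setR acc (.const 0) (.const 0) (.const 0))
    (forLoop ctr bound (.setR acc (.const 0) (.const 0)
      (.add (.cell acc (.const 0) (.const 0)) e)))

theorem Good.sumLoop {ctr acc : ℕ} {bound : NExpr} {e : RExpr} {s₀ : State 𝒦.DS} (N : ℕ)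
    (f : ℕ → ℝ) (hN : ∀ s, Frame [ctr] [acc] s₀ s → bound.eval s = N) (hF : N + 1 ≤ F)
    (he : ∀ k < N, ∀ s, Frame [ctr] [acc] s₀ s → s.nat ctr 0 0 = k → e.eval s = f k) :
    Good 𝒦 F (KDEAttention.sumLoop ctr acc bound e) s₀ (fun s' => Frame [ctr] [acc] s₀ s' ∧
      s'.real acc 0 0 = ∑ k ∈ Finset.range N, f k ∧
      (s'.time : ℝ) ≤ s₀.time + (N + 1) * (bound.size + e.size + 40)) 0 := by
  refine Good.seq_left (Q := fun s => Frame [] [acc] s₀ s ∧ s.real acc 0 0 = 0 ∧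
    s.time = s₀.time + 4) (Good.setR ?_) fun s₁ hs₁ => ?_
  · refine ⟨⟨fun _ _ => rfl, fun a' ha' => ?_, rfl⟩, ?_, ?_⟩
    · simp only [State.tick]
      exact setCell_of_ne _ _ _ _ (by simpa using ha')
    · simp [State.tick, NExpr.eval, RExpr.eval, setCell]
    · simp [State.tick, NExpr.size, RExpr.size]
  · obtain ⟨hf1, h0, ht1⟩ := hs₁
    refine (Good.forLoop_real (ln := []) (lr := [acc])
      (fun k R => R acc 0 0 = ∑ i ∈ Finset.range k, f i) N (fun _ => e.size + 10)
      (fun s hs => hN s (hf1.mono.trans hs)) (by simp) hF (by simpa using h0)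
      fun k hk s hs hc hJ => Good.setR ?_).mono (fun s' h => ?_)
    · refine ⟨⟨fun _ _ => rfl, fun a' ha' => ?_, rfl⟩, ?_, ?_⟩
      · simp only [State.tick]
        exact setCell_of_ne _ _ _ _ (by simpa using ha')
      · simp only [State.tick, NExpr.eval, RExpr.eval, setCell_self, Finset.sum_range_succ, hJ]
        rw [he k hk s (hf1.mono.trans hs) hc]
      · simp only [State.tick, NExpr.size, RExpr.size]
        push_cast
        linarith
    · refine ⟨hf1.mono.trans h.1, h.2.1, ?_⟩
      have h3 := h.2.2
      rw [ht1] at h3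
      simp only [Finset.sum_const, Finset.card_range, nsmul_eq_mul] at h3
      push_cast at h3
      have : (0 : ℝ) ≤ e.size := Nat.cast_nonneg _
      nlinarith

/-- The program `arr[ctr, j] := e` for all `ctr < bound`. -/
def fillLoop (ctr arr : ℕ) (j bound : NExpr) (e : RExpr) : Cmd :=
  forLoop ctr bound (.setR arr (.cell ctr (.const 0) (.const 0)) j e)

/-- At step `k` only the first `k` cells of column `jv` have changed, and `e` may rely on all the
others, including those of the array being written. The postcondition keeps these other cells: the
extra coordinate is later appended to the data points in place. -/
theorem Good.fillLoop {ctr arr : ℕ} {j bound : NExpr} {e : RExpr} {s₀ : State 𝒦.DS} (N jv : ℕ)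
    (f : ℕ → ℝ) (hN : ∀ s, Frame [ctr] [arr] s₀ s → bound.eval s = N)
    (hj : ∀ s, Frame [ctr] [arr] s₀ s → j.eval s = jv) (hF : N + 1 ≤ F)
    (he : ∀ k < N, ∀ s, Frame [ctr] [arr] s₀ s →
      (∀ i i', (i' ≠ jv ∨ k ≤ i) → s.real arr i i' = s₀.real arr i i') →
      s.nat ctr 0 0 = k → e.eval s = f k) :
    Good 𝒦 F (KDEAttention.fillLoop ctr arr j bound e) s₀ (fun s' => Frame [ctr] [arr] s₀ s' ∧
      ((∀ i < N, s'.real arr i jv = f i) ∧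
        ∀ i i', (i' ≠ jv ∨ N ≤ i) → s'.real arr i i' = s₀.real arr i i') ∧
      (s'.time : ℝ) ≤ s₀.time + (N + 1) * (bound.size + e.size + j.size + 40)) 0 := by
  refine (Good.forLoop_real (ln := []) (lr := [arr])
      (fun k R => (∀ i < k, R arr i jv = f i) ∧
        ∀ i i', (i' ≠ jv ∨ k ≤ i) → R arr i i' = s₀.real arr i i') N
      (fun _ => e.size + j.size + 10)
      hN (by simp) hF (by simp)
      fun k hk s hs hc hJ => Good.setR ?_).mono (fun s' h => ?_)
  · refine ⟨⟨fun _ _ => rfl, fun a' ha' => ?_, rfl⟩, ⟨fun i hi => ?_, fun i i' hi => ?_⟩, ?_⟩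
    · simp only [State.tick]
      exact setCell_of_ne _ _ _ _ (by simpa using ha')
    · simp only [State.tick, NExpr.eval, hc, hj s hs, setCell_apply, he k hk s hs hJ.2 hc]
      by_cases hik : i = k
      · simp [hik]
      · simp [hik, hJ.1 i (by omega)]
    · simp only [State.tick, NExpr.eval, hc, hj s hs, setCell_apply]
      rw [if_neg (by omega)]
      exact hJ.2 i i' (by omega)
    · simp only [State.tick, NExpr.size]
      push_cast
      linarith
  · refine ⟨h.1, h.2.1, ?_⟩
    have h3 := h.2.2
    simp only [Finset.sum_const, Finset.card_range, nsmul_eq_mul] at h3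
    have : (0 : ℝ) ≤ e.size := Nat.cast_nonneg _
    have : (0 : ℝ) ≤ j.size := Nat.cast_nonneg _
    nlinarith

/-- The program `arr[c₁, c₂] := e` for all `c₁ < b₁` and `c₂ < b₂`. -/
def fillMatrix (c₁ c₂ arr : ℕ) (b₁ b₂ : NExpr) (e : RExpr) : Cmd :=
  forLoop c₁ b₁ (forLoop c₂ b₂ (.setR arr (.cell c₁ (.const 0) (.const 0))
    (.cell c₂ (.const 0) (.const 0)) e))

theorem Good.fillMatrix {c₁ c₂ arr : ℕ} {b₁ b₂ : NExpr} {e : RExpr} {s₀ : State 𝒦.DS} (N M : ℕ)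
    (hc : c₁ ≠ c₂) (f : ℕ → ℕ → ℝ) (hN : ∀ s, Frame [c₁, c₂] [arr] s₀ s → b₁.eval s = N)
    (hM : ∀ s, Frame [c₁, c₂] [arr] s₀ s → b₂.eval s = M) (hFN : N + 1 ≤ F) (hFM : M + 1 ≤ F)
    (he : ∀ k < N, ∀ k' < M, ∀ s, Frame [c₁, c₂] [arr] s₀ s →
      s.nat c₁ 0 0 = k → s.nat c₂ 0 0 = k' → e.eval s = f k k') :
    Good 𝒦 F (KDEAttention.fillMatrix c₁ c₂ arr b₁ b₂ e) s₀
      (fun s' => Frame [c₁, c₂] [arr] s₀ s' ∧ (∀ i < N, ∀ j < M, s'.real arr i j = f i j) ∧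
      (s'.time : ℝ) ≤ s₀.time + (N + 1) * ((M + 1) * (b₁.size + b₂.size + e.size + 60))) 0 := by
  refine (Good.forLoop_real (ln := [c₂]) (lr := [arr])
      (fun k R => ∀ i < k, ∀ j < M, R arr i j = f i j) N
      (fun _ => (M + 1) * (b₂.size + e.size + 40))
      hN (by simpa using hc) hFN (by simp)
      fun k hk s hs hc1 hJ => ?_).mono (fun s' h => ?_)
  · refine (Good.forLoop_real (ln := []) (lr := [arr])
      (fun k' R => (∀ i < k, ∀ j < M, R arr i j = f i j) ∧ ∀ j < k', R arr k j = f k j) M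
      (fun _ => e.size + 10)
      (fun s' hs' => hM s' (hs.trans hs'.mono)) (by simp) hFM (by simpa using hJ)
      fun k' hk' s' hs' hc2 hJ' => Good.setR ?_).mono (fun s' h => ?_)
    · have hc1' : s'.nat c₁ 0 0 = k := by rw [hs'.nat c₁ (by simpa using hc)]; exact hc1
      refine ⟨⟨fun _ _ => rfl, fun a' ha' => ?_, rfl⟩, ⟨fun i hi j hj => ?_, fun j hj => ?_⟩, ?_⟩
      · simp only [State.tick]
        exact setCell_of_ne _ _ _ _ (by simpa using ha')
      · simp only [State.tick, NExpr.eval, hc1', hc2, setCell_apply]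
        rw [if_neg (by omega)]
        exact hJ'.1 i hi j hj
      · simp only [State.tick, NExpr.eval, hc1', hc2, setCell_apply,
          he k hk k' hk' s' (hs.trans hs'.mono) hc1' hc2]
        by_cases hjk : j = k'
        · simp [hjk]
        · simp [hjk, hJ'.2 j (by omega)]
      · simp only [State.tick, NExpr.size]
        push_cast
        linarith
    · refine ⟨h.1, fun i hi j hj => ?_, ?_⟩
      · rcases Nat.lt_succ_iff_lt_or_eq.1 hi with hi | rfl
        · exact h.2.1.1 i hi j hj
        · exact h.2.1.2 j hj
      · have h3 := h.2.2
        simp only [Finset.sum_const, Finset.card_range, nsmul_eq_mul] at h3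
        have : (0 : ℝ) ≤ e.size := Nat.cast_nonneg _
        nlinarith
  · refine ⟨h.1, h.2.1, ?_⟩
    have h3 := h.2.2
    simp only [Finset.sum_const, Finset.card_range, nsmul_eq_mul] at h3
    have h1 : (0 : ℝ) ≤ e.size := Nat.cast_nonneg _
    have h2 : (0 : ℝ) ≤ b₁.size := Nat.cast_nonneg _
    have h4 : (0 : ℝ) ≤ b₂.size := Nat.cast_nonneg _
    have h5 : (0 : ℝ) ≤ N := Nat.cast_nonneg _
    have h6 : (0 : ℝ) ≤ M := Nat.cast_nonneg _
    have h7 : (0 : ℝ) ≤ (M + 1) * (b₂.size + e.size + 40) := by positivity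
    have h8 : (0 : ℝ) ≤ M * (b₁.size + 20) := by positivity
    nlinarith [mul_nonneg h5 h8]

/-- The program `arr[c₁, 0] := e'` for all `c₁ < b₁`, where `e'` may use the value
`∑_{c₂ < b₂} e` in the cell `acc`. -/
def rowSums (c₁ c₂ acc arr : ℕ) (b₁ b₂ : NExpr) (e e' : RExpr) : Cmd :=
  forLoop c₁ b₁ (.seq (sumLoop c₂ acc b₂ e)
    (.setR arr (.cell c₁ (.const 0) (.const 0)) (.const 0) e'))

theorem Good.rowSums {c₁ c₂ acc arr : ℕ} {b₁ b₂ : NExpr} {e e' : RExpr} {s₀ : State 𝒦.DS}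
    (N M : ℕ) (hc : c₁ ≠ c₂) (f : ℕ → ℕ → ℝ) (g : ℕ → ℝ → ℝ) (harr : arr ≠ acc)
    (hN : ∀ s, Frame [c₁, c₂] [acc, arr] s₀ s → b₁.eval s = N)
    (hM : ∀ s, Frame [c₁, c₂] [acc, arr] s₀ s → b₂.eval s = M)
    (hFN : N + 1 ≤ F) (hFM : M + 1 ≤ F)
    (he : ∀ k < N, ∀ k' < M, ∀ s, Frame [c₁, c₂] [acc, arr] s₀ s →
      s.nat c₁ 0 0 = k → s.nat c₂ 0 0 = k' → e.eval s = f k k')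
    (he' : ∀ k < N, ∀ s, Frame [c₁, c₂] [acc, arr] s₀ s →
      s.nat c₁ 0 0 = k → e'.eval s = g k (s.real acc 0 0)) :
    Good 𝒦 F (KDEAttention.rowSums c₁ c₂ acc arr b₁ b₂ e e') s₀
      (fun s' => Frame [c₁, c₂] [acc, arr] s₀ s' ∧
        (∀ i < N, s'.real arr i 0 = g i (∑ k ∈ Finset.range M, f i k)) ∧
      (s'.time : ℝ) ≤ s₀.time +
        (N + 1) * ((M + 1) * (b₁.size + b₂.size + e.size + e'.size + 80))) 0 := by
  refine (Good.forLoop_real (ln := [c₂]) (lr := [acc, arr])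
      (fun k R => ∀ i < k, R arr i 0 = g i (∑ k ∈ Finset.range M, f i k)) N
      (fun _ => (M + 1) * (b₂.size + e.size + 40) + (e'.size + 10))
      hN (by simpa using hc) hFN (by simp)
      fun k hk s hs hc1 hJ => ?_).mono (fun s' h => ?_)
  · refine Good.seq_left (Good.sumLoop M (f k) (fun s' hs' => hM s' (hs.trans hs'.mono)) hFM
      fun k' hk' s' hs' hc2 => he k hk k' hk' s' (hs.trans hs'.mono)
        (by rw [hs'.nat c₁ (by simpa using hc)]; exact hc1) hc2) fun s' ⟨hs', hv, ht⟩ =>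
          Good.setR ?_
    have hc1' : s'.nat c₁ 0 0 = k := by rw [hs'.nat c₁ (by simpa using hc)]; exact hc1
    refine ⟨⟨fun a' ha' => hs'.nat a' ha', fun a' ha' => ?_, hs'.ds⟩, fun i hi => ?_, ?_⟩
    · simp only [State.tick]
      have ha2 : a' ≠ acc ∧ a' ≠ arr := by simpa using ha'
      rw [setCell_of_ne _ _ _ _ ha2.2]
      exact hs'.real a' (by simpa using ha2.1)
    · simp only [State.tick, NExpr.eval, hc1', setCell_apply,
        he' k hk s' (hs.trans hs'.mono) hc1', hv]
      by_cases hik : i = k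
      · simp [hik]
      · simp only [hik, false_and, if_false]
        rw [hs'.real arr (by simpa using harr)]
        exact hJ i (by omega)
    · simp only [State.tick, NExpr.size]
      push_cast
      linarith
  · refine ⟨h.1, h.2.1, ?_⟩
    have h3 := h.2.2
    simp only [Finset.sum_const, Finset.card_range, nsmul_eq_mul] at h3
    have h1 : (0 : ℝ) ≤ e.size := Nat.cast_nonneg _
    have h1' : (0 : ℝ) ≤ e'.size := Nat.cast_nonneg _
    have h2 : (0 : ℝ) ≤ b₁.size := Nat.cast_nonneg _
    have h4 : (0 : ℝ) ≤ b₂.size := Nat.cast_nonneg _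
    have h5 : (0 : ℝ) ≤ N := Nat.cast_nonneg _
    have h6 : (0 : ℝ) ≤ M := Nat.cast_nonneg _
    have h7 : (0 : ℝ) ≤ (M + 1) * (b₂.size + e.size + 40) + (e'.size + 10) := by positivity
    have h8 : (0 : ℝ) ≤ M * (b₁.size + e'.size + 40) := by positivity
    nlinarith [mul_nonneg h5 h8]

end Rules

end KDEAttention
end

noncomputable section

namespace KDEAttention

open scoped ENNReal

/-! ### Exponential sums and Gaussian densities -/

section ExpSum

/-- `∑_{j < n} exp (⟨x_j, q⟩ + w_j)`. -/
def expSum (n d : ℕ) (x : ℕ → ℕ → ℝ) (w : ℕ → ℝ) (q : ℕ → ℝ) : ℝ :=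
  ∑ j ∈ Finset.range n, Real.exp (∑ l ∈ Finset.range d, x j l * q l + w j)

/-- `‖q‖²` for the first `d` coordinates. -/
def normSq (d : ℕ) (q : ℕ → ℝ) : ℝ := ∑ l ∈ Finset.range d, q l * q l

/-- `∑_{j < n} exp (‖x_j‖² / 2 + w_j)`. -/
def expMass (n d : ℕ) (x : ℕ → ℕ → ℝ) (w : ℕ → ℝ) : ℝ :=
  ∑ j ∈ Finset.range n, Real.exp ((normSq d (x j) + 2 * w j) / 2)

/-- The relative size of an exponential sum. -/
def expRatio (n d : ℕ) (x : ℕ → ℕ → ℝ) (w : ℕ → ℝ) (q : ℕ → ℝ) : ℝ :=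
  expSum n d x w q / (expMass n d x w * Real.exp (normSq d q / 2))

variable {n d : ℕ} {x : ℕ → ℕ → ℝ} {w : ℕ → ℝ} {q : ℕ → ℝ}

theorem expMass_pos (hn : 0 < n) : 0 < expMass n d x w :=
  Finset.sum_pos (fun _ _ => Real.exp_pos _) ⟨0, Finset.mem_range.2 hn⟩

theorem expSum_pos (hn : 0 < n) : 0 < expSum n d x w q :=
  Finset.sum_pos (fun _ _ => Real.exp_pos _) ⟨0, Finset.mem_range.2 hn⟩

theorem expRatio_pos (hn : 0 < n) : 0 < expRatio n d x w q :=
  div_pos (expSum_pos hn) (mul_pos (expMass_pos hn) (Real.exp_pos _))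

theorem expRatio_mul (hn : 0 < n) : expRatio n d x w q *
    (expMass n d x w * Real.exp (normSq d q / 2)) = expSum n d x w q :=
  div_mul_cancel₀ _ (mul_pos (expMass_pos hn) (Real.exp_pos _)).ne'

/-- Termwise `⟨x, q⟩ ≤ (‖x‖² + ‖q‖²)/2`. -/
theorem expRatio_le_one (hn : 0 < n) : expRatio n d x w q ≤ 1 := by
  unfold expRatio
  rw [div_le_one (mul_pos (expMass_pos hn) (Real.exp_pos _)), expSum, expMass, Finset.sum_mul]
  refine Finset.sum_le_sum fun j _ => ?_
  rw [← Real.exp_add]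
  refine Real.exp_le_exp.2 ?_
  have : ∑ l ∈ Finset.range d, x j l * q l ≤ normSq d (x j) / 2 + normSq d q / 2 := by
    unfold normSq
    rw [Finset.sum_div, Finset.sum_div, ← Finset.sum_add_distrib]
    exact Finset.sum_le_sum fun l _ => by nlinarith [sq_nonneg (x j l - q l)]
  linarith

/-- Each summand is at most the total mass. This makes the radicand of the additional coordinate
nonnegative. -/
theorem le_two_log_expMass {j : ℕ} (hj : j < n) :
    normSq d (x j) + 2 * w j ≤ 2 * Real.log (expMass n d x w) := by
  have h : Real.exp ((normSq d (x j) + 2 * w j) / 2) ≤ expMass n d x w :=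
    Finset.single_le_sum (f := fun j => Real.exp ((normSq d (x j) + 2 * w j) / 2))
      (fun _ _ => (Real.exp_pos _).le) (Finset.mem_range.2 hj)
  have := (Real.le_log_iff_exp_le (expMass_pos (by omega))).2 h
  linarith

/-- With one additional coordinate, the weighted exponential sum is a Gaussian density. -/
theorem gaussDensity_lift (hn : 0 < n) {N D : ℕ} (hN : N = n) (hD : D = d + 1)
    {x' : ℕ → ℕ → ℝ} {q' : ℕ → ℝ} (hx : ∀ i < n, ∀ l < d, x' i l = x i l)
    (hxd : ∀ i < n, x' i d =
      Real.sqrt (2 * Real.log (expMass n d x w) - (normSq d (x i) + 2 * w i)))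
    (hq : ∀ l < d, q' l = q l) (hqd : q' d = 0) :
    gaussDensity (Matrix.of fun (i : Fin N) (j : Fin D) => x' i j) (fun l : Fin D => q' l) =
      expRatio n d x w q / n := by
  subst hN hD
  unfold gaussDensity expRatio expSum
  rw [Finset.sum_range, div_div, mul_comm _ (N : ℝ), ← div_div, Finset.sum_div, Finset.sum_div,
    Finset.mul_sum]
  refine Finset.sum_congr rfl fun i _ => ?_
  have hZ := expMass_pos (d := d) (x := x) (w := w) hn
  -- The square of the additional coordinate cancels `‖xᵢ‖²` and puts the constant `2 log (mass) -
  -- 2wᵢ` in its place, so the Gaussian kernel is the desired exponential up to a factor that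
  -- depends on the query alone.
  have hdot : ((fun l : Fin (d + 1) => q' l) - (Matrix.of fun (i : Fin N) (j : Fin (d + 1)) =>
      x' i j) i) ⬝ᵥ ((fun l : Fin (d + 1) => q' l) - (Matrix.of fun (i : Fin N) (j : Fin (d + 1)) =>
      x' i j) i) = normSq d q + 2 * Real.log (expMass N d x w) - 2 * w i -
        2 * ∑ l ∈ Finset.range d, x i l * q l := by
    rw [dotProduct]
    simp only [Pi.sub_apply, Matrix.of_apply]
    rw [Fin.sum_univ_eq_sum_range (fun l => (q' l - x' i l) * (q' l - x' i l)) (d + 1),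
      Finset.sum_range_succ, hqd, hxd i i.2]
    have h1 : ∑ l ∈ Finset.range d, (q' l - x' i l) * (q' l - x' i l) =
        normSq d q + normSq d (x i) - 2 * ∑ l ∈ Finset.range d, x i l * q l := by
      unfold normSq
      rw [Finset.mul_sum, ← Finset.sum_add_distrib, ← Finset.sum_sub_distrib]
      refine Finset.sum_congr rfl fun l hl => ?_
      rw [hq l (Finset.mem_range.1 hl), hx i i.2 l (Finset.mem_range.1 hl)]
      ring
    have h2 := Real.mul_self_sqrt (sub_nonneg.2 (le_two_log_expMass (d := d) (x := x) (w := w) i.2))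
    rw [h1]
    nlinarith
  rw [hdot]
  have h3 : Real.exp (-(normSq d q + 2 * Real.log (expMass N d x w) - 2 * w i -
        2 * ∑ l ∈ Finset.range d, x i l * q l) / 2) =
      Real.exp (∑ l ∈ Finset.range d, x i l * q l + w i) /
        (expMass N d x w * Real.exp (normSq d q / 2)) := by
    conv_rhs => rw [← Real.exp_log hZ, ← Real.exp_add, ← Real.exp_sub]
    congr 1
    ring
  rw [h3]
  ring

end ExpSum

/-! ### The weighted density estimation procedure -/

/-- The natural cell `a[0,0]`. -/
def nVar (a : ℕ) : NExpr := .cell a (.const 0) (.const 0)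

/-- The real cell `a[0,0]`. -/
def rVar (a : ℕ) : RExpr := .cell a (.const 0) (.const 0)

/-- The number of rows of the inputs. -/
def rowsE : NExpr := .cell 0 (.const 0) (.const 0)

/-- The number of columns of the inputs. -/
def colsE : NExpr := .cell 0 (.const 0) (.const 1)

/-- Norms of the points, the additional coordinate, and the initial values of the estimates.
Real arrays: `6` data points, `7` query points, `8` norms and weights of the data points, `9` norms
of the query points, `10` density estimates, `12` total mass, `13` reciprocal threshold, `15`
number of missing estimates, `20` logarithms of the weights. -/
def kdePrep : Cmd :=
  .seq (rowSums 10 11 11 8 rowsE colsE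
    (.mul (.cell 6 (nVar 10) (nVar 11)) (.cell 6 (nVar 10) (nVar 11)))
    (.add (rVar 11) (.mul (.const 2) (.cell 20 (nVar 10) (.const 0)))))
  (.seq (rowSums 10 11 11 9 rowsE colsE
    (.mul (.cell 7 (nVar 10) (nVar 11)) (.cell 7 (nVar 10) (nVar 11))) (rVar 11))
  (.seq (sumLoop 10 12 rowsE (.exp (.div (.cell 8 (nVar 10) (.const 0)) (.const 2))))
  (.seq (fillLoop 10 6 colsE rowsE
    (.sqrt (.sub (.mul (.const 2) (.log (rVar 12))) (.cell 8 (nVar 10) (.const 0)))))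
  (.seq (fillLoop 10 7 colsE rowsE (.const 0))
  (.seq (fillLoop 10 10 (.const 0) rowsE (.const 0))
  (.seq (.setR 13 (.const 0) (.const 0) (.const 1))
    (.setR 15 (.const 0) (.const 0) (.ofNat rowsE))))))))

/-- One round: halve the cost threshold, build the data structure, query all points. -/
def kdeRound : Cmd :=
  .seq (.setR 13 (.const 0) (.const 0) (.mul (.const 2) (rVar 13)))
  (.seq (.build 0 6 rowsE (.add colsE (.const 1)) (rVar 21)
    (.exp (.div (.sub (.const 0) (.log (rVar 13))) (.cell 3 (.const 0) (.const 1)))))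
  (.seq (.setR 15 (.const 0) (.const 0) (.const 0))
    (forLoop 10 rowsE (.seq (.query 10 (nVar 10) (.const 0) 0 7 (nVar 10) (.add colsE (.const 1)))
      (.ite (.realLe (.cell 10 (nVar 10) (.const 0)) (.const 0))
        (.setR 15 (.const 0) (.const 0) (.add (rVar 15) (.const 1))) .skip)))))

/-- Rounds until the missing values are cheap to compute directly. -/
def kdeRounds : Cmd :=
  .loop (.not (.realLe (.mul (rVar 15) (.mul (rVar 21) (rVar 21))) (rVar 13))) kdeRound

/-- Direct computation of one exponential sum into the cell `14[0,0]`. -/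
def kdeExact : Cmd :=
  .seq (.setR 14 (.const 0) (.const 0) (.const 0))
    (forLoop 11 rowsE (.seq (sumLoop 12 11 colsE
        (.mul (.cell 6 (nVar 11) (nVar 12)) (.cell 7 (nVar 10) (nVar 12))))
      (.setR 14 (.const 0) (.const 0) (.add (rVar 14)
        (.exp (.add (rVar 11) (.cell 20 (nVar 11) (.const 0))))))))

/-- Conversion of the estimates, with the missing ones computed directly, into array `22`. -/
def kdeFinish : Cmd :=
  forLoop 10 rowsE (.ite (.realLe (.cell 10 (nVar 10) (.const 0)) (.const 0))
    (.seq kdeExact (.setR 22 (nVar 10) (.const 0) (rVar 14)))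
    (.setR 22 (nVar 10) (.const 0) (.mul (.mul (.ofNat rowsE) (.cell 10 (nVar 10) (.const 0)))
      (.mul (rVar 12) (.exp (.div (.cell 9 (nVar 10) (.const 0)) (.const 2)))))))

/-- Estimation of `∑ⱼ exp (⟨xⱼ, yᵢ⟩ + wⱼ)` for all `i`. -/
def kdeProc : Cmd := .seq kdePrep (.seq kdeRounds kdeFinish)

/-- The sizes of the inputs are stored as expected. -/
structure HasDims {DS : Type} (n d : ℕ) (s : State DS) : Prop where
  rows : s.nat 0 0 0 = n
  cols : s.nat 0 0 1 = d

theorem HasDims.of_eq {DS : Type} {n d : ℕ} {s s' : State DS} (h : HasDims n d s)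
    (hn : s'.nat 0 = s.nat 0) : HasDims n d s' := by
  refine ⟨?_, ?_⟩ <;> rw [hn]
  exacts [h.rows, h.cols]

theorem HasDims.rowsE {DS : Type} {n d : ℕ} {s : State DS} (h : HasDims n d s) :
    rowsE.eval s = n := h.rows

theorem HasDims.colsE {DS : Type} {n d : ℕ} {s : State DS} (h : HasDims n d s) :
    colsE.eval s = d := h.cols

/-- The arguments of the procedure. -/
structure KDEArgs {DS : Type} (n d : ℕ) (x y : ℕ → ℕ → ℝ) (w : ℕ → ℝ) (ε τ : ℝ) (s : State DS) :
    Prop extends HasDims n d s where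
  pts : ∀ i < n, ∀ l < d, s.real 6 i l = x i l
  qrs : ∀ i < n, ∀ l < d, s.real 7 i l = y i l
  wts : ∀ i < n, s.real 20 i 0 = w i
  eps : s.real 21 0 0 = ε
  exponent : s.real 3 0 1 = τ

/-- The state after the preparation. -/
structure KDEReady {DS : Type} (n d : ℕ) (x y : ℕ → ℕ → ℝ) (w : ℕ → ℝ) (ε τ : ℝ)
    (s : State DS) : Prop extends KDEArgs n d x y w ε τ s where
  lift : ∀ i < n, s.real 6 i d =
    Real.sqrt (2 * Real.log (expMass n d x w) - (normSq d (x i) + 2 * w i))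
  qlift : ∀ i < n, s.real 7 i d = 0
  qnorm : ∀ i < n, s.real 9 i 0 = normSq d (y i)
  mass : s.real 12 0 0 = expMass n d x w

theorem KDEReady.of_eq {DS : Type} {n d : ℕ} {x y : ℕ → ℕ → ℝ} {w : ℕ → ℝ} {ε τ : ℝ}
    {s s' : State DS} (h : KDEReady n d x y w ε τ s) (hn : s'.nat 0 = s.nat 0)
    (hr : ∀ a ∈ [3, 6, 7, 9, 12, 20, 21], s'.real a = s.real a) : KDEReady n d x y w ε τ s' := by
  have r3 := hr 3 (by simp)
  have r6 := hr 6 (by simp)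
  have r7 := hr 7 (by simp)
  have r9 := hr 9 (by simp)
  have r12 := hr 12 (by simp)
  have r20 := hr 20 (by simp)
  have r21 := hr 21 (by simp)
  refine ⟨⟨h.toHasDims.of_eq hn, ?_, ?_, ?_, ?_, ?_⟩, ?_, ?_, ?_, ?_⟩
  · rw [r6]; exact h.pts
  · rw [r7]; exact h.qrs
  · rw [r20]; exact h.wts
  · rw [r21]; exact h.eps
  · rw [r3]; exact h.exponent
  · rw [r6]; exact h.lift
  · rw [r7]; exact h.qlift
  · rw [r9]; exact h.qnorm
  · rw [r12]; exact h.mass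

section KDE

variable {𝒦 : KDEPrimitive} {F n d : ℕ} {x y : ℕ → ℕ → ℝ} {w : ℕ → ℝ} {ε τ : ℝ}

/-- The rounds start with cost parameter `1` and all `n` estimates marked as missing, which is what
a nonpositive estimate means. -/
theorem kdePrep_spec {s : State 𝒦.DS} (hFn : n + 1 ≤ F) (hFd : d + 1 ≤ F)
    (h : KDEArgs n d x y w ε τ s) :
    Good 𝒦 F kdePrep s (fun s' => Frame [10, 11] [6, 7, 8, 9, 10, 11, 12, 13, 15] s s' ∧
      KDEReady n d x y w ε τ s' ∧ (∀ i < n, s'.real 10 i 0 = 0) ∧ s'.real 13 0 0 = 1 ∧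
      s'.real 15 0 0 = n ∧ (s'.time : ℝ) ≤ s.time + (n + 1) * (d + 1) * 1000) 0 := by
  have hdim : ∀ {ln lr : List ℕ} {s' : State 𝒦.DS}, Frame ln lr s s' → 0 ∉ ln →
      HasDims n d s' := fun hf h0 => h.toHasDims.of_eq (hf.nat 0 h0)
  unfold kdePrep
  refine Good.seq_left (Good.rowSums n d (by norm_num) (fun i l => x i l * x i l)
    (fun i t => t + 2 * w i) (by norm_num) (fun s' hs' => (hdim hs' (by simp)).rowsE)
    (fun s' hs' => (hdim hs' (by simp)).colsE) hFn hFd (fun k hk k' hk' s' hs' h1 h2 => ?_)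
    (fun k hk s' hs' h1 => ?_)) fun s₁ ⟨hf1, hv1, ht1⟩ => ?_
  · simp [RExpr.eval, NExpr.eval, nVar, h1, h2, hs'.real 6, h.pts k hk k' hk']
  · simp [RExpr.eval, NExpr.eval, nVar, rVar, h1, hs'.real 20, h.wts k hk]
  refine Good.seq_left (Good.rowSums n d (by norm_num) (fun i l => y i l * y i l)
    (fun i t => t) (by norm_num)
    (fun s' hs' => (hdim (hf1.mono.trans hs'.mono : Frame [10, 11] [11, 8, 9] s s')
      (by simp)).rowsE)
    (fun s' hs' => (hdim (hf1.mono.trans hs'.mono : Frame [10, 11] [11, 8, 9] s s')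
      (by simp)).colsE) hFn hFd (fun k hk k' hk' s' hs' h1 h2 => ?_)
    (fun k hk s' hs' h1 => ?_)) fun s₂ ⟨hf2, hv2, ht2⟩ => ?_
  · simp [RExpr.eval, NExpr.eval, nVar, h1, h2, hs'.real 7, hf1.real 7, h.qrs k hk k' hk']
  · simp [RExpr.eval, NExpr.eval, rVar]
  have hf2' : Frame [10, 11] [11, 8, 9] s s₂ := hf1.mono.trans hf2.mono
  refine Good.seq_left (Good.sumLoop n (fun j => Real.exp ((normSq d (x j) + 2 * w j) / 2))
    (fun s' hs' => (hdim (hf2'.mono.trans hs'.mono : Frame [10, 11] [11, 8, 9, 12] s s')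
      (by simp)).rowsE) hFn (fun k hk s' hs' h1 => ?_)) fun s₃ ⟨hf3, hv3, ht3⟩ => ?_
  · simp [RExpr.eval, NExpr.eval, nVar, h1, hs'.real 8, hf2.real 8, hv1 k hk, normSq]
  have hf3' : Frame [10, 11] [11, 8, 9, 12] s s₃ := hf2'.mono.trans hf3.mono
  refine Good.seq_left (Good.fillLoop n d (fun i =>
      Real.sqrt (2 * Real.log (expMass n d x w) - (normSq d (x i) + 2 * w i)))
    (fun s' hs' => (hdim (hf3'.mono.trans hs'.mono : Frame [10, 11] [11, 8, 9, 12, 6] s s')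
      (by simp)).rowsE)
    (fun s' hs' => (hdim (hf3'.mono.trans hs'.mono : Frame [10, 11] [11, 8, 9, 12, 6] s s')
      (by simp)).colsE) hFn (fun k hk s' hs' _ h1 => ?_)) fun s₄ ⟨hf4, hv4, ht4⟩ => ?_
  · simp [RExpr.eval, NExpr.eval, nVar, rVar, h1, hs'.real 8, hs'.real 12, hf2.real 8, hf3.real 8,
      hv1 k hk, normSq, hv3, expMass]
  have hf4' : Frame [10, 11] [11, 8, 9, 12, 6] s s₄ := hf3'.mono.trans hf4.mono
  refine Good.seq_left (Good.fillLoop n d (fun i => 0)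
    (fun s' hs' => (hdim (hf4'.mono.trans hs'.mono : Frame [10, 11] [11, 8, 9, 12, 6, 7] s s')
      (by simp)).rowsE)
    (fun s' hs' => (hdim (hf4'.mono.trans hs'.mono : Frame [10, 11] [11, 8, 9, 12, 6, 7] s s')
      (by simp)).colsE) hFn (fun k hk s' hs' _ h1 => ?_)) fun s₅ ⟨hf5, hv5, ht5⟩ => ?_
  · simp [RExpr.eval]
  have hf5' : Frame [10, 11] [11, 8, 9, 12, 6, 7] s s₅ := hf4'.mono.trans hf5.mono
  refine Good.seq_left (Good.fillLoop n 0 (fun i => 0)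
    (fun s' hs' => (hdim (hf5'.mono.trans hs'.mono : Frame [10, 11] [11, 8, 9, 12, 6, 7, 10] s s')
      (by simp)).rowsE)
    (fun s' hs' => rfl) hFn (fun k hk s' hs' _ h1 => ?_)) fun s₆ ⟨hf6, hv6, ht6⟩ => ?_
  · simp [RExpr.eval]
  have hf6' : Frame [10, 11] [11, 8, 9, 12, 6, 7, 10] s s₆ := hf5'.mono.trans hf6.mono
  refine Good.seq_left Good.setR_frame fun s₇ ⟨hf7, hv7, ht7⟩ =>
    Good.setR_frame.mono fun s₈ ⟨hf8, hv8, ht8⟩ => ?_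
  have hf7' : Frame [10, 11] [11, 8, 9, 12, 6, 7, 10, 13] s s₇ := hf6'.mono.trans hf7.mono
  have hf8' : Frame [10, 11] [6, 7, 8, 9, 10, 11, 12, 13, 15] s s₈ := hf7'.mono.trans hf8.mono
  have d7 := hdim hf7' (by simp)
  refine ⟨hf8', ⟨⟨hdim hf8' (by simp), fun i hi l hl => ?_, fun i hi l hl => ?_, fun i hi => ?_,
    ?_, ?_⟩, fun i hi => ?_, fun i hi => ?_, fun i hi => ?_, ?_⟩, fun i hi => ?_, ?_, ?_, ?_⟩
  · rw [hf8.real 6 (by simp), hf7.real 6 (by simp), hf6.real 6 (by simp), hf5.real 6 (by simp),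
      hv4.2 i l (by omega), hf3'.real 6 (by simp), h.pts i hi l hl]
  · rw [hf8.real 7 (by simp), hf7.real 7 (by simp), hf6.real 7 (by simp),
      hv5.2 i l (by omega), hf4'.real 7 (by simp), h.qrs i hi l hl]
  · rw [hf8'.real 20 (by simp), h.wts i hi]
  · rw [hf8'.real 21 (by simp), h.eps]
  · rw [hf8'.real 3 (by simp), h.exponent]
  · rw [hf8.real 6 (by simp), hf7.real 6 (by simp), hf6.real 6 (by simp), hf5.real 6 (by simp),
      hv4.1 i hi]
  · rw [hf8.real 7 (by simp), hf7.real 7 (by simp), hf6.real 7 (by simp), hv5.1 i hi]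
  · rw [hf8.real 9 (by simp), hf7.real 9 (by simp), hf6.real 9 (by simp), hf5.real 9 (by simp),
      hf4.real 9 (by simp), hf3.real 9 (by simp), hv2 i hi, normSq]
  · rw [hf8.real 12 (by simp), hf7.real 12 (by simp), hf6.real 12 (by simp), hf5.real 12 (by simp),
      hf4.real 12 (by simp), hv3, expMass]
  · rw [hf8.real 10 (by simp), hf7.real 10 (by simp), hv6.1 i hi]
  · rw [hf8.real 13 (by simp), hv7]
    simp [NExpr.eval, RExpr.eval]
  · rw [hv8]
    simp [NExpr.eval, RExpr.eval, d7.rowsE]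
  · rw [ht8, ht7]
    simp only [NExpr.size, RExpr.size, nVar, rVar, rowsE, colsE] at ht1 ht2 ht3 ht4 ht5 ht6 ⊢
    push_cast at *
    have p1 : (0 : ℝ) ≤ n := Nat.cast_nonneg _
    have p2 : (0 : ℝ) ≤ d := Nat.cast_nonneg _
    have p3 : (0 : ℝ) ≤ n * d := by positivity
    nlinarith

end KDE

end KDEAttention
end

/-! ### One round: build the data structure and query all points. -/

noncomputable section

namespace KDEAttention

open scoped ENNReal

/-- The arrays outside the given lists are unchanged. -/
structure SameArrays {DS : Type} (ln lr : List ℕ) (s s' : State DS) : Prop where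
  nat : ∀ a, a ∉ ln → s'.nat a = s.nat a
  real : ∀ a, a ∉ lr → s'.real a = s.real a

theorem Frame.same {DS : Type} {ln lr : List ℕ} {s s' : State DS} (h : Frame ln lr s s') :
    SameArrays ln lr s s' := ⟨h.nat, h.real⟩

theorem SameArrays.trans {DS : Type} {ln lr : List ℕ} {s s' s'' : State DS}
    (h : SameArrays ln lr s s') (h' : SameArrays ln lr s' s'') : SameArrays ln lr s s'' :=
  ⟨fun a ha => (h'.nat a ha).trans (h.nat a ha), fun a ha => (h'.real a ha).trans (h.real a ha)⟩

theorem SameArrays.mono {DS : Type} {ln lr ln' lr' : List ℕ} {s s' : State DS}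
    (h : SameArrays ln lr s s')
    (hn : ln ⊆ ln' := by simp) (hr : lr ⊆ lr' := by simp) : SameArrays ln' lr' s s' :=
  ⟨fun a ha => h.nat a fun h' => ha (hn h'), fun a ha => h.real a fun h' => ha (hr h')⟩

section KDE

variable {𝒦 : KDEPrimitive} {F n d : ℕ} {x y : ℕ → ℕ → ℝ} {w : ℕ → ℝ} {ε τ C₀ a : ℝ}

/-- The dimension of a query is the value of an expression in the current state; this replaces it by
the number that it equals. -/
theorem query_congr (S : 𝒦.DS) {D D' : ℕ} (h : D = D') (f : ℕ → ℝ) :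
    (𝒦.query S fun l : Fin D => f l) = 𝒦.query S fun l : Fin D' => f l := by
  subst h; rfl

/-- The density at the `i`-th query point. -/
def kdeDensity (n d : ℕ) (x y : ℕ → ℕ → ℝ) (w : ℕ → ℝ) (i : ℕ) : ℝ := expRatio n d x w (y i) / n

/-- The threshold of a round. -/
def kdeThreshold (τ P : ℝ) : ℝ := Real.exp ((0 - Real.log P) / τ)

/-- Rounds are indexed by the cost parameter `P = μ^{-τ}` instead of the density threshold `μ`.
Doubling `P` then doubles the cost bound whatever `τ` is. -/
theorem kdeThreshold_rpow (hτ : 0 < τ) {P : ℝ} (hP : 0 < P) : kdeThreshold τ P ^ τ = 1 / P := by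
  unfold kdeThreshold
  rw [← Real.exp_mul, div_mul_cancel₀ _ hτ.ne', zero_sub, Real.exp_neg, Real.exp_log hP, one_div]

/-- What a successful query returns. -/
structure KDEAnswer (C₀ ε ρ μ P : ℝ) (d : ℕ) (q : ℝ × ℕ) : Prop where
  approx : μ ≤ ρ → |q.1 - ρ| ≤ ε * ρ
  zero : ρ < μ → q.1 = 0
  time : (q.2 : ℝ) ≤ C₀ * ((d + 1) * P / ε ^ 2)

/-- The test that drives the rounds. -/
def kdeThresholdE : RExpr :=
  .exp (.div (.sub (.const 0) (.log (rVar 13))) (.cell 3 (.const 0) (.const 1)))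

/-- The guarantee of the primitive is for one fixed query. All randomness lies in the data structure
and the `n` query points are fixed before it is built, so a union bound makes one structure good for
all of them. -/
theorem kdeBuild_spec (hfast : 𝒦.IsFast τ C₀ a) (hn : 0 < n) (hτ : 0 < τ) (hC₀ : 0 < C₀)
    (hε : 0 < ε) (hε1 : ε < 1) {P : ℝ} (hP : 1 < P) {s : State 𝒦.DS}
    (h : KDEReady n d x y w ε τ s) (hpw : s.real 13 0 0 = P) :
    Good 𝒦 F (.build 0 6 rowsE (.add colsE (.const 1)) (rVar 21) kdeThresholdE) s
      (fun s' => s'.nat = s.nat ∧ s'.real = s.real ∧ (∃ S, s'.ds 0 = some S ∧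
        ∀ i < n, KDEAnswer C₀ ε (kdeDensity n d x y w i) (kdeThreshold τ P) P d
          (𝒦.query S fun l : Fin (d + 1) => s.real 7 i l)) ∧
        (s'.time : ℝ) ≤ s.time + (40 + C₀ * ((d + 1) * n * P / ε ^ 2)))
      (n * ENNReal.ofReal ((n : ℝ) ^ (-a))) := by
  refine Good.build ?_
  have hN : rowsE.eval s = n := h.toHasDims.rowsE
  have hD : (NExpr.add colsE (.const 1)).eval s = d + 1 := by
    simp [NExpr.eval, h.toHasDims.colsE]
  have hE : (rVar 21).eval s = ε := by simp [rVar, RExpr.eval, NExpr.eval, h.eps]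
  have hM : kdeThresholdE.eval s = kdeThreshold τ P := by
    simp [kdeThresholdE, kdeThreshold, rVar, RExpr.eval, NExpr.eval, hpw, h.exponent]
  have hDc : (((NExpr.add colsE (.const 1)).eval s : ℕ) : ℝ) = d + 1 := by rw [hD]; push_cast; rfl
  have hNc : ((rowsE.eval s : ℕ) : ℝ) = n := by rw [hN]
  have hP0 : 0 < P := by linarith
  have hμ0 : 0 < kdeThreshold τ P := Real.exp_pos _
  have hμ1 : kdeThreshold τ P < 1 := by
    unfold kdeThreshold
    rw [Real.exp_lt_one_iff]
    exact div_neg_of_neg_of_pos (by have := Real.log_pos hP; linarith) hτ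
  have hμτ := kdeThreshold_rpow hτ hP0
  have key := fun i : ℕ => hfast (rowsE.eval s) ((NExpr.add colsE (.const 1)).eval s)
    (by rw [hN]; exact hn) (by rw [hD]; omega)
    (Matrix.of fun (i : Fin (rowsE.eval s)) (j : Fin ((NExpr.add colsE (.const 1)).eval s)) =>
      s.real 6 i j) ((rVar 21).eval s) (kdeThresholdE.eval s) (by rw [hE]; exact ⟨hε, hε1⟩)
    (by rw [hM]; exact ⟨hμ0, hμ1⟩) (fun l => s.real 7 i l)
  rw [hNc] at key
  refine le_trans (MeasureTheory.measure_mono (fun r hr => ?_))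
    ((MeasureTheory.measure_biUnion_finset_le (Finset.range n) _).trans
      ((Finset.sum_le_sum fun i _ => key i).trans (by simp)))
  by_contra hcon
  refine hr ?_
  have hgood : ∀ i < n, (r.2 : ℝ) ≤ C₀ * ((d + 1) * n / (ε ^ 2 * (kdeThreshold τ P) ^ τ)) ∧
      KDEAnswer C₀ ε (kdeDensity n d x y w i) (kdeThreshold τ P) P d
          (𝒦.query r.1 fun l : Fin (d + 1) => s.real 7 i l) := by
    intro i hi
    have hnot : ¬ r ∈ {r : 𝒦.DS × ℕ | ¬ (_ ∧ _)} := fun hmem =>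
      hcon (Set.mem_biUnion (Finset.mem_coe.2 (Finset.mem_range.2 hi)) hmem)
    have hi' := not_not.1 hnot
    have hdens := gaussDensity_lift (q := y i) hn hN hD h.pts h.lift (h.qrs i hi) (h.qlift i hi)
    rw [hdens, hE, hM, hDc, query_congr r.1 hD (fun l => s.real 7 i l)] at hi'
    obtain ⟨h1, h2, h3, h4⟩ := hi'
    refine ⟨h1, h2, h3, h4.trans (mul_le_mul_of_nonneg_left ?_ hC₀.le)⟩
    have hρ : 0 < expRatio n d x w (y i) / n := div_pos (expRatio_pos hn) (Nat.cast_pos.2 hn)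
    -- Dropping the density from `(μ + ρ)^τ` bounds the time of each query by that for the threshold
    -- alone.
    have hle : 1 / P ≤ (kdeThreshold τ P + expRatio n d x w (y i) / n) ^ τ := by
      rw [← hμτ]
      exact Real.rpow_le_rpow hμ0.le (by linarith) hτ.le
    rw [div_le_div_iff₀ (by have := Real.rpow_pos_of_pos (add_pos hμ0 hρ) τ; positivity)
      (by positivity)]
    have h5 : 1 ≤ P * (kdeThreshold τ P + expRatio n d x w (y i) / n) ^ τ := by
      rw [div_le_iff₀ hP0] at hle; linarith
    have h6 : (0 : ℝ) ≤ (d + 1) * ε ^ 2 := by positivity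
    nlinarith [mul_le_mul_of_nonneg_left h5 h6]
  refine ⟨rfl, rfl, ⟨r.1, by simp [State.tick], fun i hi => (hgood i hi).2⟩, ?_⟩
  have h1 := (hgood 0 hn).1
  rw [hμτ] at h1
  have e : ((d : ℝ) + 1) * n / (ε ^ 2 * (1 / P)) = (d + 1) * n * P / ε ^ 2 := by
    field_simp
  rw [e] at h1
  simp only [State.tick, NExpr.size, RExpr.size, rowsE, colsE, rVar, kdeThresholdE]
  push_cast
  linarith

/-- The loop that queries all points. -/
def kdeQueries : Cmd :=
  forLoop 10 rowsE (.seq (.query 10 (nVar 10) (.const 0) 0 7 (nVar 10) (.add colsE (.const 1)))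
      (.ite (.realLe (.cell 10 (nVar 10) (.const 0)) (.const 0))
        (.setR 15 (.const 0) (.const 0) (.add (rVar 15) (.const 1))) .skip))

theorem card_filter_range_succ (p : ℕ → Prop) [DecidablePred p] (k : ℕ) :
    (((Finset.range (k + 1)).filter p).card : ℝ) =
      ((Finset.range k).filter p).card + if p k then 1 else 0 := by
  rw [Finset.range_add_one, Finset.filter_insert]
  split_ifs with h
  · rw [Finset.card_insert_of_notMem (by simp)]; push_cast; rfl
  · simp

open Classical in
theorem kdeQueries_spec (hF : n + 1 ≤ F) {B : ℝ} {s : State 𝒦.DS} {S : 𝒦.DS}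
    (h : HasDims n d s) (hS : s.ds 0 = some S) (h0 : s.real 15 0 0 = 0)
    (hB : ∀ i < n, ((𝒦.query S fun l : Fin (d + 1) => s.real 7 i l).2 : ℝ) ≤ B) :
    Good 𝒦 F kdeQueries s (fun s' => Frame [10] [10, 15] s s' ∧
      ((∀ i < n, s'.real 10 i 0 = (𝒦.query S fun l : Fin (d + 1) => s.real 7 i l).1) ∧
      s'.real 15 0 0 = ((Finset.range n).filter fun i =>
        (𝒦.query S fun l : Fin (d + 1) => s.real 7 i l).1 ≤ 0).card) ∧
      (s'.time : ℝ) ≤ s.time + (n * (B + 40) + (n + 1) * 30)) 0 := by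
  refine (Good.forLoop_real (ln := []) (lr := [10, 15])
      (fun k R => (∀ i < k, R 10 i 0 = (𝒦.query S fun l : Fin (d + 1) => s.real 7 i l).1) ∧
        R 15 0 0 = ((Finset.range k).filter fun i =>
        (𝒦.query S fun l : Fin (d + 1) => s.real 7 i l).1 ≤ 0).card) n (fun _ => B + 40)
      (fun s' hs' => (h.of_eq (hs'.nat 0 (by simp))).rowsE) (by simp) hF
      ⟨by simp, by simp [h0]⟩ fun k hk s₁ hs₁ hc hJ => ?_).mono (fun s' ⟨h1, h2, h3⟩ => ?_)
  · have hq : (𝒦.query S fun l : Fin ((NExpr.add colsE (.const 1)).eval s₁) =>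
        s₁.real 7 ((nVar 10).eval s₁) l) = 𝒦.query S fun l : Fin (d + 1) => s.real 7 k l := by
      rw [query_congr S (D' := d + 1) (by
        simp [NExpr.eval, (h.of_eq (hs₁.nat 0 (by simp))).colsE])
        (fun l => s₁.real 7 ((nVar 10).eval s₁) l), hs₁.real 7 (by simp)]
      simp only [nVar, NExpr.eval, hc]
    refine Good.seq_left (Q := fun s₂ => Frame [] [10] s₁ s₂ ∧
      (∀ i, s₂.real 10 i 0 = if i = k then (𝒦.query S fun l : Fin (d + 1) => s.real 7 k l).1
        else s₁.real 10 i 0) ∧ (s₂.time : ℝ) ≤ s₁.time + (B + 15))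
      (Good.query (S := S) (by rw [hs₁.ds, hS]) ⟨⟨fun _ _ => rfl, fun a ha => ?_, rfl⟩,
        fun i => ?_, ?_⟩) fun s₂ ⟨hf2, hv2, ht2⟩ => ?_
    · exact setCell_of_ne _ _ _ _ (by simpa using ha)
    · rw [hq]
      simp [State.tick, setCell, nVar, NExpr.eval, hc]
    · rw [hq]
      have := hB k hk
      simp only [State.tick, NExpr.size, nVar, colsE]
      push_cast
      linarith
    have hc2 : s₂.nat 10 0 0 = k := by rw [hf2.nat 10 (by simp)]; exact hc
    have hest : ∀ i < k + 1, s₂.real 10 i 0 =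
        (𝒦.query S fun l : Fin (d + 1) => s.real 7 i l).1 := by
      intro i hi
      rw [hv2 i]
      split_ifs with hik
      · rw [hik]
      · exact hJ.1 i (by omega)
    have hcnt : s₂.real 15 0 0 = s₁.real 15 0 0 := by rw [hf2.real 15 (by simp)]
    have hb : (BExpr.realLe (.cell 10 (nVar 10) (.const 0)) (.const 0)).Holds s₂ ↔
        (𝒦.query S fun l : Fin (d + 1) => s.real 7 k l).1 ≤ 0 := by
      simp [BExpr.Holds, RExpr.eval, NExpr.eval, nVar, hc2, hest k (by omega)]
    refine Good.ite (fun hle => Good.setR_frame.mono fun s₃ ⟨hf3, hv3, ht3⟩ => ?_)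
      (fun hle => Good.skip ?_)
    · rw [hb] at hle
      refine ⟨⟨fun a ha => ?_, fun a ha => ?_, ?_⟩, ⟨fun i hi => ?_, ?_⟩, ?_⟩
      · rw [hf3.nat a (by simp)]; exact hf2.nat a (by simp)
      · have ha2 : a ≠ 10 ∧ a ≠ 15 := by simpa using ha
        rw [hf3.real a (by simpa using ha2.2)]; exact hf2.real a (by simpa using ha2.1)
      · rw [hf3.ds]; exact hf2.ds
      · rw [hf3.real 10 (by simp)]; exact hest i hi
      · rw [hv3, card_filter_range_succ, if_pos hle, ← hJ.2, ← hcnt]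
        simp [NExpr.eval, RExpr.eval, rVar, State.tick]
      · rw [ht3]
        simp only [State.tick, NExpr.size, RExpr.size, BExpr.size, nVar, rVar]
        push_cast
        linarith
    · rw [hb] at hle
      refine ⟨⟨fun a _ => hf2.nat a (by simp), fun a ha => ?_, hf2.ds⟩, ⟨hest, ?_⟩, ?_⟩
      · have ha2 : a ≠ 10 ∧ a ≠ 15 := by simpa using ha
        exact hf2.real a (by simpa using ha2.1)
      · rw [card_filter_range_succ, if_neg hle, ← hJ.2, ← hcnt, add_zero]
        rfl
      · simp only [State.tick, NExpr.size, RExpr.size, BExpr.size, nVar]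
        push_cast
        linarith
  · refine ⟨h1, h2, h3.trans ?_⟩
    simp only [Finset.sum_const, Finset.card_range, nsmul_eq_mul, NExpr.size, rowsE]
    push_cast
    have : (0 : ℝ) ≤ n := Nat.cast_nonneg _
    nlinarith

theorem kdeRound_eq : kdeRound =
    .seq (.setR 13 (.const 0) (.const 0) (.mul (.const 2) (rVar 13)))
    (.seq (.build 0 6 rowsE (.add colsE (.const 1)) (rVar 21) kdeThresholdE)
    (.seq (.setR 15 (.const 0) (.const 0) (.const 0)) kdeQueries)) := rfl

open Classical in
-- Building costs `C₀(d+1)n · 2P/ε²`, and the `n` queries together cost no more than that. The round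
-- is therefore linear in its new parameter `2P`, and the bookkeeping is absorbed since `2P/ε² ≥ 1`.
theorem kdeRound_spec (hfast : 𝒦.IsFast τ C₀ a) (hn : 0 < n) (hd : 0 < d) (hτ : 0 < τ)
    (hC₀ : 0 < C₀) (hε : 0 < ε) (hε1 : ε < 1) (hF : n + 1 ≤ F) {P : ℝ} (hP : 1 ≤ P)
    {s : State 𝒦.DS} (h : KDEReady n d x y w ε τ s) (hpw : s.real 13 0 0 = P) :
    Good 𝒦 F kdeRound s (fun s' => SameArrays [10] [10, 13, 15] s s' ∧
      KDEReady n d x y w ε τ s' ∧ s'.real 13 0 0 = 2 * P ∧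
      (∀ i < n, (kdeThreshold τ (2 * P) ≤ kdeDensity n d x y w i →
          |s'.real 10 i 0 - kdeDensity n d x y w i| ≤ ε * kdeDensity n d x y w i) ∧
        (kdeDensity n d x y w i < kdeThreshold τ (2 * P) → s'.real 10 i 0 = 0)) ∧
      s'.real 15 0 0 = ((Finset.range n).filter fun i => s'.real 10 i 0 ≤ 0).card ∧
      (s'.time : ℝ) ≤ s.time + (4 * C₀ + 300) * (n * d) * (2 * P) / ε ^ 2)
      (n * ENNReal.ofReal ((n : ℝ) ^ (-a))) := by
  rw [kdeRound_eq]
  refine Good.seq_left Good.setR_frame fun s₁ ⟨hf1, hv1, ht1⟩ => ?_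
  have hr1 : KDEReady n d x y w ε τ s₁ := h.of_eq (hf1.nat 0 (by simp)) fun a ha =>
    hf1.real a (by simp at ha ⊢; omega)
  have hp1 : s₁.real 13 0 0 = 2 * P := by
    rw [hv1]; simp [NExpr.eval, RExpr.eval, rVar, hpw]
  refine Good.seq_right (kdeBuild_spec hfast hn hτ hC₀ hε hε1 (by linarith) hr1 hp1)
    fun s₂ ⟨hn2, hre2, ⟨S, hS, hans⟩, ht2⟩ => ?_
  have hr2 : KDEReady n d x y w ε τ s₂ := hr1.of_eq (by rw [hn2]) fun a _ => by rw [hre2]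
  refine Good.seq_left Good.setR_frame fun s₃ ⟨hf3, hv3, ht3⟩ => ?_
  have hr3 : KDEReady n d x y w ε τ s₃ := hr2.of_eq (hf3.nat 0 (by simp)) fun a ha =>
    hf3.real a (by simp at ha ⊢; omega)
  have h7 : s₃.real 7 = s₁.real 7 := by rw [hf3.real 7 (by simp), hre2]
  refine (kdeQueries_spec (S := S) (B := C₀ * ((d + 1) * (2 * P) / ε ^ 2)) hF hr3.toHasDims
    (by rw [hf3.ds, hS]) (by rw [hv3]; simp [NExpr.eval, RExpr.eval])
    (fun i hi => by rw [h7]; exact (hans i hi).time)).mono fun s₄ ⟨hf4, ⟨hv4, hc4⟩, ht4⟩ => ?_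
  rw [h7] at hv4 hc4
  have hsame : SameArrays [10] [10, 13, 15] s s₄ := by
    have e1 : SameArrays [10] [10, 13, 15] s s₁ := hf1.same.mono
    have e2 : SameArrays [10] [10, 13, 15] s₁ s₂ :=
      ⟨fun a _ => by rw [hn2], fun a _ => by rw [hre2]⟩
    have e3 : SameArrays [10] [10, 13, 15] s₂ s₃ := hf3.same.mono
    have e4 : SameArrays [10] [10, 13, 15] s₃ s₄ := hf4.same.mono
    exact ((e1.trans e2).trans e3).trans e4
  refine ⟨hsame, h.of_eq (hsame.nat 0 (by simp)) fun a ha =>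
    hsame.real a (by simp at ha ⊢; omega), ?_, fun i hi => ?_, ?_, ?_⟩
  · rw [hf4.real 13 (by simp), hf3.real 13 (by simp), hre2, hp1]
  · rw [hv4 i hi]
    exact ⟨(hans i hi).approx, (hans i hi).zero⟩
  · rw [hc4]
    congr 2
    refine Finset.filter_congr fun i hi => ?_
    rw [hv4 i (Finset.mem_range.1 hi)]
  · have hn1 : (1 : ℝ) ≤ n := by exact_mod_cast hn
    have hd1 : (1 : ℝ) ≤ d := by exact_mod_cast hd
    have hE : (1 : ℝ) ≤ 1 / ε ^ 2 := by
      rw [le_div_iff₀ (by positivity), one_mul]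
      exact pow_le_one₀ hε.le hε1.le
    set G := (2 * P) / ε ^ 2 with hG
    have hG1 : 1 ≤ G := by
      have : G = (2 * P) * (1 / ε ^ 2) := by rw [hG]; ring
      nlinarith
    have e1 : (d + 1 : ℝ) * n * (2 * P) / ε ^ 2 = (d + 1) * n * G := by rw [hG]; ring
    have e2 : (d + 1 : ℝ) * (2 * P) / ε ^ 2 = (d + 1) * G := by rw [hG]; ring
    have e3 : (4 * C₀ + 300) * (n * d) * (2 * P) / ε ^ 2 = (4 * C₀ + 300) * (n * d * G) := by
      rw [hG]; ring
    rw [e1] at ht2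
    rw [e2] at ht4
    rw [e3]
    have ht1' : (s₁.time : ℝ) = s.time + 8 := by
      rw [ht1]; simp only [NExpr.size, RExpr.size, rVar]; push_cast; ring
    have ht3' : (s₃.time : ℝ) = s₂.time + 4 := by
      rw [ht3]; simp only [NExpr.size, RExpr.size]; push_cast; ring
    have hnd : (n : ℝ) ≤ n * d * G := by
      have : (1 : ℝ) ≤ d * G := by nlinarith
      nlinarith
    have hq1 : C₀ * ((d + 1) * n * G) ≤ C₀ * (2 * (n * d * G)) := by
      refine mul_le_mul_of_nonneg_left ?_ hC₀.le
      have : (n : ℝ) * G ≤ n * G * d := le_mul_of_one_le_right (by positivity) hd1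
      linarith
    have hq2 : n * (C₀ * ((d + 1) * G) + 40) = C₀ * ((d + 1) * n * G) + 40 * n := by ring
    rw [hq2] at ht4
    have hq3 : (4 * C₀ + 300) * (n * d * G) = 2 * (C₀ * (2 * (n * d * G))) + 300 * (n * d * G) := by
      ring
    linarith

end KDE

end KDEAttention
end

/-! ### The sequence of rounds, the missing sums, and the comparison with the data-dependent cost.
-/

noncomputable section

namespace KDEAttention

open scoped ENNReal

section KDE

variable {𝒦 : KDEPrimitive} {F n d : ℕ} {x y : ℕ → ℕ → ℝ} {w : ℕ → ℝ} {ε τ C₀ a c : ℝ}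

open Classical in
/-- `c` is an upper bound for all lower bounds of the data-dependent cost. -/
def IsKDECost (n d : ℕ) (x y : ℕ → ℕ → ℝ) (w : ℕ → ℝ) (ε τ c : ℝ) : Prop :=
  ∀ B : ℝ, (∀ μ : ℝ, 0 < μ → B ≤ 1 / (ε ^ 2 * μ ^ τ) +
    (((Finset.range n).filter fun i => expRatio n d x w (y i) < n * μ).card : ℝ)) → B ≤ c

/-- For `μ ≤ 1` the power term alone is at least `1/ε²`; for `μ > 1` every point counts as light,
since the ratio never exceeds `1`. -/
theorem IsKDECost.le_of_le (hc : IsKDECost n d x y w ε τ c) (hn : 0 < n) (hτ : 0 < τ) (hε : 0 < ε)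
    {B : ℝ} (h1 : B ≤ 1 / ε ^ 2) (h2 : B ≤ n) : B ≤ c := by
  classical
  refine hc B fun μ hμ => ?_
  have hμτ : 0 < μ ^ τ := Real.rpow_pos_of_pos hμ τ
  rcases le_or_gt μ 1 with h | h
  · have h3 : μ ^ τ ≤ 1 := Real.rpow_le_one hμ.le h hτ.le
    have h4 : 1 / ε ^ 2 ≤ 1 / (ε ^ 2 * μ ^ τ) :=
      one_div_le_one_div_of_le (by positivity) (mul_le_of_le_one_right (by positivity) h3)
    have : (0 : ℝ) ≤ (((Finset.range n).filter fun i => expRatio n d x w (y i) < n * μ).card : ℝ) :=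
      Nat.cast_nonneg _
    linarith
  · have hall : (Finset.range n).filter (fun i => expRatio n d x w (y i) < n * μ) =
        Finset.range n := by
      refine Finset.filter_true_of_mem fun i _ => ?_
      have h5 := expRatio_le_one (d := d) (x := x) (w := w) (q := y i) hn
      have h6 : (1 : ℝ) ≤ n := by exact_mod_cast hn
      nlinarith
    rw [hall, Finset.card_range]
    have : 0 ≤ 1 / (ε ^ 2 * μ ^ τ) := by positivity
    linarith

open Classical in
-- If too many points are light at the threshold belonging to `P`, no choice of `μ` is cheap: up to
-- that threshold the power term is at least `P/ε²`, and above it the number of light points is.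
-- This certifies each round as affordable.
theorem IsKDECost.le_of_card (hc : IsKDECost n d x y w ε τ c) (hn : 0 < n) (hτ : 0 < τ)
    (hε : 0 < ε) {P : ℝ} (hP : 0 < P)
    (h : P < ((Finset.range n).filter fun i =>
      kdeDensity n d x y w i < kdeThreshold τ P).card * ε ^ 2) : P / ε ^ 2 ≤ c := by
  refine hc _ fun μ hμ => ?_
  have hμτ : 0 < μ ^ τ := Real.rpow_pos_of_pos hμ τ
  have hnR : (0 : ℝ) < n := Nat.cast_pos.2 hn
  rcases le_or_gt μ (kdeThreshold τ P) with hle | hlt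
  · have h3 : μ ^ τ ≤ 1 / P := by
      rw [← kdeThreshold_rpow hτ hP]; exact Real.rpow_le_rpow hμ.le hle hτ.le
    have h4 : P / ε ^ 2 ≤ 1 / (ε ^ 2 * μ ^ τ) := by
      rw [div_le_div_iff₀ (by positivity) (by positivity)]
      rw [le_div_iff₀ hP] at h3
      nlinarith [sq_nonneg ε]
    have : (0 : ℝ) ≤ (((Finset.range n).filter fun i => expRatio n d x w (y i) < n * μ).card : ℝ) :=
      Nat.cast_nonneg _
    linarith
  · have h5 : (((Finset.range n).filter fun i =>
        kdeDensity n d x y w i < kdeThreshold τ P).card : ℝ) ≤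
        ((Finset.range n).filter fun i => expRatio n d x w (y i) < n * μ).card := by
      refine Nat.cast_le.2 (Finset.card_le_card fun i hi => ?_)
      rw [Finset.mem_filter] at hi ⊢
      refine ⟨hi.1, ?_⟩
      have h6 := hi.2
      unfold kdeDensity at h6
      rw [div_lt_iff₀ hnR] at h6
      nlinarith
    have h7 : P / ε ^ 2 ≤ ((Finset.range n).filter fun i =>
        kdeDensity n d x y w i < kdeThreshold τ P).card := by
      rw [div_le_iff₀ (by positivity)]; exact h.le
    have : 0 ≤ 1 / (ε ^ 2 * μ ^ τ) := by positivity
    linarith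

/-- The invariant of the rounds. -/
structure RoundsInv {DS : Type} (n d : ℕ) (x y : ℕ → ℕ → ℝ) (w : ℕ → ℝ) (ε τ c L : ℝ)
    (s₀ : State DS) (t : ℕ) (s : State DS) : Prop where
  same : SameArrays [10] [10, 13, 15] s₀ s
  ready : KDEReady n d x y w ε τ s
  pw : s.real 13 0 0 = 2 ^ t
  cnt : s.real 15 0 0 = ((Finset.range n).filter fun i => s.real 10 i 0 ≤ 0).card
  est : ∀ i < n, s.real 10 i 0 ≤ 0 ∨
    |s.real 10 i 0 - kdeDensity n d x y w i| ≤ ε * kdeDensity n d x y w i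
  low : ∀ i < n, s.real 10 i 0 ≤ 0 → kdeDensity n d x y w i < kdeThreshold τ (2 ^ t)
  cost : (t = 0 ∧ s.real 15 0 0 = n) ∨ 2 ^ t / ε ^ 2 ≤ 2 * c
  time : (s.time : ℝ) ≤ s₀.time + L / ε ^ 2 * (2 ^ t - 1)

theorem kdeDensity_pos (hn : 0 < n) (i : ℕ) : 0 < kdeDensity n d x y w i :=
  div_pos (expRatio_pos hn) (Nat.cast_pos.2 hn)

/-- Entering a round with parameter `2^t` certifies `2^t/ε² ≤ c`, so the parameter after it
satisfies `2^(t+1)/ε² ≤ 2c`. The geometric sum of the round costs and, on leaving, the number of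
missing estimates are bounded by that last parameter over `ε²`. -/
theorem kdeRounds_spec (hfast : 𝒦.IsFast τ C₀ a) (hn : 2 ≤ n) (hd : 0 < d) (hτ : 0 < τ)
    (hC₀ : 0 < C₀) (hε : 0 < ε) (hε1 : ε < 1) (hF : n + 1 ≤ F)
    (hc : IsKDECost n d x y w ε τ c)
    {s : State 𝒦.DS} (h : KDEReady n d x y w ε τ s) (h10 : ∀ i < n, s.real 10 i 0 = 0)
    (h13 : s.real 13 0 0 = 1) (h15 : s.real 15 0 0 = n) :
    Good 𝒦 F kdeRounds s (fun s' => SameArrays [10] [10, 13, 15] s s' ∧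
      KDEReady n d x y w ε τ s' ∧
      (∀ i < n, s'.real 10 i 0 ≤ 0 ∨
        |s'.real 10 i 0 - kdeDensity n d x y w i| ≤ ε * kdeDensity n d x y w i) ∧
      (((Finset.range n).filter fun i => s'.real 10 i 0 ≤ 0).card : ℝ) ≤ 2 * c ∧
      (s'.time : ℝ) ≤ s.time + ((16 * C₀ + 1280) * (n * d) * c + 20))
      (n * (n * ENNReal.ofReal ((n : ℝ) ^ (-a)))) := by
  classical
  have hn0 : 0 < n := by omega
  have hnR : (2 : ℝ) ≤ n := by exact_mod_cast hn
  have hdR : (1 : ℝ) ≤ d := by exact_mod_cast hd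
  set L : ℝ := 2 * ((4 * C₀ + 320) * (n * d)) with hL
  have hL0 : 0 ≤ L := by positivity
  have hholds : ∀ {t : ℕ} {s' : State 𝒦.DS}, RoundsInv n d x y w ε τ c L s t s' →
      ((BExpr.not (.realLe (.mul (rVar 15) (.mul (rVar 21) (rVar 21))) (rVar 13))).Holds s' ↔
        (2 : ℝ) ^ t < ((Finset.range n).filter fun i => s'.real 10 i 0 ≤ 0).card * ε ^ 2) := by
    intro t s' hI
    simp only [BExpr.Holds, rVar, RExpr.eval, NExpr.eval, hI.ready.eps, hI.pw, not_le, hI.cnt]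
    rw [← sq]
  have hcard : ∀ s' : State 𝒦.DS,
      (((Finset.range n).filter fun i => s'.real 10 i 0 ≤ 0).card : ℝ) ≤ n := by
    intro s'
    exact_mod_cast (Finset.card_filter_le _ _).trans (Finset.card_range n).le
  have hε2 : ε ^ 2 < 1 := pow_lt_one₀ hε.le hε1 (by norm_num)
  refine (Good.loop (RoundsInv n d x y w ε τ c L s) n hF ?_ (fun s' hI => ?_)
    fun t ht s' hI hb => ?_).mono (fun s' hs' => ?_)
  · refine ⟨⟨fun _ _ => rfl, fun _ _ => rfl⟩, h, by simpa using h13, ?_,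
      fun i hi => Or.inl (h10 i hi).le, fun i hi _ => ?_, Or.inl ⟨rfl, h15⟩, by simp⟩
    · rw [h15, Finset.filter_true_of_mem, Finset.card_range]
      exact fun i hi => (h10 i (Finset.mem_range.1 hi)).le
    · unfold kdeThreshold kdeDensity
      simp only [pow_zero, Real.log_one, sub_zero, zero_div, Real.exp_zero]
      -- With parameter `1` the threshold is `1`, and all densities are at most `1/n < 1`; this uses
      -- `n ≥ 2`.
      rw [div_lt_one (by linarith)]
      have := expRatio_le_one (d := d) (x := x) (w := w) (q := y i) hn0
      linarith
  · rw [hholds hI, not_lt]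
    -- After `n` rounds the parameter exceeds `n`, hence any possible number of missing estimates
    -- times `ε²`. This crude bound on the rounds enters only the fuel and the failure probability.
    have h1 : (n : ℝ) ≤ 2 ^ n := by exact_mod_cast Nat.lt_two_pow_self.le
    have h2 := hcard s'
    nlinarith [sq_nonneg ε]
  · have hlt := (hholds hI).1 hb
    have hP : (1 : ℝ) ≤ 2 ^ t := one_le_pow₀ (by norm_num)
    have hI' : KDEReady n d x y w ε τ (s'.tick ((BExpr.not (.realLe (.mul (rVar 15)
      (.mul (rVar 21) (rVar 21))) (rVar 13))).size + 1)) := hI.ready.of_eq rfl fun _ _ => rfl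
    refine (kdeRound_spec hfast hn0 hd hτ hC₀ hε hε1 hF hP hI' hI.pw).mono
      fun s₁ ⟨hsame, hready, hpw, hans, hcnt, htime⟩ => ?_
    rw [← pow_succ'] at hpw hans htime
    refine ⟨hI.same.trans ⟨hsame.nat, hsame.real⟩, hready, hpw, hcnt, fun i hi => ?_,
      fun i hi h0 => ?_, Or.inr ?_, ?_⟩
    · rcases le_or_gt (kdeThreshold τ (2 ^ (t + 1))) (kdeDensity n d x y w i) with h1 | h1
      · exact Or.inr ((hans i hi).1 h1)
      · exact Or.inl ((hans i hi).2 h1).le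
    -- An estimate within relative error `ε < 1` of a positive density is positive, so a nonpositive
    -- estimate certifies a density below the threshold.
    · by_contra! h1
      have h2 := neg_le_of_abs_le ((hans i hi).1 h1)
      have h3 := kdeDensity_pos (d := d) (x := x) (y := y) (w := w) hn0 i
      nlinarith
    · have h1 : (((Finset.range n).filter fun i => s'.real 10 i 0 ≤ 0).card : ℝ) ≤
          ((Finset.range n).filter fun i =>
            kdeDensity n d x y w i < kdeThreshold τ (2 ^ t)).card := by
        refine Nat.cast_le.2 (Finset.card_le_card fun i hi => ?_)
        rw [Finset.mem_filter] at hi ⊢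
        exact ⟨hi.1, hI.low i (Finset.mem_range.1 hi.1) hi.2⟩
      have h2 := hc.le_of_card hn0 hτ hε (P := 2 ^ t) (by positivity)
        (hlt.trans_le (mul_le_mul_of_nonneg_right h1 (sq_nonneg ε)))
      rw [pow_succ', mul_div_assoc]
      linarith
    · have h1 := hI.time
      have ht2 : ((s'.tick ((BExpr.not (.realLe (.mul (rVar 15)
          (.mul (rVar 21) (rVar 21))) (rVar 13))).size + 1)).time : ℝ) = s'.time + 17 := by
        simp only [State.tick, BExpr.size, RExpr.size, NExpr.size, rVar]; push_cast; ring
      rw [ht2] at htime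
      have h3 : (1 : ℝ) ≤ 2 ^ (t + 1) / ε ^ 2 := by
        rw [le_div_iff₀ (by positivity)]
        have : (1 : ℝ) ≤ 2 ^ (t + 1) := one_le_pow₀ (by norm_num)
        linarith
      have h4 : (1 : ℝ) ≤ n * d * (2 ^ (t + 1) / ε ^ 2) := by
        have : (1 : ℝ) ≤ n * d := by nlinarith
        nlinarith
      have e1 : (4 * C₀ + 300) * (n * d) * 2 ^ (t + 1) / ε ^ 2 =
          (4 * C₀ + 320) * (n * d) * (2 ^ (t + 1) / ε ^ 2) -
            20 * (n * d * (2 ^ (t + 1) / ε ^ 2)) := by ring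
      have e2 : L / ε ^ 2 * (2 ^ (t + 1) - 1) = L / ε ^ 2 * (2 ^ t - 1) +
          (4 * C₀ + 320) * (n * d) * (2 ^ (t + 1) / ε ^ 2) := by
        rw [hL, pow_succ]; ring
      rw [e1] at htime
      rw [e2]
      linarith
  · obtain ⟨t, _, s₁, hI, hb, rfl⟩ := hs'
    have hle := not_lt.1 ((hholds hI).not.1 hb)
    have hc1 : 1 ≤ c := hc.le_of_le hn0 hτ hε
      (by rw [le_div_iff₀ (by positivity)]; linarith) (by linarith)
    refine ⟨⟨hI.same.nat, hI.same.real⟩, hI.ready.of_eq rfl fun _ _ => rfl, hI.est, ?_, ?_⟩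
    · change (((Finset.range n).filter fun i => s₁.real 10 i 0 ≤ 0).card : ℝ) ≤ 2 * c
      -- If no round was run, then `n * ε² ≤ 1`, and the direct computation of all `n` sums is
      -- itself within the cost.
      rcases hI.cost with ⟨rfl, h2⟩ | h2
      · rw [← hI.cnt, h2] at hle ⊢
        have := hc.le_of_le hn0 hτ hε (B := n)
          (by rw [le_div_iff₀ (by positivity)]; simpa using hle) le_rfl
        linarith
      · refine le_trans ?_ h2
        rw [le_div_iff₀ (by positivity)]
        exact hle
    · have h1 := hI.time
      have ht2 : ((s₁.tick ((BExpr.not (.realLe (.mul (rVar 15)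
          (.mul (rVar 21) (rVar 21))) (rVar 13))).size + 1)).time : ℝ) = s₁.time + 17 := by
        simp only [State.tick, BExpr.size, RExpr.size, NExpr.size, rVar]; push_cast; ring
      rw [ht2]
      have h3 : L / ε ^ 2 * (2 ^ t - 1) ≤ L * (2 * c) := by
        rcases hI.cost with ⟨rfl, _⟩ | h2
        · simp only [pow_zero, sub_self, mul_zero]
          have : 0 ≤ c := by linarith
          positivity
        · have e : L / ε ^ 2 * (2 ^ t - 1) = L * (2 ^ t / ε ^ 2) - L / ε ^ 2 := by ring
          rw [e]
          have : 0 ≤ L / ε ^ 2 := by positivity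
          have := mul_le_mul_of_nonneg_left h2 hL0
          linarith
      have e3 : L * (2 * c) = (16 * C₀ + 1280) * (n * d) * c := by rw [hL]; ring
      rw [e3] at h3
      linarith

theorem kdeExact_spec (hFn : n + 1 ≤ F) (hFd : d + 1 ≤ F) {s : State 𝒦.DS}
    (h : KDEReady n d x y w ε τ s) {k : ℕ} (hk : k < n) (h10 : s.nat 10 0 0 = k) :
    Good 𝒦 F kdeExact s (fun s' => Frame [11, 12] [11, 14] s s' ∧
      s'.real 14 0 0 = expSum n d x w (y k) ∧
      (s'.time : ℝ) ≤ s.time + (n + 1) * (d + 1) * 150) 0 := by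
  unfold kdeExact
  refine Good.seq_left Good.setR_frame fun s₁ ⟨hf1, hv1, ht1⟩ => ?_
  have hready : ∀ {s' : State 𝒦.DS}, Frame [11, 12] [11, 14] s s' →
      KDEReady n d x y w ε τ s' ∧ s'.nat 10 0 0 = k := fun {s'} hf =>
    ⟨h.of_eq (hf.nat 0 (by simp)) fun a ha => hf.real a (by simp at ha ⊢; omega),
      by rw [hf.nat 10 (by simp), h10]⟩
  have hf1' : Frame [11, 12] [11, 14] s s₁ := hf1.mono
  refine (Good.forLoop_real (ln := [12]) (lr := [11, 14])
    (fun j R => R 14 0 0 = ∑ j ∈ Finset.range j,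
      Real.exp (∑ l ∈ Finset.range d, x j l * y k l + w j)) n (fun _ => (d + 1) * 100)
    (fun s' hs' => (hready (hf1'.trans hs'.mono)).1.toHasDims.rowsE) (by simp) hFn
    (by rw [hv1]; simp [RExpr.eval, NExpr.eval]) fun j hj s₂ hs₂ hc2 hJ => ?_).mono
      fun s' ⟨hf', hv', ht'⟩ => ⟨hf1'.trans hf', hv', ?_⟩
  · have hf2' : Frame [11, 12] [11, 14] s s₂ := hf1'.trans hs₂
    refine Good.seq_left (Good.sumLoop d (fun l => x j l * y k l)
      (fun s' hs' => (hready (hf2'.trans hs'.mono)).1.toHasDims.colsE) hFd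
      fun l hl s' hs' hc' => ?_) fun s₃ ⟨hf3, hv3, ht3⟩ =>
        Good.setR_frame.mono fun s₄ ⟨hf4, hv4, ht4⟩ => ?_
    · obtain ⟨hr, hk'⟩ := hready (hf2'.trans hs'.mono)
      have hj' : s'.nat 11 0 0 = j := by rw [hs'.nat 11 (by simp), hc2]
      simp [RExpr.eval, NExpr.eval, nVar, hj', hc', hk', hr.pts j hj l hl, hr.qrs k hk l hl]
    · obtain ⟨hr, hk'⟩ := hready (hf2'.trans hf3.mono)
      have hj' : s₃.nat 11 0 0 = j := by rw [hf3.nat 11 (by simp), hc2]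
      refine ⟨hf3.mono.trans hf4.mono, ?_, ?_⟩
      · rw [hv4, Finset.sum_range_succ, ← hJ]
        simp [RExpr.eval, NExpr.eval, nVar, rVar, hj', hv3, hr.wts j hj, hf3.real 14]
      · rw [ht4]
        simp only [NExpr.size, RExpr.size, nVar, rVar, colsE] at ht3 ⊢
        push_cast at ht3 ⊢
        have : (0 : ℝ) ≤ d := Nat.cast_nonneg _
        linarith
  · rw [ht1] at ht'
    simp only [NExpr.size, RExpr.size, rowsE, Finset.sum_const, Finset.card_range,
      nsmul_eq_mul] at ht'
    push_cast at ht'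
    have h1 : (0 : ℝ) ≤ d := Nat.cast_nonneg _
    have h2 : (0 : ℝ) ≤ n := Nat.cast_nonneg _
    have h3 : (0 : ℝ) ≤ n * d := by positivity
    nlinarith

/-- An exponential sum is its density times `n`, the mass and `exp(‖yᵢ‖²/2)`, and such a rescaling
keeps relative errors. Missing sums are computed exactly, so only they pay `O(nd)` each. -/
theorem kdeFinish_spec (hn : 0 < n) (hε : 0 < ε) (hFn : n + 1 ≤ F) (hFd : d + 1 ≤ F)
    {s : State 𝒦.DS} (h : KDEReady n d x y w ε τ s)
    (hest : ∀ i < n, s.real 10 i 0 ≤ 0 ∨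
        |s.real 10 i 0 - kdeDensity n d x y w i| ≤ ε * kdeDensity n d x y w i) :
    Good 𝒦 F kdeFinish s (fun s' => Frame [10, 11, 12] [11, 14, 22] s s' ∧
      (∀ i < n, |s'.real 22 i 0 - expSum n d x w (y i)| ≤ ε * expSum n d x w (y i)) ∧
      (s'.time : ℝ) ≤ s.time + ((((Finset.range n).filter fun i => s.real 10 i 0 ≤ 0).card : ℝ) *
        ((n + 1) * (d + 1) * 150) + (n + 1) * 100)) 0 := by
  unfold kdeFinish
  have hready : ∀ {s' : State 𝒦.DS}, Frame [10, 11, 12] [11, 14, 22] s s' →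
      KDEReady n d x y w ε τ s' := fun {s'} hf =>
    h.of_eq (hf.nat 0 (by simp)) fun a ha => hf.real a (by simp at ha ⊢; omega)
  set B : ℝ := (n + 1) * (d + 1) * 150 with hB
  have hB0 : 0 ≤ B := by positivity
  refine (Good.forLoop_real (ln := [11, 12]) (lr := [11, 14, 22])
    (fun k R => ∀ i < k, |R 22 i 0 - expSum n d x w (y i)| ≤ ε * expSum n d x w (y i)) n
    (fun k => (if s.real 10 k 0 ≤ 0 then B else 0) + 50)
    (fun s' hs' => (hready hs').toHasDims.rowsE) (by simp) hFn (by simp)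
    fun k hk s₁ hs₁ hc1 hJ => ?_).mono fun s' ⟨hf', hv', ht'⟩ => ⟨hf', hv', ?_⟩
  · have hr1 := hready hs₁
    have h10 : s₁.real 10 k 0 = s.real 10 k 0 := by rw [hs₁.real 10 (by simp)]
    have hb : (BExpr.realLe (.cell 10 (nVar 10) (.const 0)) (.const 0)).Holds s₁ ↔
        s.real 10 k 0 ≤ 0 := by
      simp [BExpr.Holds, RExpr.eval, NExpr.eval, nVar, hc1, h10]
    set s₂ := s₁.tick ((BExpr.realLe (.cell 10 (nVar 10) (.const 0)) (.const 0)).size + 1) with hs₂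
    have ht2 : (s₂.time : ℝ) = s₁.time + 8 := by
      simp only [hs₂, State.tick, BExpr.size, RExpr.size, NExpr.size, nVar]; push_cast; ring
    have hf2 : Frame [] [] s₁ s₂ := ⟨fun _ _ => rfl, fun _ _ => rfl, rfl⟩
    have hr2 : KDEReady n d x y w ε τ s₂ := hr1.of_eq rfl fun _ _ => rfl
    have hc2 : s₂.nat 10 0 0 = k := hc1
    refine Good.ite (fun hle => ?_) (fun hle => ?_)
    · rw [hb] at hle
      refine Good.seq_left (kdeExact_spec hFn hFd hr2 hk hc2) fun s₃ ⟨hf3, hv3, ht3⟩ =>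
        Good.setR_frame.mono fun s₄ ⟨hf4, hv4, ht4⟩ => ?_
      have hc3 : s₃.nat 10 0 0 = k := by rw [hf3.nat 10 (by simp), hc2]
      refine ⟨(hf2.mono.trans hf3.mono).trans hf4.mono, fun i hi => ?_, ?_⟩
      · rw [hv4]
        simp only [nVar, rVar, NExpr.eval, RExpr.eval, hc3, and_true]
        split_ifs with hik
        · rw [hv3, hik, sub_self, abs_zero]
          exact mul_nonneg hε.le (expSum_pos hn).le
        · rw [hf3.real 22 (by simp)]
          exact hJ i (by omega)
      · rw [ht4, if_pos hle]
        simp only [NExpr.size, RExpr.size, nVar, rVar]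
        push_cast
        linarith
    · rw [hb] at hle
      rw [← hs₂]
      refine Good.setR_frame.mono fun s₄ ⟨hf4, hv4, ht4⟩ => ?_
      refine ⟨hf2.mono.trans hf4.mono, fun i hi => ?_, ?_⟩
      · rw [hv4]
        simp only [nVar, rVar, NExpr.eval, RExpr.eval, hc2, and_true]
        split_ifs with hik
        · rw [hik]
          have hd := (hest k hk).resolve_left hle
          have e10 : s₂.real 10 k 0 = s.real 10 k 0 := h10
          rw [e10, hr2.mass, hr2.qnorm k hk, hr2.toHasDims.rowsE]
          have hnR : (0 : ℝ) < n := Nat.cast_pos.2 hn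
          set m := expMass n d x w * Real.exp (normSq d (y k) / 2) with hm
          have hm0 : 0 < m := mul_pos (expMass_pos hn) (Real.exp_pos _)
          have hE : expSum n d x w (y k) = n * kdeDensity n d x y w k * m := by
            rw [← expRatio_mul hn, kdeDensity, mul_div_cancel₀ _ hnR.ne']
          rw [hE]
          have e1 : (n : ℝ) * s.real 10 k 0 * (expMass n d x w *
              Real.exp (normSq d (y k) / (2 : ℚ))) - n * kdeDensity n d x y w k * m =
              n * m * (s.real 10 k 0 - kdeDensity n d x y w k) := by
            rw [hm]; push_cast; ring
          rw [e1, abs_mul, abs_of_pos (mul_pos hnR hm0)]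
          nlinarith [mul_le_mul_of_nonneg_left hd (mul_pos hnR hm0).le]
        · exact hJ i (by omega)
      · rw [ht4, if_neg hle]
        simp only [NExpr.size, RExpr.size, nVar, rVar, rowsE]
        push_cast
        linarith
  · refine ht'.trans ?_
    have e : ∑ k ∈ Finset.range n, ((if s.real 10 k 0 ≤ 0 then B else 0) + 50) =
        (((Finset.range n).filter fun i => s.real 10 i 0 ≤ 0).card : ℝ) * B + n * 50 := by
      rw [Finset.sum_add_distrib, ← Finset.sum_filter]
      simp
    rw [e]
    simp only [NExpr.size, rowsE]
    push_cast
    have h2 : (0 : ℝ) ≤ n := Nat.cast_nonneg _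
    linarith

/-- Correctness and running time of the estimation procedure. -/
theorem kdeProc_spec (hfast : 𝒦.IsFast τ C₀ a) (hn : 2 ≤ n) (hd : 0 < d) (hτ : 0 < τ)
    (hC₀ : 0 < C₀) (hε : 0 < ε) (hε1 : ε < 1) (hFn : n + 1 ≤ F) (hFd : d + 1 ≤ F)
    (hc : IsKDECost n d x y w ε τ c) {s : State 𝒦.DS} (h : KDEArgs n d x y w ε τ s) :
    Good 𝒦 F kdeProc s (fun s' => SameArrays [10, 11, 12]
        [6, 7, 8, 9, 10, 11, 12, 13, 14, 15, 22] s s' ∧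
      (∀ i < n, |s'.real 22 i 0 - expSum n d x w (y i)| ≤ ε * expSum n d x w (y i)) ∧
      (s'.time : ℝ) ≤ s.time + (16 * C₀ + 7000) * (n * d * c))
      (n * (n * ENNReal.ofReal ((n : ℝ) ^ (-a)))) := by
  have hn0 : 0 < n := by omega
  refine Good.seq_left (kdePrep_spec hFn hFd h) fun s₁ ⟨hf1, hr1, h10, h13, h15, ht1⟩ => ?_
  refine Good.seq_right (kdeRounds_spec hfast hn hd hτ hC₀ hε hε1 hFn hc hr1 h10 h13 h15)
    fun s₂ ⟨hf2, hr2, hest, hcard, ht2⟩ => ?_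
  refine (kdeFinish_spec hn0 hε hFn hFd hr2 hest).mono fun s₃ ⟨hf3, hv3, ht3⟩ =>
    ⟨(hf1.same.mono.trans hf2.mono).trans hf3.same.mono, hv3, ?_⟩
  have hn1 : (1 : ℝ) ≤ n := by exact_mod_cast hn0
  have hd1 : (1 : ℝ) ≤ d := by exact_mod_cast hd
  have hc1 : 1 ≤ c := hc.le_of_le hn0 hτ hε
    (by rw [le_div_iff₀ (by positivity)]; have := pow_lt_one₀ hε.le hε1 two_ne_zero; linarith) hn1
  have hnd : ((n : ℝ) + 1) * (d + 1) ≤ 4 * (n * d) := by nlinarith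
  have hndc : (n : ℝ) * d ≤ n * d * c := le_mul_of_one_le_right (by positivity) hc1
  have hn2 : (n : ℝ) ≤ n * d := le_mul_of_one_le_right (by positivity) hd1
  have h4 : (((Finset.range n).filter fun i => s₂.real 10 i 0 ≤ 0).card : ℝ) *
      ((n + 1) * (d + 1) * 150) ≤ 2 * c * (4 * (n * d) * 150) :=
    mul_le_mul hcard (by linarith) (by positivity) (by linarith)
  have e : (16 * C₀ + 7000) * (n * d * c) = (16 * C₀ + 1280) * (n * d) * c +
    5720 * (n * d * c) := by ring
  rw [e]
  nlinarith

end KDE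

end KDEAttention
end

noncomputable section

namespace KDEAttention

open scoped ENNReal

/-! ### Drawing from a table -/

section Draw

theorem andThen_assoc {α : Type} (p : PMF (Option α)) (f g : α → PMF (Option α)) :
    andThen (andThen p f) g = andThen p fun s => andThen (f s) g := by
  unfold andThen
  rw [PMF.bind_bind]
  congr 1
  funext o
  cases o with
  | none => simp
  | some s => rfl

theorem andThen_pure_some {α : Type} (s : α) (g : α → PMF (Option α)) :
    andThen (PMF.pure (some s)) g = g s := by
  unfold andThen
  rw [PMF.pure_bind]
  rfl

/-- The law of total probability: failure bounds are averaged over the drawn value. A bound uniform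
in the value would be too weak, as the conditional failure probability varies with the draw. -/
theorem GoodRun.unif_andThen {α : Type} {T : ℕ} (hT : 0 < T) {f : ℕ → α} {g : α → PMF (Option α)}
    {Q : α → Prop} {δ : ℕ → ℝ≥0∞} (h : ∀ x < T, GoodRun (g (f x)) Q (δ x)) :
    GoodRun (KDEAttention.andThen ((unifBelow T).map fun x => some (f x)) g) Q
      ((∑ x ∈ Finset.range T, δ x) / T) := by
  unfold GoodRun KDEAttention.andThen
  rw [PMF.bind_map, PMF.toOuterMeasure_bind_apply, tsum_eq_sum (s := Finset.range T)]
  · rw [ENNReal.div_eq_inv_mul, Finset.mul_sum]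
    refine Finset.sum_le_sum fun x hx => ?_
    have hu : unifBelow T x = (T : ℝ≥0∞)⁻¹ := by
      unfold unifBelow
      rw [dif_pos hT]
      refine (PMF.uniformOfFinset_apply_of_mem _ hx).trans ?_
      rw [Finset.card_range]
    rw [hu]
    exact mul_le_mul_right (h x (Finset.mem_range.1 hx)) _
  · intro x hx
    have hu : unifBelow T x = 0 := by
      unfold unifBelow
      rw [dif_pos hT]
      exact PMF.uniformOfFinset_apply_of_notMem _ hx
    rw [hu, zero_mul]

variable {𝒦 : KDEPrimitive} {F : ℕ}

/-- The number of samples. -/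
def samplesE : NExpr := .cell 0 (.const 0) (.const 2)

/-- Drawing `m` uniform positions of the table. -/
def drawLoop : Cmd := forLoop 10 samplesE (.unif 5 (nVar 10) (.const 0) (nVar 4))

/-- The bad samples with a given beginning are partitioned by their next coordinate. -/
theorem sum_card_agree {m T k : ℕ} (hk : k < m) (bad : Finset (Fin m → Fin T)) (u : ℕ → ℕ) :
    ∑ x ∈ Finset.range T, (bad.filter fun ω => ∀ r : Fin m, (r : ℕ) < k + 1 →
        (ω r : ℕ) = if (r : ℕ) = k then x else u r).card =
      (bad.filter fun ω => ∀ r : Fin m, (r : ℕ) < k → (ω r : ℕ) = u r).card := by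
  rw [Finset.card_eq_sum_card_fiberwise (f := fun ω : Fin m → Fin T => (ω ⟨k, hk⟩ : ℕ))
    (t := Finset.range T) (fun ω _ => Finset.mem_coe.2 (Finset.mem_range.2 (ω ⟨k, hk⟩).2))]
  refine Finset.sum_congr rfl fun x _ => ?_
  congr 1
  ext ω
  simp only [Finset.mem_filter, and_assoc]
  refine and_congr_right fun _ => ⟨fun h => ⟨fun r hr => ?_, ?_⟩, fun h r hr => ?_⟩
  · have := h r (by omega)
    rwa [if_neg (by omega)] at this
  · simpa using h ⟨k, hk⟩ (by simp)
  · split_ifs with hrk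
    · rw [← h.2]
      congr 2
      exact Fin.ext hrk
    · exact h.1 r (by omega)

/-- The samples avoid a given set, except with the probability of that set. -/
theorem drawLoop_spec {m T : ℕ} (hT : 0 < T) (hF : m + 1 ≤ F) {s : State 𝒦.DS}
    (hm : s.nat 0 0 2 = m) (hT4 : s.nat 4 0 0 = T) (bad : Finset (Fin m → Fin T)) :
    Good 𝒦 F drawLoop s (fun s' => Frame [10, 5] [] s s' ∧
      (∃ ω : Fin m → Fin T, ω ∉ bad ∧ ∀ r : Fin m, s'.nat 5 r 0 = ω r) ∧
      (s'.time : ℝ) ≤ s.time + (m + 1) * 60) ((bad.card : ℝ≥0∞) / (T : ℝ≥0∞) ^ m) := by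
  set b : BExpr := .natLe (.add (.cell 10 (.const 0) (.const 0)) (.const 1)) samplesE with hb
  set Q : State 𝒦.DS → Prop := fun s' => Frame [10, 5] [] s s' ∧
      (∃ ω : Fin m → Fin T, ω ∉ bad ∧ ∀ r : Fin m, s'.nat 5 r 0 = ω r) ∧
      (s'.time : ℝ) ≤ s.time + (m + 1) * 60 with hQ
  set body : Cmd := .seq (.unif 5 (nVar 10) (.const 0) (nVar 4)) (.setN 10 (.const 0) (.const 0)
    (.add (.cell 10 (.const 0) (.const 0)) (.const 1))) with hbody
  -- With `k` draws made and `j` to come, the conditional failure probability is the share of the `T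
  -- ^ j` completions that are bad.
  have key : ∀ j k f (s₁ : State 𝒦.DS), k + j = m → j + 1 ≤ f → Frame [10, 5] [] s s₁ →
      s₁.nat 10 0 0 = k → (∀ r < k, s₁.nat 5 r 0 < T) →
      (s₁.time : ℝ) ≤ s.time + k * 60 + 4 →
      GoodRun (runLoop b (body.run 𝒦 F) f s₁) Q
        (((bad.filter fun ω => ∀ r : Fin m, (r : ℕ) < k → (ω r : ℕ) = s₁.nat 5 r 0).card : ℝ≥0∞) /
          (T : ℝ≥0∞) ^ j) := by
    intro j
    induction j with
    | zero =>
      intro k f s₁ hkj hf hfr hk hlt ht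
      obtain rfl : k = m := by omega
      obtain ⟨f, rfl⟩ : ∃ f', f = f' + 1 := ⟨f - 1, by omega⟩
      have hnb : ¬ b.Holds s₁ := by
        simp only [hb, BExpr.Holds, NExpr.eval, samplesE, hk, hfr.nat 0 (by simp), hm]
        omega
      rw [runLoop, if_neg hnb]
      set ω : Fin k → Fin T := fun r => ⟨s₁.nat 5 r 0, hlt r r.2⟩ with hω
      -- With all draws made the count is `1` or `0`, and a bad sample is paid for by the trivial
      -- bound `1`.
      by_cases hbad : ω ∈ bad
      · refine GoodRun.of_one_le ?_
        rw [pow_zero, div_one, ← Nat.cast_one, Nat.cast_le]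
        exact Finset.card_pos.2 ⟨ω, Finset.mem_filter.2 ⟨hbad, fun r _ => rfl⟩⟩
      · refine GoodRun.pure ⟨⟨hfr.nat, hfr.real, hfr.ds⟩, ⟨ω, hbad, fun r => rfl⟩, ?_⟩
        simp only [hb, State.tick, BExpr.size, NExpr.size, samplesE]
        push_cast
        linarith
    | succ j ih =>
      intro k f s₁ hkj hf hfr hk hlt ht
      obtain ⟨f, rfl⟩ : ∃ f', f = f' + 1 := ⟨f - 1, by omega⟩
      have hbh : b.Holds s₁ := by
        simp only [hb, BExpr.Holds, NExpr.eval, samplesE, hk, hfr.nat 0 (by simp), hm]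
        omega
      rw [runLoop, if_pos hbh]
      simp only [hbody, Cmd.run]
      have h4 : (nVar 4).eval (s₁.tick (b.size + 1)) = T := by
        simp only [nVar, NExpr.eval, State.tick, hfr.nat 4 (by simp), hT4]
      rw [andThen_assoc, h4]
      refine GoodRun.mono (GoodRun.unif_andThen (δ := fun x =>
        (((bad.filter fun ω => ∀ r : Fin m, (r : ℕ) < k + 1 → (ω r : ℕ) =
          if (r : ℕ) = k then x else s₁.nat 5 r 0).card : ℝ≥0∞) / (T : ℝ≥0∞) ^ j)) hT
        fun x hx => ?_) (fun _ h => h) (le_of_eq ?_)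
      · rw [andThen_pure_some]
        have h5 : ∀ r, setCell (setCell s₁.nat 5 k 0 x) 10 0 0 (k + 1) 5 r 0 =
            if r = k then x else s₁.nat 5 r 0 := by
          intro r; simp [setCell]
        set s₂ : State 𝒦.DS := _
        change GoodRun (runLoop b _ f s₂) Q _
        have hnat : s₂.nat = setCell (setCell s₁.nat 5 k 0 x) 10 0 0 (k + 1) := by
          simp only [s₂, State.tick, NExpr.eval, nVar, hk]
          congr 1
          simp [setCell, hk]
        have := ih (k + 1) f s₂ (by omega) (by omega) ⟨fun a ha => ?_, fun a ha => ?_, ?_⟩ ?_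
          (fun r hr => ?_) ?_
        · rw [hnat] at this
          simp only [h5] at this
          exact this
        · have ha2 : a ≠ 10 ∧ a ≠ 5 := by simpa using ha
          rw [hnat, setCell_of_ne _ _ _ _ ha2.1, setCell_of_ne _ _ _ _ ha2.2, hfr.nat a ha]
        · exact hfr.real a ha
        · exact hfr.ds
        · rw [hnat]; simp [setCell]
        · rw [hnat, h5]
          split_ifs with h
          · exact hx
          · exact hlt r (by omega)
        · simp only [s₂, State.tick, BExpr.size, NExpr.size, nVar, hb, samplesE]
          push_cast
          linarith
      · rw [← sum_card_agree (by omega : k < m) bad (fun r => s₁.nat 5 r 0)]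
        push_cast
        simp only [ENNReal.div_eq_inv_mul, ← Finset.mul_sum]
        rw [← mul_assoc, pow_succ, ENNReal.mul_inv (Or.inr (by simp)) (Or.inr (by
          exact_mod_cast hT.ne')), mul_comm ((T : ℝ≥0∞) ^ j)⁻¹]
  refine Good.seq_left Good.setN_frame fun s₁ ⟨hf1, hv1, ht1⟩ => ?_
  have := key m 0 F s₁ (by omega) hF hf1.mono (by rw [hv1]; simp [NExpr.eval]) (by simp) (by
    rw [ht1]; simp only [NExpr.size]; push_cast; linarith)
  have hbad : (bad.filter fun ω => ∀ r : Fin m, (r : ℕ) < 0 → (ω r : ℕ) = s₁.nat 5 r 0) = bad :=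
    Finset.filter_true_of_mem fun _ _ r hr => absurd hr (Nat.not_lt_zero _)
  rw [hbad] at this
  exact this

end Draw

/-! ### Building the table -/

section Table

variable {𝒦 : KDEPrimitive} {F n : ℕ} {u : ℕ → ℝ}

/-- Appends one more copy of the current index to the table. -/
def tableStep : Cmd :=
  .seq (.setN 2 (nVar 4) (.const 0) (nVar 10))
    (.seq (.setN 4 (.const 0) (.const 0) (.add (nVar 4) (.const 1)))
      (.setN 3 (nVar 10) (.const 0) (.add (.cell 3 (nVar 10) (.const 0)) (.const 1))))

/-- The table (natural array `2`) holds each index `i` as often as `⌈n uᵢ⌉`; the multiplicities are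
stored in natural array `3`, the size of the table in natural array `4`. -/
def tableLoop : Cmd :=
  .seq (.setN 4 (.const 0) (.const 0) (.const 0))
    (forLoop 10 rowsE (.seq (.setN 3 (nVar 10) (.const 0) (.const 0))
      (.loop (.not (.realLe (.mul (.ofNat rowsE) (.cell 19 (nVar 10) (.const 0)))
        (.ofNat (.cell 3 (nVar 10) (.const 0))))) tableStep)))

/-- The multiplicities in the table. -/
def tableCount (n : ℕ) (u : ℕ → ℝ) (i : ℕ) : ℕ := ⌈(n : ℝ) * u i⌉₊

/-- The table while the copies of index `k` are appended, `t` of them being there already. -/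
structure TableInv {DS : Type} (n : ℕ) (u : ℕ → ℝ) (k t : ℕ) (s : State DS) : Prop where
  total : s.nat 4 0 0 = ∑ i ∈ Finset.range k, tableCount n u i + t
  counts : ∀ i < k, s.nat 3 i 0 = tableCount n u i
  bound : ∀ p < s.nat 4 0 0, s.nat 2 p 0 ≤ k ∧ (t = 0 → s.nat 2 p 0 < k)
  fibers : ∀ i, ((Finset.range (s.nat 4 0 0)).filter fun p => s.nat 2 p 0 = i).card =
    if i < k then tableCount n u i else if i = k then t else 0

theorem TableInv.of_eq {DS : Type} {k t : ℕ} {s s' : State DS} (h : TableInv n u k t s)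
    (h2 : s'.nat 2 = s.nat 2) (h3 : ∀ i < k, s'.nat 3 i 0 = s.nat 3 i 0)
    (h4 : s'.nat 4 = s.nat 4) : TableInv n u k t s' := by
  refine ⟨?_, fun i hi => ?_, ?_, ?_⟩
  · rw [h4]; exact h.total
  · rw [h3 i hi]; exact h.counts i hi
  · rw [h2, h4]; exact h.bound
  · rw [h2, h4]; exact h.fibers

theorem tableStep_spec {k t : ℕ} {s : State 𝒦.DS} (h : TableInv n u k t s)
    (h10 : s.nat 10 0 0 = k) (h3 : s.nat 3 k 0 = t) :
    Good 𝒦 F tableStep s (fun s' => Frame [2, 3, 4] [] s s' ∧ TableInv n u k (t + 1) s' ∧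
      s'.nat 3 k 0 = t + 1 ∧ (s'.time : ℝ) ≤ s.time + 40) 0 := by
  refine Good.seq_left Good.setN_frame fun s₁ ⟨hf1, hv1, ht1⟩ => Good.seq_left Good.setN_frame
    fun s₂ ⟨hf2, hv2, ht2⟩ => Good.setN_frame.mono fun s₃ ⟨hf3, hv3, ht3⟩ => ?_
  have e4 : s₃.nat 4 0 0 = s.nat 4 0 0 + 1 := by
    rw [hf3.nat 4 (by simp), hv2]
    simp [NExpr.eval, nVar, hf1.nat 4]
  have e2 : ∀ p, s₃.nat 2 p 0 = if p = s.nat 4 0 0 then k else s.nat 2 p 0 := by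
    intro p
    rw [hf3.nat 2 (by simp), hf2.nat 2 (by simp), hv1]
    simp [NExpr.eval, nVar, h10]
  have hc10 : s₂.nat 10 0 0 = k := by rw [hf2.nat 10 (by simp), hf1.nat 10 (by simp), h10]
  have e3 : ∀ i, s₃.nat 3 i 0 = if i = k then t + 1 else s.nat 3 i 0 := by
    intro i
    rw [hv3]
    simp [NExpr.eval, nVar, hc10, hf2.nat 3, hf1.nat 3, h3]
  refine ⟨(hf1.mono.trans hf2.mono).trans hf3.mono, ⟨?_, fun i hi => ?_, fun p hp => ?_,
    fun i => ?_⟩, ?_, ?_⟩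
  · rw [e4, h.total]; ring
  · rw [e3, if_neg (by omega), h.counts i hi]
  · rw [e2]
    refine ⟨?_, by simp⟩
    split_ifs with hp'
    · exact le_rfl
    · exact (h.bound p (by omega)).1
  · have hcard : ((Finset.range (s₃.nat 4 0 0)).filter fun p => s₃.nat 2 p 0 = i).card =
        ((Finset.range (s.nat 4 0 0)).filter fun p => s.nat 2 p 0 = i).card +
          if k = i then 1 else 0 := by
      rw [e4, Finset.range_add_one, Finset.filter_insert]
      have hcongr : (Finset.range (s.nat 4 0 0)).filter (fun p => s₃.nat 2 p 0 = i) =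
          (Finset.range (s.nat 4 0 0)).filter fun p => s.nat 2 p 0 = i := by
        refine Finset.filter_congr fun p hp => ?_
        rw [e2, if_neg (Finset.mem_range.1 hp).ne]
      rw [hcongr, e2, if_pos rfl]
      split_ifs with hki
      · rw [Finset.card_insert_of_notMem (by simp)]
      · simp
    rw [hcard, h.fibers i]
    split_ifs <;> omega
  · rw [e3, if_pos rfl]
  · rw [ht3, ht2, ht1]
    simp only [NExpr.size, nVar]
    push_cast
    linarith

/-- Copies of an index are appended until their number reaches `n * u i`. The first such number is
the ceiling, so real comparisons suffice to round. -/
theorem tableLoop_spec {d : ℕ} (hFn : n + 1 ≤ F) (hFu : ∀ i < n, tableCount n u i + 1 ≤ F)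
    {s : State 𝒦.DS} (h : HasDims n d s) (hu : ∀ i < n, s.real 19 i 0 = u i) :
    Good 𝒦 F tableLoop s (fun s' => Frame [2, 3, 4, 10] [] s s' ∧ TableInv n u n 0 s' ∧
      (s'.time : ℝ) ≤ s.time +
        ((∑ i ∈ Finset.range n, (tableCount n u i : ℝ)) * 100 + (n + 1) * 100)) 0 := by
  refine Good.seq_left Good.setN_frame fun s₁ ⟨hf1, hv1, ht1⟩ => ?_
  have hloop := Good.forLoop (𝒦 := 𝒦) (F := F) (a := 10) (bound := rowsE)
    (body := .seq (.setN 3 (nVar 10) (.const 0) (.const 0))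
      (.loop (.not (.realLe (.mul (.ofNat rowsE) (.cell 19 (nVar 10) (.const 0)))
        (.ofNat (.cell 3 (nVar 10) (.const 0))))) tableStep)) (s₀ := s₁)
    (ln := [2, 3, 4]) (lr := []) (δ := 0)
    (fun k s => TableInv n u k 0 s) n (fun k => tableCount n u k * 100 + 50)
    (fun k s s' h1 _ h3 => h3.of_eq (h1 2 (by norm_num)) (fun i _ => by rw [h1 3 (by norm_num)])
      (h1 4 (by norm_num)))
    (fun s' hs' => (h.of_eq (by rw [hs'.nat 0 (by simp), hf1.nat 0 (by simp)])).rowsE) (by simp)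
    hFn ?_ fun k hk s₂ hs₂ hc2 hJ => ?_
  · rw [mul_zero] at hloop
    refine hloop.mono fun s' ⟨hf', hv', ht'⟩ => ⟨hf1.mono.trans hf'.mono, hv', ht'.trans ?_⟩
    rw [ht1, Finset.sum_add_distrib, ← Finset.sum_mul]
    simp only [NExpr.size, rowsE, Finset.sum_const, Finset.card_range, nsmul_eq_mul]
    push_cast
    have : (0 : ℝ) ≤ n := Nat.cast_nonneg _
    linarith
  · have h0 : s₁.nat 4 0 0 = 0 := by rw [hv1]; simp [NExpr.eval]
    exact ⟨by simp [h0], by simp, by simp [h0], by simp [h0]⟩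
  · refine Good.seq_left Good.setN_frame fun s₃ ⟨hf3, hv3, ht3⟩ => ?_
    have hc3 : s₃.nat 10 0 0 = k := by rw [hf3.nat 10 (by simp), hc2]
    have e3 : ∀ i, s₃.nat 3 i 0 = if i = k then 0 else s₂.nat 3 i 0 := by
      intro i
      rw [hv3]
      simp [NExpr.eval, nVar, hc2]
    set I : ℕ → State 𝒦.DS → Prop := fun t s' => Frame [2, 3, 4] [] s₃ s' ∧
      TableInv n u k t s' ∧ s'.nat 3 k 0 = t ∧ t ≤ tableCount n u k ∧
      (s'.time : ℝ) ≤ s₃.time + t * 100 with hI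
    have hholds : ∀ {t : ℕ} {s' : State 𝒦.DS}, I t s' →
        ((BExpr.not (.realLe (.mul (.ofNat rowsE) (.cell 19 (nVar 10) (.const 0)))
          (.ofNat (.cell 3 (nVar 10) (.const 0))))).Holds s' ↔ (t : ℝ) < n * u k) := by
      intro t s' hI'
      have d0 : HasDims n d s' := h.of_eq (by
        rw [hI'.1.nat 0 (by simp), hf3.nat 0 (by simp), hs₂.nat 0 (by simp), hf1.nat 0 (by simp)])
      have d1 : s'.real 19 k 0 = u k := by
        rw [hI'.1.real 19 (by simp), hf3.real 19 (by simp), hs₂.real 19 (by simp),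
          hf1.real 19 (by simp), hu k hk]
      have d2 : s'.nat 10 0 0 = k := by rw [hI'.1.nat 10 (by simp), hc3]
      simp only [BExpr.Holds, RExpr.eval, NExpr.eval, nVar, d2, d1, d0.rowsE, hI'.2.2.1, not_le]
    have hstep : ∀ t < tableCount n u k, ∀ s' : State 𝒦.DS, I t s' →
        (BExpr.not (.realLe (.mul (.ofNat rowsE) (.cell 19 (nVar 10) (.const 0)))
          (.ofNat (.cell 3 (nVar 10) (.const 0))))).Holds s' →
        Good 𝒦 F tableStep (s'.tick ((BExpr.not (.realLe (.mul (.ofNat rowsE)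
          (.cell 19 (nVar 10) (.const 0))) (.ofNat (.cell 3 (nVar 10) (.const 0))))).size + 1))
          (I (t + 1)) 0 := by
      intro t ht s' hI' _
      obtain ⟨i1, i2, i3, i4, i5⟩ := hI'
      generalize hz : (BExpr.not (.realLe (.mul (.ofNat rowsE)
          (.cell 19 (nVar 10) (.const 0))) (.ofNat (.cell 3 (nVar 10) (.const 0))))).size + 1 = z
      have hz' : z ≤ 30 := by
        rw [← hz]
        simp only [BExpr.size, RExpr.size, NExpr.size, nVar, rowsE]
        norm_num
      have g1 : TableInv n u k t (s'.tick z) := i2.of_eq rfl (fun _ _ => rfl) rfl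
      have g2 : (s'.tick z).nat 10 0 0 = k := by
        change s'.nat 10 0 0 = k
        rw [i1.nat 10 (by simp), hc3]
      refine (tableStep_spec g1 g2 i3).mono fun s₄ hs₄ => ?_
      obtain ⟨j1, j2, j3, j4⟩ := hs₄
      refine ⟨i1.trans ⟨j1.nat, j1.real, j1.ds⟩, j2, j3, ht, ?_⟩
      have hz2 : (z : ℝ) ≤ 30 := by exact_mod_cast hz'
      simp only [State.tick] at j4
      push_cast at j4 ⊢
      linarith
    have hl := Good.loop (𝒦 := 𝒦) (F := F) (c := tableStep) (δ := 0) I (tableCount n u k)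
      (s := s₃) (hFu k hk) ⟨Frame.refl _, hJ.of_eq (hf3.nat 2 (by simp))
        (fun i hi => by rw [e3, if_neg (by omega)]) (hf3.nat 4 (by simp)), by rw [e3, if_pos rfl],
        Nat.zero_le _, by simp⟩
      (b := .not (.realLe (.mul (.ofNat rowsE) (.cell 19 (nVar 10) (.const 0)))
        (.ofNat (.cell 3 (nVar 10) (.const 0)))))
      (fun s' hI' => by
        rw [hholds hI', not_lt]
        exact Nat.le_ceil _)
      hstep
    rw [mul_zero] at hl
    refine hl.mono fun s' ⟨t, ht, s₄, hI', hb, hs'⟩ => ?_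
    have hle := not_lt.1 ((hholds hI').not.1 hb)
    -- The invariant gives at most the ceiling, the failed test at least.
    have htk : t = tableCount n u k := le_antisymm ht (Nat.ceil_le.2 hle)
    obtain ⟨i1, i2, i3, i4, i5⟩ := hI'
    subst hs'
    refine ⟨hf3.mono.trans ⟨i1.nat, i1.real, i1.ds⟩, ⟨?_, fun i hi => ?_, fun p hp => ?_,
      fun i => ?_⟩, ?_⟩
    · rw [Finset.sum_range_succ, add_zero, ← htk]
      exact i2.total
    · rcases Nat.lt_succ_iff_lt_or_eq.1 hi with hi' | rfl
      · exact i2.counts i hi'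
      · rw [← htk]; exact i3
    · have := (i2.bound p hp).1
      exact ⟨this.trans (Nat.le_succ k), fun _ => Nat.lt_succ_of_le this⟩
    · refine (i2.fibers i).trans ?_
      rcases lt_trichotomy i k with h1 | h1 | h1
      · rw [if_pos h1, if_pos (by omega)]
      · rw [if_neg (by omega), if_pos h1, if_pos (by omega), htk, h1]
      · rw [if_neg (by omega), if_neg (by omega), if_neg (by omega)]
        split_ifs <;> rfl
    · rw [ht3] at i5
      rw [htk] at i5
      simp only [State.tick, BExpr.size, RExpr.size, NExpr.size, nVar, rowsE] at i5 ⊢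
      push_cast at i5 ⊢
      linarith

end Table

end KDEAttention
end

noncomputable section

namespace KDEAttention

open scoped ENNReal

/-! ### Exponential sums of matrices -/

section Entries

variable {n d : ℕ}

theorem entry_apply (M : Matrix (Fin n) (Fin d) ℝ) (i : Fin n) (j : Fin d) :
    entry M i j = M i j := by
  simp [entry]

theorem entry_smul (c : ℝ) (M : Matrix (Fin n) (Fin d) ℝ) (i j : ℕ) :
    entry (c • M) i j = c * entry M i j := by
  unfold entry
  split_ifs <;> simp

theorem sum_range_entry_mul (X Y : Matrix (Fin n) (Fin d) ℝ) (i j : Fin n) :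
    ∑ l ∈ Finset.range d, entry X i l * entry Y j l = X i ⬝ᵥ Y j := by
  rw [Finset.sum_range]
  exact Finset.sum_congr rfl fun l _ => by rw [entry_apply, entry_apply]

theorem expSum_entry (X Y : Matrix (Fin n) (Fin d) ℝ) (w : ℕ → ℝ) (i : Fin n) :
    expSum n d (entry X) w (entry Y i) =
      ∑ j : Fin n, Real.exp (w j) * Real.exp (X j ⬝ᵥ Y i) := by
  unfold expSum
  rw [Finset.sum_range]
  refine Finset.sum_congr rfl fun j _ => ?_
  rw [sum_range_entry_mul, Real.exp_add, mul_comm]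

theorem expRatio_entry (X Y : Matrix (Fin n) (Fin d) ℝ) (w : ℕ → ℝ) (i : Fin n) :
    expRatio n d (entry X) w (entry Y i) = (∑ j : Fin n, Real.exp (w j) * Real.exp (X j ⬝ᵥ Y i)) /
      ∑ j : Fin n, Real.exp (w j) * Real.exp ((X j ⬝ᵥ X j + Y i ⬝ᵥ Y i) / 2) := by
  unfold expRatio
  rw [expSum_entry]
  congr 1
  unfold expMass normSq
  rw [Finset.sum_range, Finset.sum_mul]
  refine Finset.sum_congr rfl fun j _ => ?_
  rw [sum_range_entry_mul, sum_range_entry_mul, ← Real.exp_add, ← Real.exp_add]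
  congr 1
  ring

/-- This connects the analysis of the procedure, written for functions on `ℕ` and logarithmic
weights, with the infimum in the theorem: the ratio of each point is the quotient counted there. -/
theorem isKDECost_kdeCost (X Y : Matrix (Fin n) (Fin d) ℝ) (w : ℕ → ℝ) (ε τ : ℝ) :
    IsKDECost n d (entry X) (entry Y) w ε τ (kdeCost X Y (fun j => Real.exp (w j)) ε τ) := by
  classical
  intro B hB
  refine le_kdeCost fun μ hμ => (hB μ hμ).trans (le_of_eq ?_)
  congr 2
  rw [← Finset.card_map Fin.valEmbedding]
  congr 1
  ext i
  simp only [Finset.mem_filter, Finset.mem_range, Finset.mem_map, Finset.mem_univ, true_and,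
    Fin.valEmbedding_apply]
  constructor
  · rintro ⟨hi, h⟩
    exact ⟨⟨i, hi⟩, by rw [← expRatio_entry]; exact h, rfl⟩
  · rintro ⟨i, h, rfl⟩
    exact ⟨i.2, by rw [expRatio_entry]; exact h⟩

theorem inv_rpow_quarter (d : ℕ) : ((d : ℝ) ^ (1 / 4 : ℝ))⁻¹ = 1 / Real.sqrt (Real.sqrt d) := by
  rw [one_div, Real.sqrt_eq_rpow, Real.sqrt_eq_rpow, ← Real.rpow_mul (Nat.cast_nonneg _)]
  norm_num

theorem smul_row_dotProduct (c : ℝ) (X Y : Matrix (Fin n) (Fin d) ℝ) (i j : Fin n) :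
    (c • X) i ⬝ᵥ (c • Y) j = c * c * (X i ⬝ᵥ Y j) := by
  change (c • X i) ⬝ᵥ (c • Y j) = _
  rw [smul_dotProduct, dotProduct_smul, smul_eq_mul, smul_eq_mul, mul_assoc]

theorem rescale_dotProduct (X Y : Matrix (Fin n) (Fin d) ℝ) (i j : Fin n) :
    rescale X i ⬝ᵥ rescale Y j = X i ⬝ᵥ Y j / Real.sqrt d := by
  have h : 1 / Real.sqrt (Real.sqrt d) * (1 / Real.sqrt (Real.sqrt d)) = 1 / Real.sqrt d := by
    rw [div_mul_div_comm, one_mul, Real.mul_self_sqrt (Real.sqrt_nonneg _)]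
  unfold rescale
  rw [smul_row_dotProduct, inv_rpow_quarter, h]
  ring

theorem expSum_rescale (Q K : Matrix (Fin n) (Fin d) ℝ) (i : Fin n) :
    expSum n d (entry (rescale K)) (fun _ => 0) (entry (rescale Q) i) = attnRowSum Q K i := by
  rw [expSum_entry, attnRowSum]
  refine Finset.sum_congr rfl fun j _ => ?_
  rw [rescale_dotProduct, Real.exp_zero, one_mul, dotProduct_comm]

/-- Scaling points and queries by `√2` doubles the exponents and so squares the attention entries.
With inverse squared row sums as weights this is a squared column norm of the softmax matrix. -/
theorem expSum_sqrt_two_rescale (Q K : Matrix (Fin n) (Fin d) ℝ) (w : ℕ → ℝ) (i : Fin n) :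
    expSum n d (entry (Real.sqrt 2 • rescale Q)) w (entry (Real.sqrt 2 • rescale K) i) =
      ∑ j : Fin n, Real.exp (w j) * Real.exp (Q j ⬝ᵥ K i / Real.sqrt d) ^ 2 := by
  rw [expSum_entry]
  refine Finset.sum_congr rfl fun j _ => ?_
  have h : (Real.sqrt 2 • rescale Q) j ⬝ᵥ (Real.sqrt 2 • rescale K) i =
      2 * (Q j ⬝ᵥ K i / Real.sqrt d) := by
    rw [smul_row_dotProduct, rescale_dotProduct, Real.mul_self_sqrt (by norm_num)]
  rw [h, two_mul, Real.exp_add, sq]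

/-- Reading and preprocessing cost of order `n * d` is absorbed into the running time bound through
this. -/
theorem one_le_kdeCost_one (hn : 0 < n) {τ : ℝ} (hτ : 0 < τ) (X Y : Matrix (Fin n) (Fin d) ℝ)
    {v : Fin n → ℝ} (hv : ∀ j, 0 < v j) : 1 ≤ kdeCost X Y v 1 τ := by
  have h := (isKDECost_kdeCost X Y (fun j => if h : j < n then Real.log (v ⟨j, h⟩) else 0)
    1 τ).le_of_le hn hτ one_pos (B := 1) (by norm_num) (by exact_mod_cast hn)
  have hw : (fun j : Fin n => Real.exp (if h : (j : ℕ) < n then Real.log (v ⟨j, h⟩) else 0)) = v := by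
    funext j
    rw [dif_pos j.2, Real.exp_log (hv _)]
  rwa [hw] at h

end Entries

/-! ### Sampling probabilities -/

section Probabilities

variable {n d : ℕ}

/-- Dominance of normalized weights under multiplicative approximation. -/
theorem div_sum_le_of_approx {ι : Type*} [Fintype ι] {f g : ι → ℝ} {α β : ℝ} (hα : 0 < α)
    (hf : ∀ i, 0 < f i) (h1 : ∀ i, α * f i ≤ g i) (h2 : ∀ i, g i ≤ β * f i) (i : ι) :
    f i / ∑ j, f j ≤ β / α * (g i / ∑ j, g j) := by
  have hs : 0 < ∑ j, f j := Finset.sum_pos (fun j _ => hf j) ⟨i, Finset.mem_univ _⟩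
  have hg : ∀ i, 0 < g i := fun i => lt_of_lt_of_le (mul_pos hα (hf i)) (h1 i)
  have hgs : 0 < ∑ j, g j := Finset.sum_pos (fun j _ => hg j) ⟨i, Finset.mem_univ _⟩
  have h3 : ∑ j, g j ≤ β * ∑ j, f j := by
    rw [Finset.mul_sum]; exact Finset.sum_le_sum fun j _ => h2 j
  rw [div_mul_div_comm, div_le_div_iff₀ hs (by positivity)]
  calc f i * (α * ∑ j, g j) = (α * f i) * ∑ j, g j := by ring
    _ ≤ g i * (β * ∑ j, f j) := by
      refine mul_le_mul (h1 i) h3 hgs.le (hg i).le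
    _ = β * g i * ∑ j, f j := by ring

/-- The constants are `(5/4)⁻² = 16/25` and `(3/4)⁻² = 16/9`. -/
theorem inv_sq_approx {x y : ℝ} (hy : 0 < y) (h : |x - y| ≤ 1 / 4 * y) :
    16 / 25 * (y ^ 2)⁻¹ ≤ (x ^ 2)⁻¹ ∧ (x ^ 2)⁻¹ ≤ 16 / 9 * (y ^ 2)⁻¹ := by
  have h1 := abs_le.1 h
  have hx : 0 < x := by linarith
  constructor
  · rw [show (16 / 25 : ℝ) * (y ^ 2)⁻¹ = ((5 / 4 * y) ^ 2)⁻¹ by rw [mul_pow, mul_inv]; norm_num]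
    exact inv_anti₀ (by positivity) (pow_le_pow_left₀ hx.le (by linarith) 2)
  · rw [show (16 / 9 : ℝ) * (y ^ 2)⁻¹ = ((3 / 4 * y) ^ 2)⁻¹ by rw [mul_pow, mul_inv]; norm_num]
    exact inv_anti₀ (by positivity) (pow_le_pow_left₀ (by positivity) (by linarith) 2)

/-- The column norms of the softmax matrix are approximated by means of an approximate scaling. -/
theorem softmax_col_approx (hn : 0 < n) (Q K : Matrix (Fin n) (Fin d) ℝ) {v : Fin n → ℝ}
    (hv : ∀ i, |v i - attnRowSum Q K i| ≤ 1 / 4 * attnRowSum Q K i) (i : Fin n) {α : ℝ}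
    (hα : |α - ∑ j, ((v j) ^ 2)⁻¹ * Real.exp (Q j ⬝ᵥ K i / Real.sqrt d) ^ 2| ≤
      1 / 2 * ∑ j, ((v j) ^ 2)⁻¹ * Real.exp (Q j ⬝ᵥ K i / Real.sqrt d) ^ 2) :
    8 / 25 * ∑ j, softmaxMatrix Q K j i ^ 2 ≤ α ∧ α ≤ 8 / 3 * ∑ j, softmaxMatrix Q K j i ^ 2 := by
  set b := ∑ j, ((v j) ^ 2)⁻¹ * Real.exp (Q j ⬝ᵥ K i / Real.sqrt d) ^ 2 with hb
  have key := fun j => inv_sq_approx (attnRowSum_pos hn Q K j) (hv j)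
  have hsm : ∀ j, softmaxMatrix Q K j i ^ 2 =
      ((attnRowSum Q K j) ^ 2)⁻¹ * Real.exp (Q j ⬝ᵥ K i / Real.sqrt d) ^ 2 := fun j => by
    rw [softmaxMatrix_apply hn, div_pow]; ring
  have h1 : 16 / 25 * ∑ j, softmaxMatrix Q K j i ^ 2 ≤ b := by
    rw [Finset.mul_sum]
    refine Finset.sum_le_sum fun j _ => ?_
    rw [hsm, ← mul_assoc]
    exact mul_le_mul_of_nonneg_right (key j).1 (sq_nonneg _)
  have h2 : b ≤ 16 / 9 * ∑ j, softmaxMatrix Q K j i ^ 2 := by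
    rw [Finset.mul_sum]
    refine Finset.sum_le_sum fun j _ => ?_
    rw [hsm, ← mul_assoc]
    exact mul_le_mul_of_nonneg_right (key j).2 (sq_nonneg _)
  have h3 := abs_le.1 hα
  constructor <;> linarith

theorem frobSq_eq_sum_col {m n : ℕ} (A : Matrix (Fin m) (Fin n) ℝ) :
    frobSq A = ∑ i, ∑ j, A j i ^ 2 := Finset.sum_comm

/-- The sum of the leverage of the `i`-th column and the `i`-th row, against approximations. -/
theorem leverage_le {P : Matrix (Fin n) (Fin n) ℝ} {V : Matrix (Fin n) (Fin d) ℝ} {α : Fin n → ℝ}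
    (hP : ∀ i, 0 < ∑ j, P j i ^ 2)
    (h1 : ∀ i, 8 / 25 * ∑ j, P j i ^ 2 ≤ α i) (h2 : ∀ i, α i ≤ 8 / 3 * ∑ j, P j i ^ 2) (i : Fin n) :
    (∑ j, P j i ^ 2) / opNorm P ^ 2 + (∑ j, V i j ^ 2) / opNorm V ^ 2 ≤
      9 * (srank P + srank V) * (α i / ∑ k, α k + (∑ j, V i j ^ 2) / frobSq V) := by
  have hα : ∀ i, 0 ≤ α i := fun i => le_trans (by have := hP i; positivity) (h1 i)
  have ha : 0 ≤ α i / ∑ k, α k := div_nonneg (hα i) (Finset.sum_nonneg fun k _ => hα k)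
  have hF : 0 ≤ frobSq V := Finset.sum_nonneg fun _ _ => Finset.sum_nonneg fun _ _ => sq_nonneg _
  have hb : 0 ≤ (∑ j, V i j ^ 2) / frobSq V :=
    div_nonneg (Finset.sum_nonneg fun _ _ => sq_nonneg _) hF
  have hFP : 0 < frobSq P := by
    rw [frobSq_eq_sum_col]
    exact Finset.sum_pos (fun i _ => hP i) ⟨i, Finset.mem_univ _⟩
  -- Here `25/3` is the quotient of the approximation constants `8/3` and `8/25`; it is rounded up
  -- to `9` at the end.
  have hc1 : (∑ j, P j i ^ 2) / opNorm P ^ 2 ≤ 25 / 3 * srank P * (α i / ∑ k, α k) := by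
    have := div_sum_le_of_approx (by norm_num) hP h1 h2 i
    rw [← frobSq_eq_sum_col] at this
    have h3 : (∑ j, P j i ^ 2) / opNorm P ^ 2 = srank P * ((∑ j, P j i ^ 2) / frobSq P) := by
      unfold srank
      rw [div_mul_div_comm, mul_comm (frobSq P), mul_div_mul_right _ _ hFP.ne']
    rw [h3]
    have h4 := mul_le_mul_of_nonneg_left this (srank_nonneg P)
    refine h4.trans (le_of_eq ?_)
    ring
  have hc2 : (∑ j, V i j ^ 2) / opNorm V ^ 2 ≤ srank V * ((∑ j, V i j ^ 2) / frobSq V) := by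
    -- For `V = 0` both sides vanish, with `0 / 0 = 0`.
    rcases hF.eq_or_lt with h0 | h0
    · have : ∑ j, V i j ^ 2 ≤ frobSq V := Finset.single_le_sum (f := fun i => ∑ j, V i j ^ 2)
        (fun _ _ => Finset.sum_nonneg fun _ _ => sq_nonneg _) (Finset.mem_univ i)
      have h3 : ∑ j, V i j ^ 2 = 0 :=
        le_antisymm (by rw [← h0] at this; exact this) (Finset.sum_nonneg fun _ _ => sq_nonneg _)
      rw [h3]; simp
    · unfold srank
      rw [div_mul_div_comm, mul_comm (frobSq V), mul_div_mul_right _ _ h0.ne']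
  have hsP := srank_nonneg P
  have hsV := srank_nonneg V
  nlinarith [mul_nonneg hsP ha, mul_nonneg hsP hb, mul_nonneg hsV ha, mul_nonneg hsV hb]

/-- Rounding up adds at most one copy per index, hence `2n + n`. The probabilities realized by the
table therefore lose at most a factor `3` against the weights. -/
theorem sum_tableCount_le {u : ℕ → ℝ} (hu : ∀ i < n, 0 ≤ u i)
    (hs : ∑ i ∈ Finset.range n, u i ≤ 2) :
    ((∑ i ∈ Finset.range n, tableCount n u i : ℕ) : ℝ) ≤ 3 * n := by
  push_cast
  have : ∑ i ∈ Finset.range n, (tableCount n u i : ℝ) ≤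
      ∑ i ∈ Finset.range n, (n * u i + 1) := Finset.sum_le_sum fun i hi =>
    (Nat.ceil_lt_add_one (mul_nonneg (Nat.cast_nonneg _) (hu i (Finset.mem_range.1 hi)))).le
  rw [Finset.sum_add_distrib, ← Finset.mul_sum] at this
  simp only [Finset.sum_const, Finset.card_range, nsmul_eq_mul, mul_one] at this
  have hn : (0 : ℝ) ≤ n := Nat.cast_nonneg _
  nlinarith

theorem le_three_mul_tableCount_div {u : ℕ → ℝ} {T : ℕ} {i : ℕ} (hT : 0 < T)
    (hT3 : (T : ℝ) ≤ 3 * n) (hu : 0 ≤ u i) : u i ≤ 3 * ((tableCount n u i : ℝ) / T) := by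
  have hTR : (0 : ℝ) < T := by exact_mod_cast hT
  have h := Nat.le_ceil ((n : ℝ) * u i)
  rw [← mul_div_assoc, le_div_iff₀ hTR]
  unfold tableCount
  nlinarith

end Probabilities

end KDEAttention
end

noncomputable section

namespace KDEAttention

open scoped ENNReal

section Program

variable {𝒦 : KDEPrimitive} {F n d m : ℕ}

/-- The real cell of array `a` in column `0`, in the row given by the main counter. -/
def rowCell (a : ℕ) : RExpr := .cell a (nVar 10) (.const 0)

/-- The real cell of array `a` at the position given by the two counters. -/
def ctrCell (a : ℕ) : RExpr := .cell a (nVar 10) (nVar 11)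

/-! ### Exponential sums of scaled data sets -/

/-- Estimates the exponential sums for the points in array `aX` and the queries in array `aY`, both
scaled by `sc`, with logarithmic weights `wE` and precision `eE`. -/
def densityProc (sc : RExpr) (aX aY : ℕ) (wE eE : RExpr) : Cmd :=
  .seq (fillMatrix 10 11 6 rowsE colsE (.mul sc (ctrCell aX)))
    (.seq (fillMatrix 10 11 7 rowsE colsE (.mul sc (ctrCell aY)))
      (.seq (fillLoop 10 20 (.const 0) rowsE wE)
        (.seq (.setR 21 (.const 0) (.const 0) eE) kdeProc)))

/-- The expressions for scale, weights and precision are evaluated only after some working arrays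
have been overwritten, hence the hypotheses about later states. As `c ≥ 1`, the filling of the
arrays is absorbed into `n * d * c`. -/
theorem densityProc_spec {τ C₀ a ε c σ : ℝ} {x y : ℕ → ℕ → ℝ} {w : ℕ → ℝ} {sc wE eE : RExpr}
    {aX aY : ℕ}
    (hfast : 𝒦.IsFast τ C₀ a) (hn : 2 ≤ n) (hd : 0 < d) (hτ : 0 < τ)
    (hC₀ : 0 < C₀) (hε : 0 < ε) (hε1 : ε < 1) (hFn : n + 1 ≤ F) (hFd : d + 1 ≤ F)
    (hc : IsKDECost n d (fun i l => σ * x i l) (fun i l => σ * y i l) w ε τ c) {s : State 𝒦.DS}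
    (h : HasDims n d s) (h3 : s.real 3 0 1 = τ) (haX : aX ∉ [6, 7]) (haY : aY ∉ [6, 7])
    (hX : ∀ i < n, ∀ l < d, s.real aX i l = x i l) (hY : ∀ i < n, ∀ l < d, s.real aY i l = y i l)
    (hsc : ∀ s' : State 𝒦.DS, s'.nat 0 = s.nat 0 → sc.eval s' = σ)
    (hw : ∀ k < n, ∀ s' : State 𝒦.DS, SameArrays [10, 11] [6, 7, 20] s s' →
      s'.nat 10 0 0 = k → wE.eval s' = w k)
    (he : ∀ s' : State 𝒦.DS, SameArrays [10, 11] [6, 7, 20] s s' → eE.eval s' = ε)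
    (hsz : sc.size + wE.size + eE.size ≤ 100) :
    Good 𝒦 F (densityProc sc aX aY wE eE) s (fun s' =>
      SameArrays [10, 11, 12] [6, 7, 8, 9, 10, 11, 12, 13, 14, 15, 20, 21, 22] s s' ∧
      (∀ i < n, |s'.real 22 i 0 - expSum n d (fun i l => σ * x i l) w (fun l => σ * y i l)| ≤
        ε * expSum n d (fun i l => σ * x i l) w (fun l => σ * y i l)) ∧
      (s'.time : ℝ) ≤ s.time + (16 * C₀ + 10000) * (n * d * c))
      (n * (n * ENNReal.ofReal ((n : ℝ) ^ (-a)))) := by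
  have hX6 : aX ≠ 6 ∧ aX ≠ 7 := by simpa using haX
  have hY6 : aY ≠ 6 ∧ aY ≠ 7 := by simpa using haY
  have dims : ∀ {s' : State 𝒦.DS} {ln lr : List ℕ}, SameArrays ln lr s s' → 0 ∉ ln →
      HasDims n d s' := fun hs' h0 => h.of_eq (hs'.nat 0 h0)
  refine Good.seq_left (Good.fillMatrix n d (by norm_num) (fun i l => σ * x i l)
    (fun s' hs' => (dims hs'.same (by simp)).rowsE) (fun s' hs' => (dims hs'.same (by simp)).colsE)
    hFn hFd fun k hk k' hk' s' hs' hc1 hc2 => ?_) fun s₁ ⟨hf1, hv1, ht1⟩ => ?_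
  · simp only [RExpr.eval, ctrCell, nVar, NExpr.eval, hc1, hc2]
    rw [hsc s' (hs'.nat 0 (by simp)), hs'.real aX (by simpa using hX6.1), hX k hk k' hk']
  have g1 := hf1.same
  refine Good.seq_left (Good.fillMatrix n d (by norm_num) (fun i l => σ * y i l)
    (fun s' hs' => (dims (g1.mono.trans hs'.same.mono (ln := [10, 11]) (lr := [6, 7]))
      (by simp)).rowsE)
    (fun s' hs' => (dims (g1.mono.trans hs'.same.mono (ln := [10, 11]) (lr := [6, 7]))
      (by simp)).colsE)
    hFn hFd fun k hk k' hk' s' hs' hc1 hc2 => ?_) fun s₂ ⟨hf2, hv2, ht2⟩ => ?_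
  · simp only [RExpr.eval, ctrCell, nVar, NExpr.eval, hc1, hc2]
    rw [hsc s' (by rw [hs'.nat 0 (by simp), hf1.nat 0 (by simp)]), hs'.real aY (by simpa using hY6.2),
      hf1.real aY (by simpa using hY6.1), hY k hk k' hk']
  have g2 : SameArrays [10, 11] [6, 7, 20] s s₂ := g1.mono.trans hf2.same.mono
  refine Good.seq_left (Good.fillLoop n 0 w
    (fun s' hs' => (dims (g2.trans hs'.same.mono) (by simp)).rowsE) (fun s' hs' => rfl)
    hFn fun k hk s' hs' _ hc1 => ?_) fun s₃ ⟨hf3, hv3, ht3⟩ => ?_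
  · exact hw k hk s' (g2.trans hs'.same.mono) hc1
  have g3 : SameArrays [10, 11] [6, 7, 20] s s₃ := g2.trans hf3.same.mono
  refine Good.seq_left Good.setR_frame fun s₄ ⟨hf4, hv4, ht4⟩ => ?_
  have g4 : SameArrays [10, 11, 12] [6, 7, 8, 9, 10, 11, 12, 13, 14, 15, 20, 21, 22] s s₄ :=
    g3.mono.trans hf4.same.mono
  refine (kdeProc_spec hfast hn hd hτ hC₀ hε hε1 hFn hFd hc (s := s₄) ⟨dims g4 (by simp),
    fun i hi l hl => ?_, fun i hi l hl => ?_, fun i hi => ?_, ?_, ?_⟩).mono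
      fun s₅ ⟨hf5, hv5, ht5⟩ => ⟨g4.trans hf5.mono, hv5, ?_⟩
  · rw [hf4.real 6 (by simp), hf3.real 6 (by simp), hf2.real 6 (by simp), hv1 i hi l hl]
  · rw [hf4.real 7 (by simp), hf3.real 7 (by simp), hv2 i hi l hl]
  · rw [hf4.real 20 (by simp), hv3.1 i hi]
  · rw [hv4]; simp [NExpr.eval, he s₃ g3]
  · rw [g4.real 3 (by simp), h3]
  have hn1 : (1 : ℝ) ≤ n := by exact_mod_cast (by omega : 1 ≤ n)
  have hd1 : (1 : ℝ) ≤ d := by exact_mod_cast hd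
  have hc1 : 1 ≤ c := hc.le_of_le (by omega) hτ hε
    (by rw [le_div_iff₀ (by positivity)]; have := pow_lt_one₀ hε.le hε1 two_ne_zero; linarith) hn1
  have hnd : ((n : ℝ) + 1) * (d + 1) ≤ 4 * (n * d) := by nlinarith
  have hndc : (n : ℝ) * d ≤ n * d * c := le_mul_of_one_le_right (by positivity) hc1
  have hn2 : (n : ℝ) ≤ n * d := le_mul_of_one_le_right (by positivity) hd1
  have hszR : ((sc.size : ℝ) + wE.size + eE.size) ≤ 100 := by exact_mod_cast hsz
  have z1 : (0 : ℝ) ≤ sc.size := Nat.cast_nonneg _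
  have z2 : (0 : ℝ) ≤ wE.size := Nat.cast_nonneg _
  have z3 : (0 : ℝ) ≤ eE.size := Nat.cast_nonneg _
  simp only [RExpr.size, NExpr.size, ctrCell, nVar, rowsE, colsE] at ht1 ht2 ht3 ht4
  rw [ht4] at ht5
  push_cast at ht1 ht2 ht3 ht5
  have w1 : ((n : ℝ) + 1) * ((d + 1) * (1 + 1 + 1 + (1 + 1 + 1) +
      (sc.size + (1 + 1 + 1 + (1 + 1 + 1) + 1) + 1) + 60)) ≤ 4 * (n * d) * 180 := by
    rw [← mul_assoc]
    exact mul_le_mul hnd (by linarith) (by positivity) (by positivity)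
  have w2 : ((n : ℝ) + 1) * (1 + 1 + 1 + wE.size + 1 + 40) ≤ 2 * (n * d) * 180 :=
    mul_le_mul (by linarith) (by linarith) (by positivity) (by positivity)
  nlinarith

/-! ### The sampling weights -/

/-- Combines the column estimates (array `22`) with the row norms of the values into sampling
weights (array `19`). -/
def weightProc : Cmd :=
  .seq (rowSums 10 11 11 16 rowsE colsE (.mul (ctrCell 2) (ctrCell 2)) (rVar 11))
    (.seq (sumLoop 10 17 rowsE (rowCell 22))
      (.seq (sumLoop 10 18 rowsE (rowCell 16))
        (fillLoop 10 19 (.const 0) rowsE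
          (.add (.div (rowCell 22) (rVar 17)) (.div (rowCell 16) (rVar 18))))))

theorem weightProc_spec {α : ℕ → ℝ} {V : ℕ → ℕ → ℝ} (hFn : n + 1 ≤ F) (hFd : d + 1 ≤ F)
    {s : State 𝒦.DS} (h : HasDims n d s) (hα : ∀ i < n, s.real 22 i 0 = α i)
    (hV : ∀ i < n, ∀ l < d, s.real 2 i l = V i l) :
    Good 𝒦 F weightProc s (fun s' => Frame [10, 11] [11, 16, 17, 18, 19] s s' ∧
      (∀ i < n, s'.real 19 i 0 = α i / ∑ k ∈ Finset.range n, α k +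
        normSq d (V i) / ∑ k ∈ Finset.range n, normSq d (V k)) ∧
      (s'.time : ℝ) ≤ s.time + (n + 1) * (d + 1) * 400) 0 := by
  have dims : ∀ {s' : State 𝒦.DS} {ln lr : List ℕ}, Frame ln lr s s' → 0 ∉ ln →
      HasDims n d s' := fun hs' h0 => h.of_eq (hs'.nat 0 h0)
  refine Good.seq_left (Good.rowSums n d (by norm_num) (fun i l => V i l * V i l) (fun _ x => x)
    (by norm_num) (fun s' hs' => (dims hs' (by simp)).rowsE)
    (fun s' hs' => (dims hs' (by simp)).colsE) hFn hFd (fun k hk k' hk' s' hs' hc1 hc2 => ?_)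
    (fun k hk s' hs' hc1 => rfl)) fun s₁ ⟨hf1, hv1, ht1⟩ => ?_
  · simp only [RExpr.eval, ctrCell, nVar, NExpr.eval, hc1, hc2]
    rw [hs'.real 2 (by simp), hV k hk k' hk']
  have g1 : Frame [10, 11] [11, 16, 17, 18, 19] s s₁ := hf1.mono
  refine Good.seq_left (Good.sumLoop n α
    (fun s' hs' => (dims (g1.trans hs'.mono) (by simp)).rowsE) hFn
    fun k hk s' hs' hc1 => ?_) fun s₂ ⟨hf2, hv2, ht2⟩ => ?_
  · simp only [RExpr.eval, rowCell, nVar, NExpr.eval, hc1]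
    rw [hs'.real 22 (by simp), hf1.real 22 (by simp), hα k hk]
  have g2 : Frame [10, 11] [11, 16, 17, 18, 19] s s₂ := g1.trans hf2.mono
  have v16 : ∀ i < n, s₁.real 16 i 0 = normSq d (V i) := hv1
  refine Good.seq_left (Good.sumLoop n (fun k => normSq d (V k))
    (fun s' hs' => (dims (g2.trans hs'.mono) (by simp)).rowsE) hFn
    fun k hk s' hs' hc1 => ?_) fun s₃ ⟨hf3, hv3, ht3⟩ => ?_
  · simp only [RExpr.eval, rowCell, nVar, NExpr.eval, hc1]
    rw [hs'.real 16 (by simp), hf2.real 16 (by simp), v16 k hk]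
  have g3 : Frame [10, 11] [11, 16, 17, 18, 19] s s₃ := g2.trans hf3.mono
  refine (Good.fillLoop n 0 (fun i => α i / ∑ k ∈ Finset.range n, α k +
        normSq d (V i) / ∑ k ∈ Finset.range n, normSq d (V k))
    (fun s' hs' => (dims (g3.trans hs'.mono) (by simp)).rowsE) (fun _ _ => rfl) hFn
    fun k hk s' hs' _ hc1 => ?_).mono fun s₄ ⟨hf4, hv4, ht4⟩ => ⟨g3.trans hf4.mono, hv4.1, ?_⟩
  · simp only [RExpr.eval, rowCell, nVar, rVar, NExpr.eval, hc1]
    rw [hs'.real 22 (by simp), g3.real 22 (by simp), hα k hk, hs'.real 17 (by simp),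
      hf3.real 17 (by simp), hv2, hs'.real 16 (by simp), hf3.real 16 (by simp),
      hf2.real 16 (by simp), v16 k hk, hs'.real 18 (by simp), hv3]
  · simp only [RExpr.size, NExpr.size, ctrCell, rowCell, nVar, rVar, rowsE, colsE]
      at ht1 ht2 ht3 ht4
    push_cast at ht1 ht2 ht3 ht4
    have hd0 : (0 : ℝ) ≤ d := Nat.cast_nonneg _
    have hn0 : (0 : ℝ) ≤ n := Nat.cast_nonneg _
    nlinarith [mul_nonneg hn0 hd0]

/-! ### Output of the samples -/

/-- Writes the rows of the sampling matrix. -/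
def outputLoop : Cmd :=
  forLoop 10 samplesE
    (.seq (.setN 1 (nVar 10) (.const 0) (.cell 2 (.cell 5 (nVar 10) (.const 0)) (.const 0)))
      (.setR 5 (nVar 10) (.const 0) (.div (.const 1) (.sqrt (.mul (.ofNat samplesE)
        (.div (.ofNat (.cell 3 (.cell 1 (nVar 10) (.const 0)) (.const 0))) (.ofNat (nVar 4))))))))

theorem outputLoop_spec (hF : m + 1 ≤ F) {s : State 𝒦.DS} (hm : s.nat 0 0 2 = m) :
    Good 𝒦 F outputLoop s (fun s' => Frame [10, 1] [5] s s' ∧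
      (∀ r < m, s'.nat 1 r 0 = s.nat 2 (s.nat 5 r 0) 0 ∧ s'.real 5 r 0 = 1 / Real.sqrt (m *
        ((s.nat 3 (s.nat 2 (s.nat 5 r 0) 0) 0 : ℝ) / (s.nat 4 0 0 : ℝ)))) ∧
      (s'.time : ℝ) ≤ s.time + (m + 1) * 100) 0 := by
  have hloop := Good.forLoop (𝒦 := 𝒦) (F := F) (a := 10) (bound := samplesE)
    (body := .seq (.setN 1 (nVar 10) (.const 0) (.cell 2 (.cell 5 (nVar 10) (.const 0)) (.const 0)))
      (.setR 5 (nVar 10) (.const 0) (.div (.const 1) (.sqrt (.mul (.ofNat samplesE)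
        (.div (.ofNat (.cell 3 (.cell 1 (nVar 10) (.const 0)) (.const 0))) (.ofNat (nVar 4))))))))
    (s₀ := s) (ln := [1]) (lr := [5]) (δ := 0)
    (fun k s' => ∀ r < k, s'.nat 1 r 0 = s.nat 2 (s.nat 5 r 0) 0 ∧ s'.real 5 r 0 =
      1 / Real.sqrt (m * ((s.nat 3 (s.nat 2 (s.nat 5 r 0) 0) 0 : ℝ) / (s.nat 4 0 0 : ℝ)))) m
    (fun _ => 60)
    (fun k s₁ s₂ h1 h2 h3 r hr => by rw [h1 1 (by norm_num), h2]; exact h3 r hr)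
    (fun s' hs' => by
      simp only [samplesE, NExpr.eval]
      rw [hs'.nat 0 (by simp), hm]) (by simp) hF (by simp) fun k hk s₁ hs₁ hc1 hJ => ?_
  · rw [mul_zero] at hloop
    refine hloop.mono fun s' ⟨hf', hv', ht'⟩ => ⟨hf', hv', ht'.trans ?_⟩
    simp only [NExpr.size, samplesE, Finset.sum_const, Finset.card_range, nsmul_eq_mul]
    push_cast
    have : (0 : ℝ) ≤ m := Nat.cast_nonneg _
    linarith
  · refine Good.seq_left Good.setN_frame fun s₂ ⟨hf2, hv2, ht2⟩ => Good.setR_frame.mono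
      fun s₃ ⟨hf3, hv3, ht3⟩ => ⟨hf2.mono.trans hf3.mono, fun r hr => ?_, ?_⟩
    · have hc2 : s₂.nat 10 0 0 = k := by rw [hf2.nat 10 (by simp), hc1]
      have e1 : ∀ r, s₂.nat 1 r 0 = if r = k then s.nat 2 (s.nat 5 k 0) 0 else s₁.nat 1 r 0 := by
        intro r
        rw [hv2]
        simp [NExpr.eval, nVar, hc1, hs₁.nat 2, hs₁.nat 5]
      rw [hf3.nat 1 (by simp), hv3, e1]
      simp only [NExpr.eval, RExpr.eval, nVar, samplesE, hc2, e1, if_true, and_true,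
        hf2.nat 0 (by simp : 0 ∉ [1]), hf2.nat 3 (by simp : 3 ∉ [1]), hf2.nat 4 (by simp : 4 ∉ [1]),
        hs₁.nat 0 (by simp), hs₁.nat 3 (by simp), hs₁.nat 4 (by simp), hm, hf2.real 5 (by simp)]
      split_ifs with hrk
      · subst hrk
        exact ⟨rfl, by norm_num⟩
      · exact hJ r (by omega)
    · rw [ht3, ht2]
      simp only [RExpr.size, NExpr.size, nVar, samplesE]
      push_cast
      linarith

end Program

end KDEAttention
end

/-! ### The sampling procedure and the two branches of the algorithm. -/

noncomputable section

namespace KDEAttention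

open scoped ENNReal

section Algorithm

variable {𝒦 : KDEPrimitive} {F n d m : ℕ}

/-- Draws the sampling matrix according to the weights in array `19`. -/
def samplingProc : Cmd := .seq tableLoop (.seq drawLoop outputLoop)

open Classical in
-- The property `G` is arbitrary, which separates the program from the probability: `hG` asks for a
-- count of bad samples, for every table that the program could have built.
theorem samplingProc_spec {u : ℕ → ℝ} (hn : 0 < n) (hFn : 3 * n + 1 ≤ F) (hFm : m + 1 ≤ F)
    {s : State 𝒦.DS} (h : HasDims n d s) (hm : s.nat 0 0 2 = m)
    (hu : ∀ i < n, s.real 19 i 0 = u i) (hu0 : ∀ i < n, 0 < u i)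
    (hus : ∑ i ∈ Finset.range n, u i ≤ 2) (G : Matrix (Fin m) (Fin n) ℝ → Prop) {δ : ℝ≥0∞}
    (hG : ∀ (T : ℕ) (l : Fin T → Fin n), 0 < T → (T : ℝ) ≤ 3 * n →
      (∀ i : Fin n, (Finset.univ.filter fun t => l t = i).card = tableCount n u i) →
      ((Finset.univ.filter fun ω : Fin m → Fin T =>
        ¬ G (tableSampling l (fun i => (tableCount n u i : ℝ) / T) ω)).card : ℝ≥0∞) /
          (T : ℝ≥0∞) ^ m ≤ δ) :
    Good 𝒦 F samplingProc s (fun s' => Frame [1, 2, 3, 4, 5, 10] [5] s s' ∧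
      IsSamplingMatrix (outputSampling s' m n) ∧ G (outputSampling s' m n) ∧
      (s'.time : ℝ) ≤ s.time + (700 * n + 160 * m)) δ := by
  have hcount : ∀ i < n, 0 < tableCount n u i := fun i hi =>
    Nat.ceil_pos.2 (mul_pos (by exact_mod_cast hn) (hu0 i hi))
  have hsum := sum_tableCount_le (fun i hi => (hu0 i hi).le) hus
  have hle : ∀ i < n, tableCount n u i + 1 ≤ F := fun i hi => by
    have h1 : tableCount n u i ≤ ∑ i ∈ Finset.range n, tableCount n u i :=
      Finset.single_le_sum (fun _ _ => Nat.zero_le _) (Finset.mem_range.2 hi)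
    have h2 : ∑ i ∈ Finset.range n, tableCount n u i ≤ 3 * n := by exact_mod_cast hsum
    omega
  refine Good.seq_left (tableLoop_spec (by omega) hle h hu) fun s₁ ⟨hf1, hv1, ht1⟩ => ?_
  obtain ⟨T, hTdef⟩ : ∃ T, T = s₁.nat 4 0 0 := ⟨_, rfl⟩
  have hTsum : T = ∑ i ∈ Finset.range n, tableCount n u i := by
    rw [hTdef, hv1.total, add_zero]
  have hT : 0 < T := by
    rw [hTsum]
    exact Finset.sum_pos (fun i hi => hcount i (Finset.mem_range.1 hi))
      ⟨0, Finset.mem_range.2 hn⟩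
  have hTR : (0 : ℝ) < T := by exact_mod_cast hT
  have hT3 : (T : ℝ) ≤ 3 * n := by rw [hTsum]; exact hsum
  set l : Fin T → Fin n := fun t => ⟨s₁.nat 2 t 0, (hv1.bound t (by rw [← hTdef]; exact t.2)).2 rfl⟩
    with hl
  have hfib : ∀ i : Fin n, (Finset.univ.filter fun t => l t = i).card = tableCount n u i := by
    intro i
    have h1 := hv1.fibers i
    rw [if_pos i.2, ← hTdef] at h1
    rw [← h1, ← Finset.card_map Fin.valEmbedding]
    congr 1
    ext t
    simp only [Finset.mem_filter, Finset.mem_range, Finset.mem_map, Finset.mem_univ, true_and,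
      Fin.valEmbedding_apply]
    constructor
    · rintro ⟨t, h2, rfl⟩
      exact ⟨t.2, congrArg Fin.val h2⟩
    · rintro ⟨h2, h3⟩
      exact ⟨⟨t, h2⟩, Fin.ext h3, rfl⟩
  refine Good.seq_right ((drawLoop_spec hT hFm (by rw [hf1.nat 0 (by simp), hm]) hTdef.symm
    (Finset.univ.filter fun ω : Fin m → Fin T =>
        ¬ G (tableSampling l (fun i => (tableCount n u i : ℝ) / T) ω))).mono (fun _ h => h)
          (hG T l hT hT3 hfib)) fun s₂ ⟨hf2, ⟨ω, hω, hω5⟩, ht2⟩ => ?_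
  refine (outputLoop_spec hFm (by rw [hf2.nat 0 (by simp), hf1.nat 0 (by simp), hm])).mono
    fun s₃ ⟨hf3, hv3, ht3⟩ => ?_
  have hout : outputSampling s₃ m n = tableSampling l (fun i => (tableCount n u i : ℝ) / T) ω := by
    ext r i
    obtain ⟨h1, h2⟩ := hv3 r r.2
    rw [hf2.nat 2 (by simp), hω5 r] at h1 h2
    rw [hf2.nat 3 (by simp), hf2.nat 4 (by simp), ← hTdef] at h2
    have hlv : s₁.nat 2 (ω r) 0 = (l (ω r) : ℕ) := rfl
    rw [hlv] at h1 h2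
    rw [hv1.counts _ (l (ω r)).2] at h2
    simp only [outputSampling, tableSampling, Matrix.of_apply, h1, h2]
    by_cases hi : i = l (ω r)
    · rw [if_pos hi, if_pos (congrArg Fin.val hi).symm]
    · rw [if_neg hi, if_neg fun h' => hi (Fin.ext h').symm]
  refine ⟨(hf1.mono.trans hf2.mono).trans hf3.mono, ?_, ?_, ?_⟩
  · rw [hout]
    refine ⟨fun i => (tableCount n u i : ℝ) / T, fun r => l (ω r), fun i => by positivity, ?_,
      fun r => div_pos (by exact_mod_cast hcount _ (l (ω r)).2) hTR, fun r i => rfl⟩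
    rw [← Finset.sum_div, ← Nat.cast_sum, ← Finset.sum_range (fun i => tableCount n u i), ← hTsum,
      div_self hTR.ne']
  · rw [hout]
    simpa using hω
  · rw [← Nat.cast_sum, ← hTsum] at ht1
    have hn1 : (1 : ℝ) ≤ n := by exact_mod_cast hn
    linarith

/-- The scaling `d^{-1/4}`. -/
def scaleE : RExpr := .div (.const 1) (.sqrt (.sqrt (.ofNat colsE)))

theorem scaleE_eval {s : State 𝒦.DS} (h : HasDims n d s) :
    scaleE.eval s = ((d : ℝ) ^ (1 / 4 : ℝ))⁻¹ := by
  rw [inv_rpow_quarter]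
  simp only [scaleE, RExpr.eval, h.colsE, Rat.cast_one]

/-- The algorithm for precision below `2`. -/
def mainBranch : Cmd :=
  .seq (densityProc scaleE 1 0 (.const 0) (.div (rVar 3) (.const 8)))
    (.seq (fillLoop 10 4 (.const 0) rowsE (rowCell 22))
      (.seq (densityProc (.mul (.sqrt (.const 2)) scaleE) 0 1
          (.mul (.const (-2)) (.log (rowCell 4))) (.const (1 / 2)))
        (.seq weightProc samplingProc)))

/-- The algorithm for precision at least `2`: all samples are the first index. -/
def trivialBranch : Cmd :=
  .seq (rowSums 10 11 11 4 rowsE colsE (.mul (ctrCell 0) (.cell 1 (.const 0) (nVar 11)))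
      (.mul (.ofNat rowsE) (.exp (.div (rVar 11) (.sqrt (.ofNat colsE))))))
    (fillLoop 10 5 (.const 0) samplesE (.div (.const 1) (.sqrt (.ofNat samplesE))))

/-- Approximate attention. -/
def attentionAlg : Cmd := .ite (.realLe (.const 2) (rVar 3)) trivialBranch mainBranch

/-- The memory holds the input. -/
structure HasInput {DS : Type} (Q K V : Matrix (Fin n) (Fin d) ℝ) (ε τ : ℝ) (m : ℕ)
    (s : State DS) : Prop extends HasDims n d s where
  samples : s.nat 0 0 2 = m
  queries : s.real 0 = entry Q
  keys : s.real 1 = entry K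
  values : s.real 2 = entry V
  eps : s.real 3 0 0 = ε
  exponent : s.real 3 0 1 = τ

theorem HasInput.of_same {DS : Type} {Q K V : Matrix (Fin n) (Fin d) ℝ} {ε τ : ℝ}
    {s s' : State DS} {ln lr : List ℕ} (h : HasInput Q K V ε τ m s) (hs : SameArrays ln lr s s')
    (h0 : 0 ∉ ln := by simp) (h0' : 0 ∉ lr := by simp) (h1 : 1 ∉ lr := by simp)
    (h2 : 2 ∉ lr := by simp) (h3 : 3 ∉ lr := by simp) : HasInput Q K V ε τ m s' where
  toHasDims := h.toHasDims.of_eq (hs.nat 0 h0)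
  samples := by rw [hs.nat 0 h0, h.samples]
  queries := by rw [hs.real 0 h0', h.queries]
  keys := by rw [hs.real 1 h1, h.keys]
  values := by rw [hs.real 2 h2, h.values]
  eps := by rw [hs.real 3 h3, h.eps]
  exponent := by rw [hs.real 3 h3, h.exponent]

theorem HasInput.samplesE {DS : Type} {Q K V : Matrix (Fin n) (Fin d) ℝ} {ε τ : ℝ}
    {s : State DS} (h : HasInput Q K V ε τ m s) : samplesE.eval s = m := h.samples

theorem hasInput_inputState {DS : Type} (Q K V : Matrix (Fin n) (Fin d) ℝ) (ε τ : ℝ) (m : ℕ) :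
    HasInput Q K V ε τ m (inputState DS Q K V ε τ m) where
  rows := by simp [inputState]
  cols := by simp [inputState]
  samples := by simp [inputState]
  queries := by funext i j; simp [inputState]
  keys := by funext i j; simp [inputState]
  values := by funext i j; simp [inputState]
  eps := by simp [inputState]
  exponent := by simp [inputState]

/-- The output is correct. -/
def OutputOK {DS : Type} (Q K V : Matrix (Fin n) (Fin d) ℝ) (ε : ℝ) (m : ℕ) (s : State DS) : Prop :=
  (∀ i, 0 < outputDiag s n i) ∧ IsSamplingMatrix (outputSampling s m n) ∧
    SpectralGuarantee Q K V ε (Matrix.diagonal (outputDiag s n)) (outputSampling s m n)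

/-- The sampled indices are never written: their array is initially zero, which is the intended
index. The diagonal is `n` times column `0` of the attention matrix. -/
theorem trivialBranch_spec {Q K V : Matrix (Fin n) (Fin d) ℝ} {ε τ : ℝ} (hn : 0 < n) (hm : 0 < m)
    (hε : 2 ≤ ε) (hFn : n + 1 ≤ F) (hFd : d + 1 ≤ F) (hFm : m + 1 ≤ F) {s : State 𝒦.DS}
    (h : HasInput Q K V ε τ m s) (h1 : ∀ r, s.nat 1 r 0 = 0) :
    Good 𝒦 F trivialBranch s (fun s' => OutputOK Q K V ε m s' ∧
      (s'.time : ℝ) ≤ s.time + ((n + 1) * (d + 1) * 120 + (m + 1) * 60)) 0 := by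
  refine Good.seq_left (Good.rowSums n d (by norm_num) (fun i l => entry Q i l * entry K 0 l)
    (fun _ x => n * Real.exp (x / Real.sqrt d)) (by norm_num)
    (fun s' hs' => (h.of_same hs'.same).rowsE)
    (fun s' hs' => (h.of_same hs'.same).colsE) hFn hFd (fun k hk k' hk' s' hs' hc1 hc2 => ?_)
    (fun k hk s' hs' hc1 => ?_)) fun s₁ ⟨hf1, hv1, ht1⟩ => ?_
  · simp only [RExpr.eval, ctrCell, nVar, NExpr.eval, hc1, hc2]
    rw [(h.of_same hs'.same).queries, (h.of_same hs'.same).keys]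
  · simp only [RExpr.eval, rVar, NExpr.eval, (h.of_same hs'.same).rowsE,
      (h.of_same hs'.same).colsE]
  have h' := h.of_same hf1.same
  refine (Good.fillLoop m 0 (fun _ => 1 / Real.sqrt m)
    (fun s' hs' => (h'.of_same hs'.same).samplesE) (fun _ _ => rfl) hFm
    fun k hk s' hs' _ hc1 => ?_).mono fun s₂ ⟨hf2, hv2, ht2⟩ => ⟨?_, ?_⟩
  · simp only [RExpr.eval, (h'.of_same hs'.same).samplesE, Rat.cast_one]
  · have hd : ∀ i, outputDiag s₂ n i = n * Real.exp (Q i ⬝ᵥ K ⟨0, hn⟩ / Real.sqrt d) := by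
      intro i
      rw [outputDiag, hf2.real 4 (by simp), hv1 i i.2, ← sum_range_entry_mul]
    have hS : ∀ r i, outputSampling s₂ m n r i = if i = ⟨0, hn⟩ then 1 / Real.sqrt m else 0 := by
      intro r i
      have : s₂.nat 1 r 0 = 0 := by rw [hf2.nat 1 (by simp), hf1.nat 1 (by simp), h1]
      simp only [outputSampling, Matrix.of_apply, this, hv2.1 r r.2, Fin.ext_iff, eq_comm]
    have hnR : (0 : ℝ) < n := by exact_mod_cast hn
    refine ⟨fun i => by rw [hd]; positivity, ?_, spectralGuarantee_of_two_le hn hm Q K V hε ⟨0, hn⟩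
      hd _ hS⟩
    refine ⟨fun i => if i = ⟨0, hn⟩ then 1 else 0, fun _ => ⟨0, hn⟩, fun i => ?_, ?_, fun r => ?_,
      fun r i => ?_⟩
    · dsimp only
      split_ifs <;> norm_num
    · simp
    · simp
    · rw [hS]; simp
  · simp only [RExpr.size, NExpr.size, ctrCell, nVar, rVar, rowsE, colsE, samplesE] at ht1 ht2
    push_cast at ht1 ht2
    have hd0 : (0 : ℝ) ≤ d := Nat.cast_nonneg _
    have hn0 : (0 : ℝ) ≤ n := Nat.cast_nonneg _
    have hm0 : (0 : ℝ) ≤ m := Nat.cast_nonneg _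
    nlinarith [mul_nonneg hn0 hd0]

end Algorithm

end KDEAttention
end

/-! ### Assembly: failure probabilities, constants and the final theorem. -/

noncomputable section

namespace KDEAttention

open scoped ENNReal

section Main

variable {𝒦 : KDEPrimitive} {F n d m : ℕ}

theorem opNorm_softmax_pos (hn : 0 < n) (Q K : Matrix (Fin n) (Fin d) ℝ) :
    0 < opNorm (softmaxMatrix Q K) := one_pos.trans_le (one_le_opNorm_softmaxMatrix hn Q K)

theorem softmax_col_pos (hn : 0 < n) (Q K : Matrix (Fin n) (Fin d) ℝ) (i : Fin n) :
    0 < ∑ j, softmaxMatrix Q K j i ^ 2 := by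
  refine Finset.sum_pos (fun j _ => ?_) ⟨i, Finset.mem_univ _⟩
  rw [softmaxMatrix_apply hn]
  have := attnRowSum_pos hn Q K j
  positivity

open Classical in
/-- The probability that the samples from a table are bad. -/
theorem bad_samples_le (hn : 0 < n) (hm : 0 < m) (Q K V : Matrix (Fin n) (Fin d) ℝ) {ε : ℝ}
    (hε : 0 < ε) (hε2 : ε < 2) {u : ℕ → ℝ} (hu0 : ∀ i < n, 0 < u i) {α : Fin n → ℝ}
    (h1 : ∀ i, 8 / 25 * ∑ j, softmaxMatrix Q K j i ^ 2 ≤ α i)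
    (h2 : ∀ i, α i ≤ 8 / 3 * ∑ j, softmaxMatrix Q K j i ^ 2)
    (hu : ∀ i : Fin n, u i = α i / ∑ k, α k + (∑ j, V i j ^ 2) / frobSq V)
    {T : ℕ} (l : Fin T → Fin n) (hT : 0 < T) (hT3 : (T : ℝ) ≤ 3 * n)
    (hl : ∀ i : Fin n, (Finset.univ.filter fun t => l t = i).card = tableCount n u i) :
    ((Finset.univ.filter fun ω : Fin m → Fin T =>
      ¬ opNorm (softmaxMatrix Q K * V - softmaxMatrix Q K *
          (tableSampling l (fun i => (tableCount n u i : ℝ) / T) ω).transpose *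
          (tableSampling l (fun i => (tableCount n u i : ℝ) / T) ω * V)) ≤
        ε / 2 * opNorm (softmaxMatrix Q K) * opNorm V).card : ℝ≥0∞) / (T : ℝ≥0∞) ^ m ≤
      ENNReal.ofReal (2 * n * Real.exp (-(m * ε ^ 2 /
        (1728 * (srank (softmaxMatrix Q K) + srank V))))) := by
  have hTR : (0 : ℝ) < T := by exact_mod_cast hT
  -- For `V = 0` no sample is bad; the concentration bound divides by `‖V‖`.
  rcases (opNorm_nonneg V).eq_or_lt with hV | hV
  · have hV0 : V = 0 := opNorm_eq_zero.1 hV.symm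
    subst hV0
    have h0 : opNorm (0 : Matrix (Fin n) (Fin d) ℝ) = 0 := hV.symm
    simp [h0]
  · have hS : 0 < srank (softmaxMatrix Q K) + srank V :=
      add_pos_of_pos_of_nonneg (srank_softmaxMatrix_pos hn Q K) (srank_nonneg V)
    have hc0 : ∀ i : Fin n, 0 < tableCount n u i := fun i =>
      Nat.ceil_pos.2 (mul_pos (by exact_mod_cast hn) (hu0 i i.2))
    have key := card_sampling_bad_le (m := m) (softmaxMatrix Q K) V hT hm l
      (fun i => (tableCount n u i : ℝ) / T) (fun i => by rw [hl])
      (fun i => div_pos (by exact_mod_cast hc0 i) hTR)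
      (opNorm_softmax_pos hn Q K) hV (R := 27 * (srank (softmaxMatrix Q K) + srank V))
      (η := ε / 2) (by positivity) (by positivity) (by linarith) (fun i => by
        refine (leverage_le (softmax_col_pos hn Q K) h1 h2 i).trans ?_
        rw [← hu i]
        have h3 := le_three_mul_tableCount_div hT hT3 (hu0 i i.2).le
        have h4 := mul_le_mul_of_nonneg_left h3
          (by positivity : 0 ≤ 9 * (srank (softmaxMatrix Q K) + srank V))
        linarith)
    -- Here `27 = 9 * 3` combines the leverage bound with the rounding loss of the table, and `1728
    -- = 4 * 16 * 27`.
    have hexp : (m : ℝ) * (ε / 2) ^ 2 / (16 * (27 * (srank (softmaxMatrix Q K) + srank V))) =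
        m * ε ^ 2 / (1728 * (srank (softmaxMatrix Q K) + srank V)) := by
      rw [div_eq_div_iff (by positivity) (by positivity)]
      ring
    rw [hexp] at key
    refine ENNReal.div_le_of_le_mul ?_
    rw [mul_comm (ENNReal.ofReal _), ← ENNReal.ofReal_natCast T, ← ENNReal.ofReal_pow hTR.le,
      ← ENNReal.ofReal_mul (by positivity), ← ENNReal.ofReal_natCast]
    exact ENNReal.ofReal_le_ofReal key

/-- The constant in the running time. -/
def timeConst (τ C₀ : ℝ) : ℝ := (16 * C₀ + 10000) * (64 * (25 / 9) ^ τ) + 4000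

/-- The running time of the algorithm, up to a constant. -/
def attnTime (Q K : Matrix (Fin n) (Fin d) ℝ) (ε τ : ℝ) (m : ℕ) : ℝ :=
  m + n * d * (kdeCost (rescale K) (rescale Q) 1 ε τ +
    kdeCost (Real.sqrt 2 • rescale Q) (Real.sqrt 2 • rescale K) (softmaxWeights Q K) 1 τ)

theorem softmaxWeights_eq (Q K : Matrix (Fin n) (Fin d) ℝ) (j : Fin n) :
    softmaxWeights Q K j = (attnRowSum Q K j ^ 2)⁻¹ := rfl

theorem exp_neg_two_mul_log {x : ℝ} (hx : 0 < x) : Real.exp (-2 * Real.log x) = (x ^ 2)⁻¹ := by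
  rw [neg_mul, Real.exp_neg, two_mul, Real.exp_add, Real.exp_log hx, sq]

/-- Three random stages contribute to the failure probability: the row sums, the column norms with
weights taken from the first stage, and the samples. Only the row sums need precision of order `ε`;
the column norms only set sampling probabilities, so precision `1/2` suffices. -/
theorem mainBranch_spec {Q K V : Matrix (Fin n) (Fin d) ℝ} {ε τ C₀ a : ℝ}
    (hfast : 𝒦.IsFast τ C₀ a) (hn : 2 ≤ n) (hd : 0 < d) (hm : 0 < m) (hτ : 0 < τ)
    (hC₀ : 0 < C₀) (hε : 0 < ε) (hε2 : ε < 2) (hFn : 3 * n + 1 ≤ F) (hFd : d + 1 ≤ F)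
    (hFm : m + 1 ≤ F) {s : State 𝒦.DS} (h : HasInput Q K V ε τ m s) :
    Good 𝒦 F mainBranch s (fun s' => OutputOK Q K V ε m s' ∧
      (s'.time : ℝ) ≤ s.time + timeConst τ C₀ * attnTime Q K ε τ m)
      (n * (n * ENNReal.ofReal ((n : ℝ) ^ (-a))) + (n * (n * ENNReal.ofReal ((n : ℝ) ^ (-a))) +
        ENNReal.ofReal (2 * n * Real.exp (-(m * ε ^ 2 /
          (1728 * (srank (softmaxMatrix Q K) + srank V))))))) := by
  have hn0 : 0 < n := by omega
  set σ : ℝ := ((d : ℝ) ^ (1 / 4 : ℝ))⁻¹ with hσ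
  have hrs : ∀ X : Matrix (Fin n) (Fin d) ℝ, (fun i l => σ * entry X i l) = entry (rescale X) :=
    fun X => by funext i l; rw [rescale, entry_smul]
  have hrs2 : ∀ X : Matrix (Fin n) (Fin d) ℝ,
      (fun i l => Real.sqrt 2 * σ * entry X i l) = entry (Real.sqrt 2 • rescale X) :=
    fun X => by funext i l; rw [rescale, entry_smul, entry_smul, mul_assoc]
  have dims : ∀ s' : State 𝒦.DS, s'.nat 0 = s.nat 0 → scaleE.eval s' = σ := fun s' h0 =>
    scaleE_eval (h.toHasDims.of_eq h0)
  have hc1 := isKDECost_kdeCost (rescale K) (rescale Q) (fun _ => 0) (ε / 8) τ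
  rw [← hrs, ← hrs] at hc1
  refine Good.seq (densityProc_spec hfast hn hd hτ hC₀ (ε := ε / 8) (by positivity) (by linarith)
    (by omega) hFd hc1 h.toHasDims h.exponent (by simp) (by simp)
    (fun i _ l _ => by rw [h.keys]) (fun i _ l _ => by rw [h.queries]) dims
    (fun k hk s' hs' hk' => by simp [RExpr.eval])
    (fun s' hs' => by simp [RExpr.eval, rVar, NExpr.eval, hs'.real 3, h.eps])
    (by simp [scaleE, RExpr.size, NExpr.size, colsE, rVar])) fun s₁ ⟨hf1, hv1, ht1⟩ => ?_
  have i1 := h.of_same hf1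
  refine Good.seq_left (Good.fillLoop n 0 (fun i => s₁.real 22 i 0)
    (fun s' hs' => (i1.of_same hs'.same).rowsE) (fun _ _ => rfl) (by omega)
    fun k hk s' hs' _ hk' => ?_) fun s₂ ⟨hf2, hv2, ht2⟩ => ?_
  · simp only [RExpr.eval, rowCell, nVar, NExpr.eval, hk']
    rw [hs'.real 22 (by simp)]
  have i2 := i1.of_same hf2.same
  set v : ℕ → ℝ := fun i => s₁.real 22 i 0 with hvdef
  have hv8 : ∀ i : Fin n, |v i - attnRowSum Q K i| ≤ ε / 8 * attnRowSum Q K i := fun i => by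
    rw [← expSum_rescale, ← hrs, ← hrs]
    exact hv1 i i.2
  have hv4 : ∀ i : Fin n, |v i - attnRowSum Q K i| ≤ 1 / 4 * attnRowSum Q K i := fun i =>
    (hv8 i).trans (mul_le_mul_of_nonneg_right (by linarith) (attnRowSum_pos hn0 Q K i).le)
  have hv0 : ∀ i : Fin n, 0 < v i := fun i => by
    have := abs_le.1 (hv4 i)
    have := attnRowSum_pos hn0 Q K i
    linarith
  set w : ℕ → ℝ := fun i => -2 * Real.log (v i) with hwdef
  have hw : ∀ i : Fin n, Real.exp (w i) = (v i ^ 2)⁻¹ := fun i => exp_neg_two_mul_log (hv0 i)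
  have hc2 := isKDECost_kdeCost (Real.sqrt 2 • rescale Q) (Real.sqrt 2 • rescale K) w (1 / 2) τ
  rw [← hrs2, ← hrs2] at hc2
  refine Good.seq (densityProc_spec hfast hn hd hτ hC₀ (ε := 1 / 2) (by norm_num) (by norm_num)
    (by omega) hFd hc2 i2.toHasDims i2.exponent (by simp) (by simp)
    (fun i _ l _ => by rw [i2.queries]) (fun i _ l _ => by rw [i2.keys])
    (fun s' hs' => by
      simp only [RExpr.eval, Rat.cast_ofNat]
      rw [dims s' (by rw [hs', hf2.nat 0 (by simp), hf1.nat 0 (by simp)])])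
    (fun k hk s' hs' hk' => by
      simp only [RExpr.eval, rowCell, nVar, NExpr.eval, hk', hs'.real 4 (by simp : 4 ∉ [6, 7, 20]),
        hv2.1 k hk, hwdef, hvdef, Rat.cast_neg, Rat.cast_ofNat])
    (fun s' hs' => by simp [RExpr.eval])
    (by simp [scaleE, rowCell, nVar, RExpr.size, NExpr.size, colsE])) fun s₃ ⟨hf3, hv3, ht3⟩ => ?_
  have i3 := i2.of_same hf3
  refine Good.seq_left (weightProc_spec (by omega) hFd i3.toHasDims (α := fun i => s₃.real 22 i 0)
    (V := entry V) (fun _ _ => rfl) (fun i _ l _ => by rw [i3.values])) fun s₄ ⟨hf4, hv4', ht4⟩ => ?_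
  have i4 := i3.of_same hf4.same
  set α : ℕ → ℝ := fun i => s₃.real 22 i 0 with hαdef
  set u : ℕ → ℝ := fun i => α i / ∑ k ∈ Finset.range n, α k +
    normSq d (entry V i) / ∑ k ∈ Finset.range n, normSq d (entry V k) with hudef
  have hα : ∀ i : Fin n, 8 / 25 * ∑ j, softmaxMatrix Q K j i ^ 2 ≤ α i ∧
      α i ≤ 8 / 3 * ∑ j, softmaxMatrix Q K j i ^ 2 := fun i => by
    refine softmax_col_approx hn0 Q K hv4 i ?_
    have := hv3 i i.2
    simp only [hrs2, congrFun (hrs2 K) i] at this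
    rw [expSum_sqrt_two_rescale] at this
    simpa only [hw] using this
  have hα0 : ∀ i < n, 0 < α i := fun i hi =>
    lt_of_lt_of_le (mul_pos (by norm_num) (softmax_col_pos hn0 Q K ⟨i, hi⟩)) (hα ⟨i, hi⟩).1
  have hαs : 0 < ∑ k ∈ Finset.range n, α k :=
    Finset.sum_pos (fun i hi => hα0 i (Finset.mem_range.1 hi)) ⟨0, Finset.mem_range.2 hn0⟩
  have hN0 : ∀ i, 0 ≤ normSq d (entry V i) := fun i =>
    Finset.sum_nonneg fun _ _ => mul_self_nonneg _
  have hu0 : ∀ i < n, 0 < u i := fun i hi => add_pos_of_pos_of_nonneg (div_pos (hα0 i hi) hαs)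
    (div_nonneg (hN0 i) (Finset.sum_nonneg fun k _ => hN0 k))
  have hus : ∑ i ∈ Finset.range n, u i ≤ 2 := by
    rw [hudef, Finset.sum_add_distrib, ← Finset.sum_div, ← Finset.sum_div, div_self hαs.ne']
    -- If `V = 0` this quotient is `0 / 0 = 0`, so the weights sum to at most `2` and not always to
    -- `2`.
    have := div_self_le_one (∑ k ∈ Finset.range n, normSq d (entry V k))
    linarith
  have hNV : ∀ i : Fin n, normSq d (entry V i) = ∑ j, V i j ^ 2 := fun i => by
    rw [normSq, sum_range_entry_mul]
    exact Finset.sum_congr rfl fun j _ => (sq _).symm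
  have huF : ∀ i : Fin n, u i = α i / ∑ k : Fin n, α k + (∑ j, V i j ^ 2) / frobSq V := fun i => by
    simp only [hudef, Finset.sum_range, hNV, frobSq]
  refine (samplingProc_spec hn0 hFn hFm i4.toHasDims i4.samples hv4' hu0 hus
    (fun S => opNorm (softmaxMatrix Q K * V - softmaxMatrix Q K * S.transpose * (S * V)) ≤
        ε / 2 * opNorm (softmaxMatrix Q K) * opNorm V) fun T l hT hT3 hl =>
      bad_samples_le hn0 hm Q K V hε hε2 hu0 (fun i => (hα i).1) (fun i => (hα i).2) huF l hT hT3
        hl).mono fun s₅ ⟨hf5, hS, hG, ht5⟩ => ⟨?_, ?_⟩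
  · have hdiag : ∀ i, outputDiag s₅ n i = v i := fun i => by
      rw [outputDiag, hf5.real 4 (by simp), hf4.real 4 (by simp), hf3.real 4 (by simp),
        hv2.1 i i.2]
    have := spectralGuarantee_of_approx hn0 Q K V hε hε2 (v := outputDiag s₅ n)
      (fun i => by rw [hdiag]; exact hv8 i) _ hG
    exact ⟨this.1, hS, this.2⟩
  · have hn1 : (1 : ℝ) ≤ n := by exact_mod_cast hn0
    have hd1 : (1 : ℝ) ≤ d := by exact_mod_cast hd
    have hm0 : (0 : ℝ) ≤ m := Nat.cast_nonneg _
    set c₁ := kdeCost (rescale K) (rescale Q) 1 ε τ with hc₁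
    set c₂ := kdeCost (Real.sqrt 2 • rescale Q) (Real.sqrt 2 • rescale K) (softmaxWeights Q K) 1 τ
      with hc₂
    -- This lets `64 * (25/9)^τ` dominate both losses: `8² = 64` for precision `ε/8` in the first
    -- cost, and `2² * (25/9)^τ` in the second, where the weights are off by factors `16/9` and
    -- `25/16`.
    have hpow : (1 : ℝ) ≤ (25 / 9) ^ τ := Real.one_le_rpow (by norm_num) hτ.le
    have k1 : kdeCost (rescale K) (rescale Q) (fun _ => Real.exp 0) (ε / 8) τ ≤ 64 * c₁ := by
      have := kdeCost_le_mul (X := rescale K) (Y := rescale Q) (v := 1)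
        (w := fun _ => Real.exp 0) (ε := ε) (ε' := ε / 8) (τ := τ) (a := 1) (b := 1) (s := 8)
        hn0 hε (by positivity) hτ (by norm_num) (by linarith) one_pos one_pos (by norm_num)
        (fun _ => one_pos) (fun _ => by simp) (fun _ => by simp)
      rw [mul_one, Real.one_rpow] at this
      norm_num at this ⊢
      exact this
    have k2 : kdeCost (Real.sqrt 2 • rescale Q) (Real.sqrt 2 • rescale K)
        (fun j => Real.exp (w j)) (1 / 2) τ ≤ 4 * (25 / 9) ^ τ * c₂ := by
      have hD := fun j => attnRowSum_pos hn0 Q K j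
      have hia := fun j => inv_sq_approx (hD j) (hv4 j)
      have := kdeCost_le_mul (X := Real.sqrt 2 • rescale Q) (Y := Real.sqrt 2 • rescale K)
        (v := softmaxWeights Q K)
        (w := fun j => Real.exp (w j)) (ε := 1) (ε' := 1 / 2) (τ := τ) (a := 16 / 9)
        (b := 25 / 16) (s := 2)
        hn0 one_pos (by positivity) hτ (by norm_num) (by linarith) (by norm_num) (by norm_num)
        (by norm_num)
        (fun j => by rw [softmaxWeights_eq]; have := hD j; positivity)
        (fun j => by rw [softmaxWeights_eq, hw]; exact (hia j).2)
        (fun j => by rw [softmaxWeights_eq, hw]; linarith [(hia j).1])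
      rw [show (2 : ℝ) ^ 2 = 4 by norm_num, show (16 / 9 : ℝ) * (25 / 16) = 25 / 9 by norm_num]
        at this
      exact this
    have hc1n : 0 ≤ c₁ := kdeCost_nonneg _ _ _ _ _
    have hc21 : 1 ≤ c₂ := one_le_kdeCost_one hn0 hτ _ _ fun j => by
      rw [softmaxWeights_eq]; have := attnRowSum_pos hn0 Q K j; positivity
    simp only [RExpr.size, NExpr.size, rowCell, nVar, rowsE] at ht2
    push_cast at ht2
    have hnd : (1 : ℝ) ≤ n * d := by nlinarith
    have hn2 : (n : ℝ) ≤ n * d := le_mul_of_one_le_right (by positivity) hd1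
    have hnd4 : ((n : ℝ) + 1) * (d + 1) ≤ 4 * (n * d) := by nlinarith
    have hL : 0 ≤ 16 * C₀ + 10000 := by positivity
    have t1 : (16 * C₀ + 10000) * (n * d * kdeCost (rescale K) (rescale Q) (fun _ => Real.exp 0)
        (ε / 8) τ) ≤ (16 * C₀ + 10000) * (64 * (25 / 9) ^ τ) * (n * d * c₁) := by
      rw [mul_assoc (16 * C₀ + 10000)]
      refine mul_le_mul_of_nonneg_left ?_ hL
      have : (n : ℝ) * d * (64 * c₁) ≤ n * d * (64 * (25 / 9) ^ τ * c₁) :=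
        mul_le_mul_of_nonneg_left (mul_le_mul_of_nonneg_right (by linarith) hc1n) (by positivity)
      refine (mul_le_mul_of_nonneg_left k1 (by positivity)).trans (this.trans (le_of_eq ?_))
      ring
    have t3 : (16 * C₀ + 10000) * (n * d * kdeCost (Real.sqrt 2 • rescale Q)
        (Real.sqrt 2 • rescale K) (fun j => Real.exp (w j)) (1 / 2) τ) ≤
        (16 * C₀ + 10000) * (64 * (25 / 9) ^ τ) * (n * d * c₂) := by
      rw [mul_assoc (16 * C₀ + 10000)]
      refine mul_le_mul_of_nonneg_left ?_ hL
      have : (n : ℝ) * d * (4 * (25 / 9) ^ τ * c₂) ≤ n * d * (64 * (25 / 9) ^ τ * c₂) :=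
        mul_le_mul_of_nonneg_left (mul_le_mul_of_nonneg_right (by linarith) (by linarith))
          (by positivity)
      refine (mul_le_mul_of_nonneg_left k2 (by positivity)).trans (this.trans (le_of_eq ?_))
      ring
    have hndc : (n : ℝ) * d ≤ n * d * c₂ := le_mul_of_one_le_right (by positivity) hc21
    have hndc1 : 0 ≤ (n : ℝ) * d * c₁ := by positivity
    have hL2 : 0 ≤ (16 * C₀ + 10000) * (64 * (25 / 9) ^ τ) := by positivity
    have hmL := mul_nonneg hL2 hm0
    have hgoal : timeConst τ C₀ * attnTime Q K ε τ m =
        (16 * C₀ + 10000) * (64 * (25 / 9) ^ τ) * m +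
        (16 * C₀ + 10000) * (64 * (25 / 9) ^ τ) * (n * d * c₁) +
        (16 * C₀ + 10000) * (64 * (25 / 9) ^ τ) * (n * d * c₂) +
        4000 * m + 4000 * (n * d * c₁) + 4000 * (n * d * c₂) := by
      rw [timeConst, attnTime]; ring
    rw [hgoal]
    linarith

theorem attentionAlg_spec {Q K V : Matrix (Fin n) (Fin d) ℝ} {ε τ C₀ a : ℝ}
    (hfast : 𝒦.IsFast τ C₀ a) (hn : 2 ≤ n) (hd : 0 < d) (hm : 0 < m) (hτ : 0 < τ)
    (hC₀ : 0 < C₀) (hε : 0 < ε) (hFn : 3 * n + 1 ≤ F) (hFd : d + 1 ≤ F) (hFm : m + 1 ≤ F) :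
    Good 𝒦 F attentionAlg (inputState 𝒦.DS Q K V ε τ m) (fun s' => OutputOK Q K V ε m s' ∧
      (s'.time : ℝ) ≤ (timeConst τ C₀ + 1000) * attnTime Q K ε τ m)
      (n * (n * ENNReal.ofReal ((n : ℝ) ^ (-a))) + (n * (n * ENNReal.ofReal ((n : ℝ) ^ (-a))) +
        ENNReal.ofReal (2 * n * Real.exp (-(m * ε ^ 2 /
          (1728 * (srank (softmaxMatrix Q K) + srank V))))))) := by
  have hn0 : 0 < n := by omega
  have h := hasInput_inputState (DS := 𝒦.DS) Q K V ε τ m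
  have h' : ∀ t, HasInput Q K V ε τ m ((inputState 𝒦.DS Q K V ε τ m).tick t) := fun t =>
    h.of_same (ln := []) (lr := []) ⟨fun _ _ => rfl, fun _ _ => rfl⟩
  have hb : (BExpr.realLe (.const 2) (rVar 3)).Holds (inputState 𝒦.DS Q K V ε τ m) ↔ 2 ≤ ε := by
    simp only [BExpr.Holds, RExpr.eval, rVar, NExpr.eval, h.eps, Rat.cast_ofNat]
  have htick : (((inputState 𝒦.DS Q K V ε τ m).tick
      ((BExpr.realLe (.const 2) (rVar 3)).size + 1)).time : ℝ) = 6 := by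
    simp only [State.tick, inputState, BExpr.size, RExpr.size, rVar, NExpr.size]
    norm_num
  have hm1 : (1 : ℝ) ≤ m := by exact_mod_cast hm
  have hn1 : (1 : ℝ) ≤ n := by exact_mod_cast hn0
  have hd1 : (1 : ℝ) ≤ d := by exact_mod_cast hd
  have hnd4 : ((n : ℝ) + 1) * (d + 1) ≤ 4 * (n * d) := by nlinarith
  have htime : (m : ℝ) + n * d ≤ attnTime Q K ε τ m := by
    have hc21 : 1 ≤ kdeCost (Real.sqrt 2 • rescale Q) (Real.sqrt 2 • rescale K)
        (softmaxWeights Q K) 1 τ := one_le_kdeCost_one hn0 hτ _ _ fun j => by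
      rw [softmaxWeights_eq]; have := attnRowSum_pos hn0 Q K j; positivity
    have hc1n : 0 ≤ kdeCost (rescale K) (rescale Q) 1 ε τ := kdeCost_nonneg _ _ _ _ _
    have : (n : ℝ) * d ≤ n * d * (kdeCost (rescale K) (rescale Q) 1 ε τ +
      kdeCost (Real.sqrt 2 • rescale Q) (Real.sqrt 2 • rescale K) (softmaxWeights Q K) 1 τ) :=
      le_mul_of_one_le_right (by positivity) (by linarith)
    rw [attnTime]
    linarith
  have hnd : 0 ≤ (n : ℝ) * d := by positivity
  refine Good.ite (fun h2 => ?_) fun h2 => ?_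
  · refine (trivialBranch_spec hn0 hm (hb.1 h2) (by omega) hFd hFm (h' _) fun r => ?_).mono
      (fun s' hs' => ⟨hs'.1, ?_⟩) zero_le
    · simp [State.tick, inputState]
    · have := hs'.2
      rw [htick] at this
      have hpos : 0 ≤ timeConst τ C₀ := by unfold timeConst; positivity
      have h3 : 0 ≤ timeConst τ C₀ * attnTime Q K ε τ m := mul_nonneg hpos (by linarith)
      nlinarith
  · refine (mainBranch_spec hfast hn hd hm hτ hC₀ hε (not_le.1 (hb.not.1 h2)) hFn hFd hFm
      (h' _)).mono fun s' hs' => ⟨hs'.1, ?_⟩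
    have := hs'.2
    rw [htick] at this
    nlinarith

/-- The total failure probability. -/
theorem failure_le {c ε S C : ℝ} (hn : 2 ≤ n) (hε : 0 < ε) (hS : 0 < S)
    (hC : 1728 * (c + 3) ≤ C) (hm : C * (ε⁻¹ ^ 2 * Real.log n * S) ≤ m) :
    (n : ℝ≥0∞) * (n * ENNReal.ofReal ((n : ℝ) ^ (-(c + 4)))) +
      (n * (n * ENNReal.ofReal ((n : ℝ) ^ (-(c + 4)))) +
        ENNReal.ofReal (2 * n * Real.exp (-(m * ε ^ 2 / (1728 * S))))) ≤
      ENNReal.ofReal ((n : ℝ) ^ (-c)) := by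
  have hn2 : (2 : ℝ) ≤ n := by exact_mod_cast hn
  have hn0 : (0 : ℝ) < n := by linarith
  have hlog : 0 ≤ Real.log n := Real.log_nonneg (by linarith)
  have hx : 0 < (n : ℝ) ^ (-c) := Real.rpow_pos_of_pos hn0 _
  have e4 : (n : ℝ) ^ (-(c + 4)) = n ^ (-c) / n ^ 4 := by
    rw [neg_add, ← sub_eq_add_neg, Real.rpow_sub hn0]
    norm_cast
  -- The lower bound on `m` makes the exponent at least `(c + 3) log n`; two of the three spare
  -- powers of `n` survive the dimension factor `n`.
  have e3 : Real.exp (-(m * ε ^ 2 / (1728 * S))) ≤ n ^ (-c) / n ^ 3 := by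
    have : (n : ℝ) ^ (-c) / n ^ 3 = Real.exp (-((c + 3) * Real.log n)) := by
      rw [show -((c + 3) * Real.log n) = Real.log n * (-c - 3) by ring, ← Real.rpow_def_of_pos hn0,
        Real.rpow_sub hn0]
      norm_cast
    rw [this]
    refine Real.exp_le_exp.2 (neg_le_neg ?_)
    rw [le_div_iff₀ (by positivity)]
    have h1 : 1728 * (c + 3) * (ε⁻¹ ^ 2 * Real.log n * S) ≤ m :=
      (mul_le_mul_of_nonneg_right hC (by positivity)).trans hm
    have h2 := mul_le_mul_of_nonneg_right h1 (sq_nonneg ε)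
    have h3 : ε⁻¹ ^ 2 * ε ^ 2 = 1 := by field_simp
    calc (c + 3) * Real.log n * (1728 * S)
        = 1728 * (c + 3) * (Real.log n * S) * (ε⁻¹ ^ 2 * ε ^ 2) := by rw [h3]; ring
      _ = 1728 * (c + 3) * (ε⁻¹ ^ 2 * Real.log n * S) * ε ^ 2 := by ring
      _ ≤ _ := h2
  rw [← ENNReal.ofReal_natCast n, ← ENNReal.ofReal_mul hn0.le, ← ENNReal.ofReal_mul hn0.le,
    ← ENNReal.ofReal_add (by positivity) (by positivity),
    ← ENNReal.ofReal_add (by positivity) (by positivity)]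
  refine ENNReal.ofReal_le_ofReal ?_
  have h1 : (n : ℝ) * (n * n ^ (-(c + 4))) = n ^ (-c) / n ^ 2 := by
    rw [e4]; field_simp
  have h2 : 2 * n * Real.exp (-(m * ε ^ 2 / (1728 * S))) ≤ 2 * (n ^ (-c) / n ^ 2) := by
    refine (mul_le_mul_of_nonneg_left e3 (by positivity)).trans (le_of_eq ?_)
    field_simp
  -- The three stages contribute one, one and two times `n^{-c}/n²`, and `n ≥ 2`.
  have h3 : (n : ℝ) ^ (-c) / n ^ 2 ≤ n ^ (-c) / 4 :=
    div_le_div_of_nonneg_left hx.le (by norm_num) (by nlinarith)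
  rw [h1]
  linarith

end Main

end KDEAttention
end

theorem mainTheorem1 :
    ∃ alg : KDEAttention.Cmd, ∀ τ C₀ c : ℝ, 0 < τ → 0 < C₀ → 0 < c →
    ∃ C a : ℝ, 0 < C ∧ 0 < a ∧
    ∀ 𝒦 : KDEAttention.KDEPrimitive, 𝒦.IsFast τ C₀ a →
    ∀ (n d : ℕ), 0 < n → 0 < d → ∀ (Q K V : Matrix (Fin n) (Fin d) ℝ) (ε : ℝ), 0 < ε →
    ∀ m : ℕ,
      C * (ε⁻¹ ^ 2 * Real.log n *
        (KDEAttention.srank (KDEAttention.softmaxMatrix Q K) + KDEAttention.srank V)) ≤ m →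
    ∃ fuel : ℕ,
      (alg.run 𝒦 fuel (KDEAttention.inputState 𝒦.DS Q K V ε τ m)).toOuterMeasure
        {o | ¬ ∃ s, o = some s ∧
          (∀ i, 0 < KDEAttention.outputDiag s n i) ∧
          KDEAttention.IsSamplingMatrix (KDEAttention.outputSampling s m n) ∧
          KDEAttention.SpectralGuarantee Q K V ε
            (Matrix.diagonal (KDEAttention.outputDiag s n)) (KDEAttention.outputSampling s m n) ∧
          (s.time : ℝ) ≤ C * (m + n * d *
            (KDEAttention.kdeCost (KDEAttention.rescale K) (KDEAttention.rescale Q) 1 ε τ +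
              KDEAttention.kdeCost (Real.sqrt 2 • KDEAttention.rescale Q)
                (Real.sqrt 2 • KDEAttention.rescale K) (KDEAttention.softmaxWeights Q K) 1 τ))}
      ≤ ENNReal.ofReal ((n : ℝ) ^ (-c)) := by
  refine ⟨KDEAttention.attentionAlg, fun τ C₀ c hτ hC₀ hc =>
    -- The exponent `c + 4` pays for the union bound over at most `n` rounds with `n` queries each
    -- and leaves `n^{-c-2}`; the summand `1728 * (c + 3)` serves the sample size and the rest the
    -- running time.
    ⟨KDEAttention.timeConst τ C₀ + 1000 + 1728 * (c + 3), c + 4, ?_, by positivity, ?_⟩⟩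
  · unfold KDEAttention.timeConst
    positivity
  intro 𝒦 hfast n d hn hd Q K V ε hε m hm
  rcases Nat.lt_or_ge n 2 with hn2 | hn2
  -- Here `log n = 0`, so `m` may be `0`, but failure with probability `1` is allowed.
  · obtain rfl : n = 1 := by omega
    refine ⟨0, ?_⟩
    rw [Nat.cast_one, Real.one_rpow, ENNReal.ofReal_one]
    exact KDEAttention.GoodRun.of_one_le le_rfl
  · have hpos : 0 < KDEAttention.timeConst τ C₀ := by
      unfold KDEAttention.timeConst
      positivity
    have hS : 0 < KDEAttention.srank (KDEAttention.softmaxMatrix Q K) + KDEAttention.srank V :=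
      add_pos_of_pos_of_nonneg (KDEAttention.srank_softmaxMatrix_pos hn Q K)
        (KDEAttention.srank_nonneg V)
    have hlog : 0 < Real.log n := Real.log_pos (by exact_mod_cast hn2)
    have hm0 : 0 < m := by
      have h1 : (0 : ℝ) < m := lt_of_lt_of_le (by positivity) hm
      exact_mod_cast h1
    -- No loop runs more often than the largest of `3n`, `d` and `m`, the table multiplicities being
    -- at most `3n`; one more test is needed to leave a loop.
    refine ⟨3 * n + d + m + 1, ?_⟩
    refine ((KDEAttention.attentionAlg_spec (F := 3 * n + d + m + 1) (V := V) (Q := Q) (K := K)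
      hfast hn2 hd hm0 hτ hC₀ hε (by omega) (by omega) (by omega)).mono (fun s hs => ?_)
      (KDEAttention.failure_le hn2 hε hS (by linarith) hm) :
        KDEAttention.Good 𝒦 _ KDEAttention.attentionAlg _ _ _)
    obtain ⟨⟨h1, h2, h3⟩, h4⟩ := hs
    refine ⟨h1, h2, h3, h4.trans ?_⟩
    refine mul_le_mul_of_nonneg_right (by linarith) ?_
    have h5 := KDEAttention.kdeCost_nonneg (KDEAttention.rescale K) (KDEAttention.rescale Q) 1 ε τ
    have h6 := KDEAttention.kdeCost_nonneg (Real.sqrt 2 • KDEAttention.rescale Q)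
      (Real.sqrt 2 • KDEAttention.rescale K) (KDEAttention.softmaxWeights Q K) 1 τ
    unfold KDEAttention.attnTime
    positivity
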